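/- Let $a<b$, $\theta=(a+b)/2$, $0<\varepsilon<(b-a)/2$, $\theta_\pm=\theta\pm\varepsilon$, and $I=[a,\theta_-)\cup(\theta_-,\theta_+)\cup(\theta_+,b]$. Let $q:I\to\mathbb R$ be continuous with finite one-sided limits at $\theta_-$ and $\theta_+$, and let $\beta_1,\beta_2,\alpha_1,\alpha_2,\alpha_1',\alpha_2',\delta,\gamma\in\mathbb R$ with $|\beta_1|+|\beta_2|\ne0$, $\delta\ne0$, $\gamma\ne0$ and $\alpha_1'\alpha_2-\alpha_1\alpha_2'>0$. For $\lambda\in\mathbb C$ let $\phi_\lambda$ and $\chi_\lambda$ be the solutions of $-u''+qu=\lambda u$ on $I$ that satisfy the transmission conditions $$u^{(k)}(\theta_--)=\delta u^{(k)}(\theta_-+),\qquad \delta u^{(k)}(\theta_+-)=\gamma u^{(k)}(\theta_++)\qquad(k=0,1)$$ and, respectively, $\phi_\lambda(a)=\beta_2$, $\phi_\lambda'(a)=-\beta_1$, and $\chi_\lambda(b)=\lambda\alpha_2'+\alpha_2$, $\chi_\lambda'(b)=\lambda\alpha_1'+\alpha_1$. Let $\omega(\lambda)=\phi_\lambda\chi_\lambda'-\phi_\lambda'\chi_\lambda$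 be their Wronskian on $[a,\theta_-)$, which does not depend on $x$, and let $$G(x,y,\lambda)=\frac1{\omega(\lambda)}\begin{cases}\chi_\lambda(x)\phi_\lambda(y),& y\le x,\\ \chi_\lambda(y)\phi_\lambda(x),& x\le y,\end{cases}\qquad x,y\in I,$$ be Green's function. Then the zeros of $\omega$ form a strictly increasing sequence of real numbers $\lambda_0<\lambda_1<\dots$, all simple, and the canonical product $\tilde\omega(\lambda)=\prod_n(1-\lambda/\lambda_n)$ converges for every $\lambda$ (if some $\lambda_k=0$, the factor with $n=k$ is replaced by $\lambda$). Let $\Omega$ be either $\omega$ or $\tilde\omega$, let $y_0\in I$ and $g\in L_2(a,b)$, let $G(x,\lambda)=\Omega(\lambda)G(x,y_0,\lambda)$, which extends for each $x\in I$ to an entire function of $\lambda$, and put $$F(\lambda)=\int_a^{\theta_-}G(x,\lambda)\overline{g(x)}\,dx+\delta^2\int_{\theta_-}^{\theta_+}G(x,\lambda)\overline{g(x)}\,dx+\gamma^2\int_{\theta_+}^bG(x,\lambda)\overline{g(x)}\,dx .$$ These integrals exist. The function $F$ is entire of exponential type at most $b-a$, and so is $s\mapsto F(s^2)$; here an entire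 function $f$ is of exponential type at most $\sigma$ if for every $\eta>0$ there is $C$ with $|f(z)|\le Ce^{(\sigma+\eta)|z|}$ for all $z\in\mathbb C$. Moreover $\Omega'(\lambda_n)\ne0$ for all $n$, and $$F(\lambda)=\sum_{n=0}^\infty F(\lambda_n)\frac{\Omega(\lambda)}{(\lambda-\lambda_n)\Omega'(\lambda_n)}\qquad(\lambda\in\mathbb C),$$ where the fraction is understood as its limit $1$ at $\lambda=\lambda_n$. The series converges absolutely for every $\lambda\in\mathbb C$ and uniformly on compact subsets of $\mathbb C$. -/

import Mathlib

open Filter Topology MeasureTheory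

noncomputable section

/-- The data of the Sturm-Liouville problem `-u'' + q u = z u` on `[a, b]` with two interior points of
discontinuity `θ ± ε`, `θ = (a + b) / 2`, transmission conditions with real coefficients `δ, γ` there,
and the spectral parameter `z` in the boundary condition at `b`. -/
structure SLProblem where
  (a b ε : ℝ)
  (β₁ β₂ α₁ α₂ α₁' α₂' δ γ : ℝ)
  q : ℝ → ℝ
  ε_pos : 0 < ε
  ε_lt : ε < (b - a) / 2
  β_ne : |β₁| + |β₂| ≠ 0
  δ_ne : δ ≠ 0
  γ_ne : γ ≠ 0
  ρ_pos : 0 < α₁' * α₂ - α₁ * α₂'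
  q_cont_left : ContinuousOn q (Set.Ico a ((a + b) / 2 - ε))
  q_cont_mid : ContinuousOn q (Set.Ioo ((a + b) / 2 - ε) ((a + b) / 2 + ε))
  q_cont_right : ContinuousOn q (Set.Ioc ((a + b) / 2 + ε) b)
  q_lim₁ : ∃ l, Tendsto q (𝓝[<] ((a + b) / 2 - ε)) (𝓝 l)
  q_lim₂ : ∃ l, Tendsto q (𝓝[>] ((a + b) / 2 - ε)) (𝓝 l)
  q_lim₃ : ∃ l, Tendsto q (𝓝[<] ((a + b) / 2 + ε)) (𝓝 l)
  q_lim₄ : ∃ l, Tendsto q (𝓝[>] ((a + b) / 2 + ε)) (𝓝 l)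

namespace SLProblem

variable (P : SLProblem)

/-- The left point of discontinuity. -/
def θm : ℝ := (P.a + P.b) / 2 - P.ε

/-- The right point of discontinuity. -/
def θp : ℝ := (P.a + P.b) / 2 + P.ε

/-- `I = [a, θ₋) ∪ (θ₋, θ₊) ∪ (θ₊, b]`. -/
def I : Set ℝ := Set.Ico P.a P.θm ∪ Set.Ioo P.θm P.θp ∪ Set.Ioc P.θp P.b

/-- `u`, with derivative `u'`, solves `-u'' + q u = z u` on `I` (one-sided derivatives at `a`, `b`). -/
def IsSolution (z : ℂ) (u u' : ℝ → ℂ) : Prop :=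
  ∀ x ∈ P.I, HasDerivWithinAt u (u' x) P.I x ∧
    HasDerivWithinAt u' (((P.q x : ℂ) - z) * u x) P.I x

/-- `u` has finite one-sided limits at `p`, and `c * u(p-) = d * u(p+)`. -/
def JumpCondition (p : ℝ) (c d : ℂ) (u : ℝ → ℂ) : Prop :=
  ∃ l r : ℂ, Tendsto u (𝓝[<] p) (𝓝 l) ∧ Tendsto u (𝓝[>] p) (𝓝 r) ∧ c * l = d * r

/-- The four transmission conditions `u(θ₋-) = δ u(θ₋+)`, `δ u(θ₊-) = γ u(θ₊+)`, and the same
for `u'`. -/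
def Transmission (u u' : ℝ → ℂ) : Prop :=
  JumpCondition P.θm 1 P.δ u ∧ JumpCondition P.θm 1 P.δ u' ∧
  JumpCondition P.θp P.δ P.γ u ∧ JumpCondition P.θp P.δ P.γ u'

/-- The pair `(u, u')` is the solution with `u(a) = β₂`, `u'(a) = -β₁`, continued from left to right
by the transmission conditions. -/
def IsPhi (z : ℂ) (w : (ℝ → ℂ) × (ℝ → ℂ)) : Prop :=
  P.IsSolution z w.1 w.2 ∧ P.Transmission w.1 w.2 ∧ w.1 P.a = P.β₂ ∧ w.2 P.a = -P.β₁

/-- The pair `(u, u')` is the solution with `u(b) = z α₂' + α₂`, `u'(b) = z α₁' + α₁`, continued from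
right to left by the transmission conditions. -/
def IsChi (z : ℂ) (w : (ℝ → ℂ) × (ℝ → ℂ)) : Prop :=
  P.IsSolution z w.1 w.2 ∧ P.Transmission w.1 w.2 ∧
    w.1 P.b = z * P.α₂' + P.α₂ ∧ w.2 P.b = z * P.α₁' + P.α₁

/-- The solution `φ_z` with its derivative: the pair satisfying `IsPhi`, which exists and is unique
on `I` by the theory of linear differential equations. -/
def phiPair (z : ℂ) : (ℝ → ℂ) × (ℝ → ℂ) := Classical.epsilon (P.IsPhi z)

/-- The solution `χ_z` with its derivative: the pair satisfying `IsChi`, unique on `I`. -/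
def chiPair (z : ℂ) : (ℝ → ℂ) × (ℝ → ℂ) := Classical.epsilon (P.IsChi z)

def phi (z : ℂ) (x : ℝ) : ℂ := (P.phiPair z).1 x
def phi' (z : ℂ) (x : ℝ) : ℂ := (P.phiPair z).2 x
def chi (z : ℂ) (x : ℝ) : ℂ := (P.chiPair z).1 x
def chi' (z : ℂ) (x : ℝ) : ℂ := (P.chiPair z).2 x

/-- `ω(z)`: the Wronskian `φ χ' - φ' χ` on `[a, θ₋)`, where it is constant in `x`, taken at `a`. -/
def omega (z : ℂ) : ℂ := P.phi z P.a * P.chi' z P.a - P.phi' z P.a * P.chi z P.a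

/-- Green's function `G(x, y, z)`; it has poles at the zeros of `ω`, where the value here is `0`. -/
def green (x y : ℝ) (z : ℂ) : ℂ :=
  (1 / P.omega z) * (if y ≤ x then P.chi z x * P.phi z y else P.chi z y * P.phi z x)

/-- `G(x, z) = Ω(z) G(x, y₀, z)`, with the removable singularities at the poles of Green's function
removed. -/
def regGreen (Ω : ℂ → ℂ) (y₀ x : ℝ) (z : ℂ) : ℂ :=
  limUnder (𝓝[≠] z) (fun s => Ω s * P.green x y₀ s)

/-- `F(z) = ∫ G(x, z) conj (g x) dx` with weights `1`, `δ²`, `γ²` on the three subintervals. -/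
def transform (Ω : ℂ → ℂ) (y₀ : ℝ) (g : ℝ → ℂ) (z : ℂ) : ℂ :=
  (∫ x in P.a..P.θm, P.regGreen Ω y₀ x z * (starRingEnd ℂ) (g x)) +
  (P.δ : ℂ) ^ 2 * (∫ x in P.θm..P.θp, P.regGreen Ω y₀ x z * (starRingEnd ℂ) (g x)) +
  (P.γ : ℂ) ^ 2 * (∫ x in P.θp..P.b, P.regGreen Ω y₀ x z * (starRingEnd ℂ) (g x))

end SLProblem

/-- The factor of the canonical product at the zero `lam n`: `1 - z / lam n`, or `z` if `lam n = 0`. -/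
def canonicalFactor (lam : ℕ → ℝ) (z : ℂ) (n : ℕ) : ℂ :=
  if lam n = 0 then z else 1 - z / (lam n : ℂ)

/-- The canonical product with the (simple) zeros `lam n`: `∏ (1 - z / lam n)` if no `lam n` vanishes,
`z * ∏_{lam n ≠ 0} (1 - z / lam n)` otherwise. -/
def canonicalProduct (lam : ℕ → ℝ) (z : ℂ) : ℂ := ∏' n, canonicalFactor lam z n

/-- `f` is entire of exponential type (at most) `σ`:
`f` is entire and `limsup_{r → ∞} log (max_{|z| = r} |f z|) / r ≤ σ`. -/
def EntireOfExpType (σ : ℝ) (f : ℂ → ℂ) : Prop :=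
  Differentiable ℂ f ∧ ∀ η > 0, ∃ C : ℝ, ∀ z : ℂ, ‖f z‖ ≤ C * Real.exp ((σ + η) * ‖z‖)

/-- The sampling function `Ω(z) / ((z - c) Ω'(c))` at a simple zero `c` of `Ω`, with its limit `1`
at `z = c`. -/
def samplingFun (Ω : ℂ → ℂ) (c z : ℂ) : ℂ :=
  if z = c then 1 else Ω z / ((z - c) * deriv Ω c)

end

/-! Multiplying by the step function `weight` (1, δ, γ on the three pieces) turns the transmission
conditions into continuity of u and u'. So the problem becomes one on all of [a, b] without jumps,
`regular`, whose potential is bounded and continuous off two points. Under this change ω is γ times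
the regular Wronskian `wr`, and F is a constant times the transform `trans` of weight · ḡ. Sampling
functions do not see a constant factor of Ω, so both choices of Ω reduce to `wr`, once `wr` is known
to be a constant times its canonical product.

The regular problem is symmetric in L²(a, b) ⊕ ℂ with weight ρ = α₁'α₂ − α₁α₂' on the second
component, but no spectral theorem is invoked. Everything rests on Lagrange's identity and the
energy identity for functions equal to Aψ left of y and Bχ right of y (`glue`), a class containing
both the eigenfunctions and Green's function. They show that the zeros of `wr` are real, bounded
below and simple, that eigenvectors are orthogonal, that wr'(l) k̄ is the squared norm of the
eigenvector when ψ = kχ, and that the norm of Green's vector at z is at most a constant times (1 +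
|z|)^(1/4) / |Im z| (`exists_nsq_green_le`).

For the sampling formula, let D be the transform minus the series. It vanishes at every zero of
`wr`, so D = H · wr with H entire. Off the real axis H is an integral against Green's function minus
a series of products of Fourier coefficients, and Cauchy–Schwarz and Bessel bound both by the norm
of Green's vector times that of h. Hence |H(z)| |Im z| ≤ C √(1 + |z|), and the maximum principle
forces H = 0 (`eq_zero_of_norm_mul_abs_im_le`). The spectrum is infinite, since otherwise Green's
function would be a finite sum of eigenfunctions, although its derivative jumps.

Gronwall's inequality bounds solutions at z = s² by an exponential in |s|, which gives the
exponential type. It also gives `wr` growth of order 1/2. Dividing out the first n zeros then leaves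
a function that is zero-free on a disc of radius λₙ and has logarithm O(√λₙ) there, so by
Borel–Carathéodory it tends to a constant: this is the factorization
`exists_eq_mul_canonicalProduct`. -/

noncomputable section

/-! ### Volterra operators -/

section Volterra

variable {E : Type*} [NormedAddCommGroup E] [NormedSpace ℂ E]
  {a b : ℝ} (hab : a ≤ b)

lemma intervalIntegrable_clm_apply {A : ℝ → E →L[ℂ] E} (hA : StronglyMeasurable A) {K : ℝ}
    (hK : ∀ t, ‖A t‖ ≤ K) {f : ℝ → E} (hf : Continuous f) (c d : ℝ) :
    IntervalIntegrable (fun t => A t (f t)) volume c d := by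
  have hm : AEStronglyMeasurable (fun t => A t (f t)) volume :=
    (ContinuousLinearMap.id ℂ (E →L[ℂ] E)).aestronglyMeasurable_comp₂ hA.aestronglyMeasurable
      hf.aestronglyMeasurable
  refine IntervalIntegrable.mono_fun (g := fun t => A t (f t)) (f := fun t => K * ‖f t‖)
    ((continuous_const.mul hf.norm).intervalIntegrable c d) hm.restrict ?_
  refine Eventually.of_forall fun t => ?_
  have h1 : ‖A t (f t)‖ ≤ K * ‖f t‖ := (A t).le_of_opNorm_le (hK t) (f t)
  exact h1.trans (le_abs_self _)

/-- The Volterra operator `f ↦ ∫_a^x A(t) f(t) dt` on continuous functions. -/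
def volterra {A : ℝ → E →L[ℂ] E} (hA : StronglyMeasurable A) {K : ℝ} (hK : ∀ t, ‖A t‖ ≤ K) :
    C(Set.Icc a b, E) →L[ℂ] C(Set.Icc a b, E) :=
  LinearMap.mkContinuous
    { toFun := fun f => ⟨fun x => ∫ t in a..(x : ℝ), A t (Set.IccExtend hab f t),
        (intervalIntegral.continuous_primitive (fun c d =>
          intervalIntegrable_clm_apply hA hK (f.continuous.Icc_extend' (h := hab)) c d) a).comp
          continuous_subtype_val⟩
      map_add' := fun f g => by
        ext x
        simp only [ContinuousMap.coe_mk, ContinuousMap.add_apply]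
        rw [← intervalIntegral.integral_add
          (intervalIntegrable_clm_apply hA hK (f.continuous.Icc_extend' (h := hab)) _ _)
          (intervalIntegrable_clm_apply hA hK (g.continuous.Icc_extend' (h := hab)) _ _)]
        refine intervalIntegral.integral_congr fun t _ => ?_
        simp [Set.IccExtend]
      map_smul' := fun c f => by
        ext x
        simp only [ContinuousMap.coe_mk, ContinuousMap.smul_apply, RingHom.id_apply]
        rw [← intervalIntegral.integral_smul]
        refine intervalIntegral.integral_congr fun t _ => ?_
        simp [Set.IccExtend] }
    (K * (b - a)) (fun f => by
      have hK0 : 0 ≤ K := (norm_nonneg _).trans (hK a)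
      have hba : 0 ≤ b - a := sub_nonneg.2 hab
      refine (ContinuousMap.norm_le _ (by positivity)).2 fun x => ?_
      have h1 : ‖∫ t in a..(x : ℝ), A t (Set.IccExtend hab f t)‖ ≤ K * ‖f‖ * |(x : ℝ) - a| := by
        refine intervalIntegral.norm_integral_le_of_norm_le_const fun t _ => ?_
        exact ((A t).le_of_opNorm_le (hK t) _).trans
          (mul_le_mul_of_nonneg_left (f.norm_coe_le_norm _) hK0)
      rw [abs_of_nonneg (sub_nonneg.2 x.2.1)] at h1
      refine h1.trans ?_
      have : (x : ℝ) - a ≤ b - a := by linarith [x.2.2]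
      calc K * ‖f‖ * ((x : ℝ) - a) ≤ K * ‖f‖ * (b - a) := by gcongr
        _ = K * (b - a) * ‖f‖ := by ring)

lemma volterra_apply {A : ℝ → E →L[ℂ] E} (hA : StronglyMeasurable A) {K : ℝ}
    (hK : ∀ t, ‖A t‖ ≤ K) (f : C(Set.Icc a b, E)) (x : Set.Icc a b) :
    volterra hab hA hK f x = ∫ t in a..(x : ℝ), A t (Set.IccExtend hab f t) := rfl

/-- Each application integrates the previous power of K(x − a), which produces the factorial. T is
given by its pointwise formula so that a combination of Volterra operators, such as `sysVolterra`,
is covered as well. -/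
lemma norm_pow_apply_le_of_volterra {A : ℝ → E →L[ℂ] E} {K : ℝ} (hK : ∀ t, ‖A t‖ ≤ K)
    {T : C(Set.Icc a b, E) →L[ℂ] C(Set.Icc a b, E)}
    (hT : ∀ f (x : Set.Icc a b), T f x = ∫ t in a..(x : ℝ), A t (Set.IccExtend hab f t))
    (f : C(Set.Icc a b, E)) (n : ℕ) (x : Set.Icc a b) :
    ‖(T ^ n) f x‖ ≤ (K * ((x : ℝ) - a)) ^ n / n.factorial * ‖f‖ := by
  have hK0 : 0 ≤ K := (norm_nonneg _).trans (hK a)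
  induction n generalizing x with
  | zero => simpa using f.norm_coe_le_norm x
  | succ n ih =>
    rw [pow_succ', mul_apply_eq_comp, hT]
    have hax : a ≤ (x : ℝ) := x.2.1
    have h1 : ‖∫ t in a..(x : ℝ), A t (Set.IccExtend hab ((T ^ n) f) t)‖ ≤
        ∫ t in a..(x : ℝ), K * ((K * (t - a)) ^ n / n.factorial * ‖f‖) := by
      refine intervalIntegral.norm_integral_le_of_norm_le hax ?_
        (Continuous.intervalIntegrable (by fun_prop) _ _)
      refine Eventually.of_forall fun t ht => ?_
      have htm : t ∈ Set.Icc a b := ⟨ht.1.le, ht.2.trans x.2.2⟩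
      rw [Set.IccExtend_of_mem hab _ htm]
      exact ((A t).le_of_opNorm_le (hK t) _).trans
        (mul_le_mul_of_nonneg_left (ih ⟨t, htm⟩) hK0)
    refine h1.trans (le_of_eq ?_)
    have h2 : ∀ t : ℝ, K * ((K * (t - a)) ^ n / n.factorial * ‖f‖)
        = (K ^ (n + 1) / n.factorial * ‖f‖) * (t - a) ^ n := fun t => by
      rw [mul_pow]; ring
    simp_rw [h2]
    rw [intervalIntegral.integral_const_mul, intervalIntegral.integral_comp_sub_right
      (fun t => t ^ n), integral_pow, Nat.factorial_succ]
    have : (n.factorial : ℝ) ≠ 0 := by positivity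
    push_cast
    rw [mul_pow]
    simp
    field_simp

/-- The factorial makes some power Tⁿ a strict contraction, so 1 − Tⁿ is invertible. It is the
product of 1 − T and a geometric sum commuting with it, so 1 − T is invertible too. -/
lemma isUnit_one_sub_of_volterra [CompleteSpace E] {A : ℝ → E →L[ℂ] E} {K : ℝ} (hK : ∀ t, ‖A t‖ ≤ K)
    {T : C(Set.Icc a b, E) →L[ℂ] C(Set.Icc a b, E)}
    (hT : ∀ f (x : Set.Icc a b), T f x = ∫ t in a..(x : ℝ), A t (Set.IccExtend hab f t)) :
    IsUnit (1 - T) := by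
  have hK0 : 0 ≤ K := (norm_nonneg _).trans (hK a)
  have hba : 0 ≤ b - a := sub_nonneg.2 hab
  obtain ⟨n, hn⟩ := ((FloorSemiring.tendsto_pow_div_factorial_atTop (K * (b - a))).eventually
    (gt_mem_nhds one_pos)).exists
  have hTn : ‖T ^ n‖ < 1 := by
    refine lt_of_le_of_lt (ContinuousLinearMap.opNorm_le_bound _ (by positivity) fun f => ?_) hn
    refine (ContinuousMap.norm_le _ (by positivity)).2 fun x => ?_
    refine (norm_pow_apply_le_of_volterra hab hK hT f n x).trans ?_
    have h0 : 0 ≤ (x : ℝ) - a := sub_nonneg.2 x.2.1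
    have h1 : (x : ℝ) - a ≤ b - a := by linarith [x.2.2]
    gcongr
  have h : IsUnit (1 - T ^ n) := isUnit_one_sub_of_norm_lt_one
    (R := C(Set.Icc a b, E) →L[ℂ] C(Set.Icc a b, E)) hTn
  rw [← mul_neg_geom_sum] at h
  refine ((Commute.isUnit_mul_iff ?_).1 h).1
  exact (Commute.one_left _).sub_left (Commute.sum_right _ _ _ fun i _ => Commute.self_pow T i)

end Volterra

/-- Gronwall's inequality in integral form. -/
lemma le_mul_exp_of_le_add_integral {a b A K : ℝ} (hK : 0 ≤ K) {f : ℝ → ℝ}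
    (hf : Continuous f)
    (h : ∀ x ∈ Set.Icc a b, f x ≤ A + K * ∫ t in a..x, f t) {x : ℝ} (hx : x ∈ Set.Icc a b) :
    f x ≤ A * Real.exp (K * (x - a)) := by
  set Φ : ℝ → ℝ := fun x => A + K * ∫ t in a..x, f t with hΦ
  have hd : ∀ y, HasDerivAt Φ (K * f y) y := fun y =>
    ((intervalIntegral.integral_hasDerivAt_right (hf.intervalIntegrable _ _)
      hf.stronglyMeasurable.stronglyMeasurableAtFilter hf.continuousAt).const_mul K).const_add A
  have hd2 : ∀ y, HasDerivAt (fun y => Φ y * Real.exp (-(K * (y - a))))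
      (K * f y * Real.exp (-(K * (y - a))) + Φ y * (Real.exp (-(K * (y - a))) * (-(K * 1)))) y :=
    fun y => (hd y).mul ((((hasDerivAt_id y).sub_const a).const_mul K).neg.exp)
  have hanti : AntitoneOn (fun y => Φ y * Real.exp (-(K * (y - a)))) (Set.Icc a b) := by
    refine antitoneOn_of_deriv_nonpos (convex_Icc a b)
      (fun y _ => (hd2 y).continuousAt.continuousWithinAt)
      (fun y _ => (hd2 y).differentiableAt.differentiableWithinAt) fun y hy => ?_
    rw [interior_Icc] at hy
    rw [(hd2 y).deriv]
    have h1 := h y ⟨hy.1.le, hy.2.le⟩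
    have h2 : 0 ≤ K * (Φ y - f y) * Real.exp (-(K * (y - a))) :=
      mul_nonneg (mul_nonneg hK (sub_nonneg.2 h1)) (Real.exp_pos _).le
    nlinarith
  have h3 := hanti (Set.left_mem_Icc.2 (hx.1.trans hx.2)) hx hx.1
  simp only [sub_self, mul_zero, neg_zero, Real.exp_zero, mul_one] at h3
  have h4 : Φ a = A := by simp [hΦ]
  rw [h4, Real.exp_neg, ← div_eq_mul_inv, div_le_iff₀ (Real.exp_pos _)] at h3
  exact (h x hx).trans h3

lemma differentiable_inverse_one_sub_affine {R : Type*} [NormedRing R] [NormedAlgebra ℂ R]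
    [HasSummableGeomSeries R] {V W : R} (h : ∀ z : ℂ, IsUnit (1 - (V - z • W))) :
    Differentiable ℂ fun z : ℂ => Ring.inverse (1 - (V - z • W)) := by
  intro z
  have h1 : DifferentiableAt ℂ (fun z : ℂ => 1 - (V - z • W)) z := by fun_prop
  exact (differentiableAt_inverse (h z)).comp z h1

/-- A bounded measurable potential on `[a, b]`, continuous off a countable set. -/
structure Potential where
  (a b bound : ℝ)
  Q : ℝ → ℝ
  S : Set ℝ
  a_lt_b : a < b
  measurable : Measurable Q
  abs_le : ∀ x, |Q x| ≤ bound
  countable : S.Countable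
  continuousWithinAt : ∀ x ∈ Set.Icc a b \ S, ContinuousWithinAt Q (Set.Icc a b) x

/-! ### Initial value problems for a bounded potential -/

namespace Potential

variable (p : Potential)

lemma a_le_b : p.a ≤ p.b := p.a_lt_b.le

lemma bound_nonneg : 0 ≤ p.bound := (abs_nonneg _).trans (p.abs_le 0)

/-- `u`, with derivative `u'`, is a Carathéodory solution of `-u'' + Q u = z u` on `[a, b]`. -/
structure IsSol (z : ℂ) (u u' : ℝ → ℂ) : Prop where
  cont : ContinuousOn u (Set.Icc p.a p.b)
  cont' : ContinuousOn u' (Set.Icc p.a p.b)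
  deriv : ∀ x ∈ Set.Icc p.a p.b \ p.S, HasDerivWithinAt u (u' x) (Set.Icc p.a p.b) x
  deriv' : ∀ x ∈ Set.Icc p.a p.b \ p.S,
    HasDerivWithinAt u' (((p.Q x : ℂ) - z) * u x) (Set.Icc p.a p.b) x

variable {p}

/-- The fundamental theorem of calculus tolerates a countable exceptional set for a continuous
function; this is what lets the potential be discontinuous on `S`. -/
lemma integral_eq_sub {E : Type*} [NormedAddCommGroup E] [NormedSpace ℝ E] [CompleteSpace E]
    {f f' : ℝ → E} {c d : ℝ} (hcd : c ≤ d) (hc : p.a ≤ c) (hd : d ≤ p.b)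
    (hf : ContinuousOn f (Set.Icc p.a p.b))
    (hf' : ∀ x ∈ Set.Icc p.a p.b \ p.S, HasDerivWithinAt f (f' x) (Set.Icc p.a p.b) x)
    (hi : IntervalIntegrable f' volume c d) : ∫ x in c..d, f' x = f d - f c := by
  refine integral_eq_of_hasDerivAt_off_countable_of_le f f' hcd p.countable
    (hf.mono (Set.Icc_subset_Icc hc hd)) (fun x hx => ?_) hi
  have h1 : p.a < x := hc.trans_lt hx.1.1
  have h2 : x < p.b := hx.1.2.trans_le hd
  exact (hf' x ⟨⟨h1.le, h2.le⟩, hx.2⟩).hasDerivAt (Icc_mem_nhds h1 h2)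

lemma intervalIntegrable_mul {m f : ℝ → ℂ} (hm : Measurable m) {K : ℝ} (hK : ∀ x, ‖m x‖ ≤ K)
    {c d : ℝ} (hcd : c ≤ d) (hf : ContinuousOn f (Set.Icc c d)) :
    IntervalIntegrable (fun x => m x * f x) volume c d := by
  have h1 : IntervalIntegrable f volume c d :=
    ContinuousOn.intervalIntegrable (by rwa [Set.uIcc_of_le hcd])
  rw [intervalIntegrable_iff] at h1 ⊢
  exact h1.bdd_mul hm.aestronglyMeasurable (Eventually.of_forall hK)

lemma measurable_coeff (z : ℂ) : Measurable fun x => ((p.Q x : ℂ) - z) :=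
  (Complex.measurable_ofReal.comp p.measurable).sub_const z

lemma norm_coeff_le (z : ℂ) (x : ℝ) : ‖(p.Q x : ℂ) - z‖ ≤ p.bound + ‖z‖ := by
  refine (norm_sub_le _ _).trans ?_
  rw [Complex.norm_real]
  exact add_le_add_left (p.abs_le x) _

lemma IsSol.intervalIntegrable {z : ℂ} {u u' : ℝ → ℂ} (h : p.IsSol z u u') {c d : ℝ}
    (hcd : c ≤ d) (hc : p.a ≤ c) (hd : d ≤ p.b) :
    IntervalIntegrable (fun x => ((p.Q x : ℂ) - z) * u x) volume c d :=
  intervalIntegrable_mul (measurable_coeff z) (norm_coeff_le z) hcd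
    (h.cont.mono (Set.Icc_subset_Icc hc hd))

lemma IsSol.integral_deriv {z : ℂ} {u u' : ℝ → ℂ} (h : p.IsSol z u u') {x : ℝ}
    (hx : x ∈ Set.Icc p.a p.b) : ∫ t in p.a..x, u' t = u x - u p.a :=
  integral_eq_sub hx.1 le_rfl hx.2 h.cont h.deriv
    (ContinuousOn.intervalIntegrable (by
      rw [Set.uIcc_of_le hx.1]; exact h.cont'.mono (Set.Icc_subset_Icc le_rfl hx.2)))

lemma IsSol.integral_deriv' {z : ℂ} {u u' : ℝ → ℂ} (h : p.IsSol z u u') {x : ℝ}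
    (hx : x ∈ Set.Icc p.a p.b) :
    ∫ t in p.a..x, ((p.Q t : ℂ) - z) * u t = u' x - u' p.a :=
  integral_eq_sub hx.1 le_rfl hx.2 h.cont' h.deriv' (h.intervalIntegrable hx.1 le_rfl hx.2)

/-- `(u, v) ↦ (v, 0)`. -/
def shiftUp : ℂ × ℂ →L[ℂ] ℂ × ℂ :=
  (ContinuousLinearMap.inl ℂ ℂ ℂ).comp (ContinuousLinearMap.snd ℂ ℂ ℂ)

/-- `(u, v) ↦ (0, u)`. -/
def shiftDown : ℂ × ℂ →L[ℂ] ℂ × ℂ :=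
  (ContinuousLinearMap.inr ℂ ℂ ℂ).comp (ContinuousLinearMap.fst ℂ ℂ ℂ)

lemma norm_shiftUp_le : ‖shiftUp‖ ≤ 1 :=
  ContinuousLinearMap.opNorm_le_bound _ zero_le_one fun v => by
    simp [shiftUp, Prod.norm_def]

lemma norm_shiftDown_le : ‖shiftDown‖ ≤ 1 :=
  ContinuousLinearMap.opNorm_le_bound _ zero_le_one fun v => by
    simp [shiftDown, Prod.norm_def]

variable (p) in
/-- The matrix of the first order system for `z = 0`. -/
def sysZero (t : ℝ) : ℂ × ℂ →L[ℂ] ℂ × ℂ := shiftUp + (p.Q t : ℂ) • shiftDown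

lemma stronglyMeasurable_sysZero : StronglyMeasurable p.sysZero :=
  stronglyMeasurable_const.add
    ((Complex.measurable_ofReal.comp p.measurable).stronglyMeasurable.smul_const _)

lemma norm_sysZero_le (t : ℝ) : ‖p.sysZero t‖ ≤ 1 + p.bound := by
  refine (norm_add_le _ _).trans (add_le_add norm_shiftUp_le ?_)
  rw [norm_smul, Complex.norm_real]
  calc ‖p.Q t‖ * ‖shiftDown‖ ≤ p.bound * 1 :=
        mul_le_mul (p.abs_le t) norm_shiftDown_le (norm_nonneg _) p.bound_nonneg
    _ = p.bound := mul_one _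

variable (p) in
/-- The Volterra operator of the first order system, affine in the spectral parameter. -/
def sysVolterra (z : ℂ) :
    C(Set.Icc p.a p.b, ℂ × ℂ) →L[ℂ] C(Set.Icc p.a p.b, ℂ × ℂ) :=
  volterra p.a_le_b p.stronglyMeasurable_sysZero p.norm_sysZero_le -
    z • volterra p.a_le_b (A := fun _ => shiftDown) stronglyMeasurable_const
      (fun _ => norm_shiftDown_le)

lemma sysVolterra_apply (z : ℂ) (f : C(Set.Icc p.a p.b, ℂ × ℂ)) (x : Set.Icc p.a p.b) :
    p.sysVolterra z f x =
      ∫ t in p.a..(x : ℝ), (p.sysZero t - z • shiftDown) (Set.IccExtend p.a_le_b f t) := by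
  have hf := f.continuous.Icc_extend' (h := p.a_le_b)
  simp only [sysVolterra, sub_apply, smul_apply,
    ContinuousMap.sub_apply, ContinuousMap.smul_apply, volterra_apply]
  rw [← intervalIntegral.integral_smul, ← intervalIntegral.integral_sub
    (intervalIntegrable_clm_apply p.stronglyMeasurable_sysZero p.norm_sysZero_le hf _ _)]
  exact Continuous.intervalIntegrable (by fun_prop) _ _

lemma isUnit_one_sub_sysVolterra (z : ℂ) : IsUnit (1 - p.sysVolterra z) := by
  refine isUnit_one_sub_of_volterra p.a_le_b (A := fun t => p.sysZero t - z • shiftDown)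
    (K := 1 + p.bound + ‖z‖) (fun t => ?_) (sysVolterra_apply z)
  refine (norm_sub_le _ _).trans (add_le_add (norm_sysZero_le t) ?_)
  rw [norm_smul]
  exact mul_le_of_le_one_right (norm_nonneg _) norm_shiftDown_le

variable (p) in
/-- The solution of the initial value problem at `a`, as a continuous function on `[a, b]`. -/
def solMap (z : ℂ) (v : ℂ × ℂ) : C(Set.Icc p.a p.b, ℂ × ℂ) :=
  Ring.inverse (1 - p.sysVolterra z) (ContinuousMap.const _ v)

/-- The Volterra operator is affine in z, so its resolvent is entire in operator norm. The values
lie in C([a, b]), so every bounded functional of the solution, pointwise or integral, is then entire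
in z. -/
lemma differentiable_solMap {v : ℂ → ℂ × ℂ} (hv : Differentiable ℂ v) :
    Differentiable ℂ fun z => p.solMap z (v z) := by
  intro z
  have h2 : DifferentiableAt ℂ (fun z => Ring.inverse (1 - p.sysVolterra z)) z :=
    differentiable_inverse_one_sub_affine
      (R := C(Set.Icc p.a p.b, ℂ × ℂ) →L[ℂ] C(Set.Icc p.a p.b, ℂ × ℂ))
      (V := volterra p.a_le_b p.stronglyMeasurable_sysZero p.norm_sysZero_le)
      (W := volterra p.a_le_b (A := fun _ => shiftDown) stronglyMeasurable_const
        (fun _ => norm_shiftDown_le)) (fun z => isUnit_one_sub_sysVolterra (p := p) z) z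
  have h3 : DifferentiableAt ℂ
      (fun z => (ContinuousMap.const (Set.Icc p.a p.b) (v z) : C(Set.Icc p.a p.b, ℂ × ℂ))) z := by
    have : (fun z => (ContinuousMap.const (Set.Icc p.a p.b) (v z) : C(Set.Icc p.a p.b, ℂ × ℂ))) =
        fun z => (v z).1 • ContinuousMap.const (Set.Icc p.a p.b) ((1, 0) : ℂ × ℂ) +
          (v z).2 • ContinuousMap.const (Set.Icc p.a p.b) ((0, 1) : ℂ × ℂ) := by
      funext z
      ext x <;> simp
    rw [this]
    have hvz := hv z
    fun_prop
  exact h2.clm_apply h3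

lemma solMap_eq (z : ℂ) (v : ℂ × ℂ) (x : Set.Icc p.a p.b) :
    p.solMap z v x = v +
      ∫ t in p.a..(x : ℝ),
        (p.sysZero t - z • shiftDown) (Set.IccExtend p.a_le_b (p.solMap z v) t) := by
  have h : (1 - p.sysVolterra z) (p.solMap z v) = ContinuousMap.const _ v := by
    have := Ring.mul_inverse_cancel _ (isUnit_one_sub_sysVolterra (p := p) z)
    have h2 := congrArg (fun T => T (ContinuousMap.const (Set.Icc p.a p.b) v)) this
    exact h2
  have h2 : p.solMap z v x - p.sysVolterra z (p.solMap z v) x = v := congrArg (fun f => f x) h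
  rw [sysVolterra_apply] at h2
  exact eq_add_of_sub_eq h2

lemma eq_solMap (z : ℂ) (v : ℂ × ℂ) {f : C(Set.Icc p.a p.b, ℂ × ℂ)}
    (hf : ∀ x : Set.Icc p.a p.b, f x = v +
      ∫ t in p.a..(x : ℝ), (p.sysZero t - z • shiftDown) (Set.IccExtend p.a_le_b f t)) :
    f = p.solMap z v := by
  have h : (1 - p.sysVolterra z) f = ContinuousMap.const _ v := by
    ext x : 1
    change f x - p.sysVolterra z f x = v
    rw [sysVolterra_apply]
    exact sub_eq_of_eq_add (hf x)
  have := Ring.inverse_mul_cancel _ (isUnit_one_sub_sysVolterra (p := p) z)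
  have h2 := congrArg (fun T => T f) this
  simp only [mul_apply_eq_comp, one_apply_eq_self] at h2
  rw [← h2, h, solMap]

variable (p) in
/-- The solution of the initial value problem at `a`, extended to `ℝ` by constants. -/
def sol (z : ℂ) (v : ℂ × ℂ) (x : ℝ) : ℂ × ℂ := Set.IccExtend p.a_le_b (p.solMap z v) x

lemma continuous_sol (z : ℂ) (v : ℂ × ℂ) : Continuous (p.sol z v) :=
  (p.solMap z v).continuous.Icc_extend'

lemma sol_eq_integral (z : ℂ) (v : ℂ × ℂ) {x : ℝ} (hx : x ∈ Set.Icc p.a p.b) :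
    p.sol z v x = v + ∫ t in p.a..x, (p.sysZero t - z • shiftDown) (p.sol z v t) := by
  rw [sol, Set.IccExtend_of_mem _ _ hx, solMap_eq]
  rfl

lemma sol_left (z : ℂ) (v : ℂ × ℂ) : p.sol z v p.a = v := by
  rw [sol_eq_integral z v (Set.left_mem_Icc.2 p.a_le_b)]; simp

lemma stronglyMeasurable_sys (z : ℂ) :
    StronglyMeasurable fun t => p.sysZero t - z • shiftDown :=
  p.stronglyMeasurable_sysZero.sub stronglyMeasurable_const

lemma norm_sys_le (z : ℂ) (t : ℝ) : ‖p.sysZero t - z • shiftDown‖ ≤ 1 + p.bound + ‖z‖ := by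
  refine (norm_sub_le _ _).trans (add_le_add (norm_sysZero_le t) ?_)
  rw [norm_smul]
  exact mul_le_of_le_one_right (norm_nonneg _) norm_shiftDown_le

lemma sys_apply (z : ℂ) (t : ℝ) (v : ℂ × ℂ) :
    (p.sysZero t - z • shiftDown) v = (v.2, ((p.Q t : ℂ) - z) * v.1) := by
  ext <;> simp [sysZero, shiftUp, shiftDown, sub_mul]

lemma hasDerivWithinAt_sol (z : ℂ) (v : ℂ × ℂ) {x : ℝ} (hx : x ∈ Set.Icc p.a p.b \ p.S) :
    HasDerivWithinAt (p.sol z v) ((p.sol z v x).2, ((p.Q x : ℂ) - z) * (p.sol z v x).1)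
      (Set.Icc p.a p.b) x := by
  have : Fact (x ∈ Set.Icc p.a p.b) := ⟨hx.1⟩
  have hi := fun c d => intervalIntegrable_clm_apply (stronglyMeasurable_sys (p := p) z)
    (norm_sys_le z) (continuous_sol (p := p) z v) c d
  have hc : ContinuousWithinAt (fun t => (p.sysZero t - z • shiftDown) (p.sol z v t))
      (Set.Icc p.a p.b) x := by
    simp_rw [sys_apply]
    have h1 := (continuous_sol (p := p) z v).continuousWithinAt (s := Set.Icc p.a p.b) (x := x)
    exact h1.snd.prodMk (((Complex.continuous_ofReal.continuousAt.comp_continuousWithinAt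
      (p.continuousWithinAt x hx)).sub continuousWithinAt_const).mul h1.fst)
  have hm : StronglyMeasurableAtFilter
      (fun t => (p.sysZero t - z • shiftDown) (p.sol z v t)) (𝓝[Set.Icc p.a p.b] x) volume := by
    refine AEStronglyMeasurable.stronglyMeasurableAtFilter ?_
    exact (ContinuousLinearMap.id ℂ (ℂ × ℂ →L[ℂ] ℂ × ℂ)).aestronglyMeasurable_comp₂
      (stronglyMeasurable_sys z).aestronglyMeasurable
      (continuous_sol z v).aestronglyMeasurable
  have h := (intervalIntegral.integral_hasDerivWithinAt_right
    (s := Set.Icc p.a p.b) (hi p.a x) hm hc).const_add v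
  rw [sys_apply] at h
  exact h.congr (fun y hy => sol_eq_integral z v hy) (sol_eq_integral z v hx.1)

lemma isSol_sol (z : ℂ) (v : ℂ × ℂ) :
    p.IsSol z (fun x => (p.sol z v x).1) (fun x => (p.sol z v x).2) where
  cont := (continuous_sol z v).fst.continuousOn
  cont' := (continuous_sol z v).snd.continuousOn
  deriv _ hx := (hasDerivWithinAt_sol z v hx).fst
  deriv' _ hx := (hasDerivWithinAt_sol z v hx).snd

/-- Uniqueness for the initial value problem at `a`. -/
lemma IsSol.eq_sol {z : ℂ} {u u' : ℝ → ℂ} (h : p.IsSol z u u') {x : ℝ}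
    (hx : x ∈ Set.Icc p.a p.b) : (u x, u' x) = p.sol z (u p.a, u' p.a) x := by
  set f : C(Set.Icc p.a p.b, ℂ × ℂ) :=
    ⟨fun y => (u y, u' y), (h.cont.domRestrict).prodMk (h.cont'.domRestrict)⟩ with hf
  have key : f = p.solMap z (u p.a, u' p.a) := by
    refine eq_solMap z _ fun y => ?_
    have hy := y.2
    have e : ∫ t in p.a..(y : ℝ), (p.sysZero t - z • shiftDown) (Set.IccExtend p.a_le_b f t) =
        ∫ t in p.a..(y : ℝ), (u' t, ((p.Q t : ℂ) - z) * u t) := by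
      refine intervalIntegral.integral_congr fun t ht => ?_
      rw [Set.uIcc_of_le hy.1] at ht
      have htm : t ∈ Set.Icc p.a p.b := ⟨ht.1, ht.2.trans hy.2⟩
      simp only [sys_apply, Set.IccExtend_of_mem p.a_le_b _ htm]
      rfl
    rw [e]
    have h1 : ∫ t in p.a..(y : ℝ), (u' t, ((p.Q t : ℂ) - z) * u t) =
        (u y, u' y) - (u p.a, u' p.a) := by
      refine integral_eq_sub (p := p) (f := fun t => (u t, u' t)) hy.1 le_rfl hy.2
        (h.cont.prodMk h.cont') (fun t ht => (h.deriv t ht).prodMk (h.deriv' t ht)) ?_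
      have i1 : IntervalIntegrable u' volume p.a y := ContinuousOn.intervalIntegrable (by
        rw [Set.uIcc_of_le hy.1]; exact h.cont'.mono (Set.Icc_subset_Icc le_rfl hy.2))
      have i2 := h.intervalIntegrable hy.1 le_rfl hy.2
      rw [intervalIntegrable_iff] at i1 i2 ⊢
      exact i1.prodMk i2
    rw [h1, add_sub_cancel]
    rfl
  rw [sol, Set.IccExtend_of_mem _ _ hx, ← key]
  rfl

lemma IsSol.eqOn {z : ℂ} {u u' v v' : ℝ → ℂ} (hu : p.IsSol z u u') (hv : p.IsSol z v v')
    (h : u p.a = v p.a) (h' : u' p.a = v' p.a) {x : ℝ} (hx : x ∈ Set.Icc p.a p.b) :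
    u x = v x ∧ u' x = v' x := by
  have h1 := hu.eq_sol hx
  rw [h, h', ← hv.eq_sol hx, Prod.mk.injEq] at h1
  exact h1

lemma IsSol.const_mul {z : ℂ} {u u' : ℝ → ℂ} (h : p.IsSol z u u') (c : ℂ) :
    p.IsSol z (fun x => c * u x) (fun x => c * u' x) where
  cont := continuousOn_const.mul h.cont
  cont' := continuousOn_const.mul h.cont'
  deriv x hx := (h.deriv x hx).const_mul c
  deriv' x hx := by
    rw [mul_left_comm]
    exact (h.deriv' x hx).const_mul c

lemma IsSol.conj {z : ℂ} {u u' : ℝ → ℂ} (h : p.IsSol z u u') :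
    p.IsSol (starRingEnd ℂ z) (fun x => starRingEnd ℂ (u x)) (fun x => starRingEnd ℂ (u' x)) where
  cont := Complex.continuous_conj.comp_continuousOn h.cont
  cont' := Complex.continuous_conj.comp_continuousOn h.cont'
  deriv x hx := (h.deriv x hx).star
  deriv' x hx := by
    have h1 := (h.deriv' x hx).star
    have h2 : star (((p.Q x : ℂ) - z) * u x) =
        ((p.Q x : ℂ) - starRingEnd ℂ z) * starRingEnd ℂ (u x) := by
      rw [← starRingEnd_apply, map_mul, map_sub, Complex.conj_ofReal]
    rw [h2] at h1
    exact h1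

/-- The growth of solutions in terms of the square root of the spectral parameter. -/
lemma IsSol.growth {s : ℂ} (hs : s ≠ 0) {u u' : ℝ → ℂ} (h : p.IsSol (s ^ 2) u u') {x : ℝ}
    (hx : x ∈ Set.Icc p.a p.b) :
    ‖s‖ * ‖u x‖ + ‖u' x‖ ≤ (‖s‖ * ‖u p.a‖ + ‖u' p.a‖) *
      Real.exp ((‖s‖ + p.bound / ‖s‖) * (x - p.a)) := by
  have hs0 : 0 < ‖s‖ := norm_pos_iff.2 hs
  have hab := p.a_le_b
  -- Weighting u by |s| balances the system: |s||u| grows at rate at most |s||u'|, and |u'| at rate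
  -- at most (bound + |s|²)|u| = K|s||u|. As |s| ≤ K, Gronwall applies to the sum with constant K.
  set K := ‖s‖ + p.bound / ‖s‖ with hK
  have hK0 : 0 ≤ K := by have := p.bound_nonneg; positivity
  set f : ℝ → ℝ := fun x => ‖s‖ * ‖u x‖ + ‖u' x‖ with hf
  have hfc : ContinuousOn f (Set.Icc p.a p.b) :=
    (continuousOn_const.mul h.cont.norm).add h.cont'.norm
  set f₁ : ℝ → ℝ := Set.IccExtend hab (Set.domRestrict (Set.Icc p.a p.b) f) with hf₁
  have hf₁c : Continuous f₁ := hfc.domRestrict.Icc_extend'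
  have hff : ∀ t ∈ Set.Icc p.a p.b, f₁ t = f t := fun t ht => by
    rw [hf₁, Set.IccExtend_of_mem _ _ ht]; rfl
  have key := le_mul_exp_of_le_add_integral (a := p.a) (b := p.b)
    (A := ‖s‖ * ‖u p.a‖ + ‖u' p.a‖) hK0 hf₁c (fun y hy => ?_) hx
  · rwa [hff x hx] at key
  rw [hff y hy]
  have hsub : Set.Icc p.a y ⊆ Set.Icc p.a p.b := Set.Icc_subset_Icc le_rfl hy.2
  have e1 : u y = u p.a + ∫ t in p.a..y, u' t := by rw [h.integral_deriv hy]; ring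
  have e2 : u' y = u' p.a + ∫ t in p.a..y, ((p.Q t : ℂ) - s ^ 2) * u t := by
    rw [h.integral_deriv' hy]; ring
  have iu : IntervalIntegrable (fun t => ‖u t‖) volume p.a y :=
    ContinuousOn.intervalIntegrable (by
      rw [Set.uIcc_of_le hy.1]; exact (h.cont.mono hsub).norm)
  have iu' : IntervalIntegrable (fun t => ‖u' t‖) volume p.a y :=
    ContinuousOn.intervalIntegrable (by
      rw [Set.uIcc_of_le hy.1]; exact (h.cont'.mono hsub).norm)
  have b1 : ‖∫ t in p.a..y, u' t‖ ≤ ∫ t in p.a..y, ‖u' t‖ :=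
    intervalIntegral.norm_integral_le_integral_norm hy.1
  have b2 : ‖∫ t in p.a..y, ((p.Q t : ℂ) - s ^ 2) * u t‖ ≤
      ∫ t in p.a..y, (K * ‖s‖) * ‖u t‖ := by
    refine intervalIntegral.norm_integral_le_of_norm_le hy.1
      (Eventually.of_forall fun t _ => ?_) (iu.const_mul _)
    rw [norm_mul]
    refine mul_le_mul_of_nonneg_right ((norm_coeff_le _ t).trans (le_of_eq ?_)) (norm_nonneg _)
    rw [hK, norm_pow]
    field_simp
    ring
  rw [intervalIntegral.integral_const_mul] at b2
  have n1 : ‖u y‖ ≤ ‖u p.a‖ + ∫ t in p.a..y, ‖u' t‖ := by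
    rw [e1]; exact (norm_add_le _ _).trans (by linarith)
  have n2 : ‖u' y‖ ≤ ‖u' p.a‖ + K * ‖s‖ * ∫ t in p.a..y, ‖u t‖ := by
    rw [e2]; exact (norm_add_le _ _).trans (by linarith)
  have e3 : ∫ t in p.a..y, f₁ t = ‖s‖ * (∫ t in p.a..y, ‖u t‖) + ∫ t in p.a..y, ‖u' t‖ := by
    rw [← intervalIntegral.integral_const_mul, ← intervalIntegral.integral_add
      (iu.const_mul _) iu']
    refine intervalIntegral.integral_congr fun t ht => ?_
    rw [Set.uIcc_of_le hy.1] at ht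
    exact hff t (hsub ht)
  rw [e3]
  have hI : 0 ≤ ∫ t in p.a..y, ‖u' t‖ :=
    intervalIntegral.integral_nonneg hy.1 fun _ _ => norm_nonneg _
  have hsK : ‖s‖ ≤ K := by
    have : 0 ≤ p.bound / ‖s‖ := div_nonneg p.bound_nonneg hs0.le
    linarith
  have m1 := mul_le_mul_of_nonneg_left n1 hs0.le
  have m2 := mul_le_mul_of_nonneg_right hsK hI
  simp only [hf]
  nlinarith

variable (p) in
/-- The potential reflected about the midpoint of `[a, b]`. -/
def reflect : Potential where
  a := p.a
  b := p.b
  bound := p.bound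
  Q x := p.Q (p.a + p.b - x)
  S := (fun x => p.a + p.b - x) ⁻¹' p.S
  a_lt_b := p.a_lt_b
  measurable := p.measurable.comp (measurable_const.sub measurable_id)
  abs_le x := p.abs_le _
  countable := p.countable.preimage_of_injOn (fun x _ y _ h => by simpa using h)
  continuousWithinAt x hx := by
    have h := p.continuousWithinAt (p.a + p.b - x)
      ⟨⟨by linarith [hx.1.2], by linarith [hx.1.1]⟩, hx.2⟩
    exact ContinuousWithinAt.comp (f := fun x => p.a + p.b - x) h
      (by fun_prop) (fun y hy => ⟨by linarith [hy.2], by linarith [hy.1]⟩)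

/-- The reflection exchanges the end points and reverses the sign of the derivative, so problems
with data at b reduce to problems with data at a. -/
lemma IsSol.reflect {z : ℂ} {u u' : ℝ → ℂ} (h : p.reflect.IsSol z u u') :
    p.IsSol z (fun x => u (p.a + p.b - x)) (fun x => -u' (p.a + p.b - x)) := by
  have hm : Set.MapsTo (fun x => p.a + p.b - x) (Set.Icc p.a p.b) (Set.Icc p.a p.b) :=
    fun y hy => ⟨by linarith [hy.2], by linarith [hy.1]⟩
  have hd : ∀ x, HasDerivWithinAt (fun x => p.a + p.b - x) (-1) (Set.Icc p.a p.b) x := fun x =>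
    ((hasDerivAt_id x).const_sub (p.a + p.b)).hasDerivWithinAt
  have hmem : ∀ x ∈ Set.Icc p.a p.b \ p.S,
      p.a + p.b - x ∈ Set.Icc p.reflect.a p.reflect.b \ p.reflect.S := fun x hx =>
    ⟨hm hx.1, by simpa [Potential.reflect] using hx.2⟩
  refine ⟨h.cont.comp (by fun_prop) hm, (h.cont'.comp (by fun_prop) hm).neg,
    fun x hx => ?_, fun x hx => ?_⟩
  · have h1 := HasDerivWithinAt.scomp x (h.deriv _ (hmem x hx)) (hd x) hm
    rw [neg_one_smul] at h1
    exact h1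
  · have h1 := (HasDerivWithinAt.scomp x (h.deriv' _ (hmem x hx)) (hd x) hm).neg
    rw [neg_one_smul, neg_neg] at h1
    have h2 : p.reflect.Q (p.a + p.b - x) = p.Q x := congrArg p.Q (by ring)
    rw [h2] at h1
    exact h1

end Potential

/-- A Sobolev inequality on an interval. -/
lemma norm_sq_le_of_deriv_off_countable {a b : ℝ} (hab : a < b) {S : Set ℝ} (hS : S.Countable)
    {u u' : ℝ → ℂ} (hu : ContinuousOn u (Set.Icc a b))
    (hd : ∀ x ∈ Set.Ioo a b \ S, HasDerivAt u (u' x) x)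
    (hi : IntervalIntegrable u' volume a b)
    (hi2 : IntervalIntegrable (fun x => ‖u' x‖ ^ 2) volume a b)
    {τ : ℝ} (hτ : 0 < τ) {x : ℝ} (hx : x ∈ Set.Icc a b) :
    ‖u x‖ ^ 2 ≤ (1 / (b - a) + 1 / τ) * (∫ t in a..b, ‖u t‖ ^ 2) +
      τ * ∫ t in a..b, ‖u' t‖ ^ 2 := by
  have hu2 : ContinuousOn (fun x => ‖u x‖ ^ 2) (Set.Icc a b) := hu.norm.pow 2
  have iu2 : IntervalIntegrable (fun x => ‖u x‖ ^ 2) volume a b :=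
    ContinuousOn.intervalIntegrable (by rwa [Set.uIcc_of_le hab.le])
  -- At the minimum point |u|² is at most its mean. The rest of |u(x)|² is the integral of 2⟨u, u'⟩
  -- from y to x, at most the integral of τ|u'|² + |u|²/τ.
  obtain ⟨y, hy, hmin⟩ := isCompact_Icc.exists_isMinOn (Set.nonempty_Icc.2 hab.le) hu2
  have hba : 0 < b - a := sub_pos.2 hab
  have h1 : ‖u y‖ ^ 2 ≤ 1 / (b - a) * ∫ t in a..b, ‖u t‖ ^ 2 := by
    have : ∫ _ in a..b, ‖u y‖ ^ 2 ≤ ∫ t in a..b, ‖u t‖ ^ 2 :=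
      intervalIntegral.integral_mono_on hab.le intervalIntegrable_const iu2
        fun t ht => isMinOn_iff.1 hmin t ht
    rw [intervalIntegral.integral_const, smul_eq_mul] at this
    rw [one_div, ← div_eq_inv_mul, le_div_iff₀ hba]
    linarith
  set G : ℝ → ℝ := fun t => τ * ‖u' t‖ ^ 2 + 1 / τ * ‖u t‖ ^ 2 with hG
  have iG : IntervalIntegrable G volume a b := (hi2.const_mul τ).add (iu2.const_mul _)
  have hbound : ∀ t, ‖2 * inner ℝ (u t) (u' t)‖ ≤ G t := fun t => by
    have h2 : ‖inner ℝ (u t) (u' t)‖ ≤ ‖u t‖ * ‖u' t‖ := norm_inner_le_norm _ _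
    rw [norm_mul, Real.norm_ofNat]
    have h3 : 0 ≤ (τ * ‖u' t‖ - ‖u t‖) ^ 2 / τ := by positivity
    have h4 : (τ * ‖u' t‖ - ‖u t‖) ^ 2 / τ = G t - 2 * (‖u t‖ * ‖u' t‖) := by
      simp only [hG]; field_simp; ring
    linarith
  have h5 : ‖u x‖ ^ 2 - ‖u y‖ ^ 2 ≤ ∫ t in a..b, G t := by
    have hsub : Set.uIcc y x ⊆ Set.Icc a b := Set.uIcc_subset_Icc hy hx
    have e : ∫ t in y..x, 2 * inner ℝ (u t) (u' t) = ‖u x‖ ^ 2 - ‖u y‖ ^ 2 := by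
      refine integral_eq_of_hasDerivAt_off_countable (fun t => ‖u t‖ ^ 2) _ hS (hu2.mono hsub)
        (fun t ht => ?_) ?_
      · refine (hd t ⟨⟨?_, ?_⟩, ht.2⟩).norm_sq
        · exact (le_min hy.1 hx.1).trans_lt ht.1.1
        · exact ht.1.2.trans_le (max_le hy.2 hx.2)
      · have hi' : IntervalIntegrable u' volume y x := hi.mono_set (by
          rwa [Set.uIcc_of_le hab.le])
        have iG' : IntervalIntegrable G volume y x := iG.mono_set (by
          rwa [Set.uIcc_of_le hab.le])
        refine IntervalIntegrable.mono_fun iG' ?_ (Eventually.of_forall fun t =>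
          (hbound t).trans (le_abs_self _))
        have m1 : AEStronglyMeasurable u (volume.restrict (Set.uIoc y x)) :=
          ((hu.mono hsub).aestronglyMeasurable measurableSet_uIcc).mono_measure
            (Measure.restrict_mono Set.uIoc_subset_uIcc le_rfl)
        exact (m1.inner (𝕜 := ℝ) (intervalIntegrable_iff.1 hi').aestronglyMeasurable).const_mul 2
    rw [← e]
    refine (le_abs_self _).trans ?_
    rw [← Real.norm_eq_abs]
    refine (intervalIntegral.norm_integral_le_integral_norm_uIoc).trans ?_
    rw [intervalIntegral.integral_of_le hab.le]
    have hss : Set.uIoc y x ⊆ Set.Ioc a b :=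
      Set.Ioc_subset_Ioc (le_min hy.1 hx.1) (max_le hy.2 hx.2)
    have iGo : IntegrableOn G (Set.Ioc a b) volume :=
      (intervalIntegrable_iff_integrableOn_Ioc_of_le hab.le).1 iG
    calc ∫ t in Set.uIoc y x, ‖2 * inner ℝ (u t) (u' t)‖
        ≤ ∫ t in Set.uIoc y x, G t := by
          refine integral_mono_of_nonneg (Eventually.of_forall fun t => norm_nonneg _)
            (iGo.mono_set hss) (Eventually.of_forall hbound)
      _ ≤ ∫ t in Set.Ioc a b, G t := by
          refine setIntegral_mono_set iGo (Eventually.of_forall fun t => ?_) hss.eventuallyLE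
          exact (norm_nonneg _).trans (hbound t)
  have h6 : ∫ t in a..b, G t =
      τ * (∫ t in a..b, ‖u' t‖ ^ 2) + 1 / τ * ∫ t in a..b, ‖u t‖ ^ 2 := by
    rw [← intervalIntegral.integral_const_mul, ← intervalIntegral.integral_const_mul,
      ← intervalIntegral.integral_add (hi2.const_mul τ) (iu2.const_mul _)]
  rw [h6] at h5
  linarith

lemma intervalIntegrable_ite {E : Type*} [NormedAddCommGroup E] {f g : ℝ → E} {a b y : ℝ}
    (hy : y ∈ Set.Icc a b) (hf : IntervalIntegrable f volume a y)
    (hg : IntervalIntegrable g volume y b) :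
    IntervalIntegrable (fun x => if x ≤ y then f x else g x) volume a b := by
  refine IntervalIntegrable.trans (b := y) ?_ ?_
  · refine hf.congr fun x hx => ?_
    rw [Set.uIoc_of_le hy.1] at hx
    simp [hx.2]
  · refine hg.congr fun x hx => ?_
    rw [Set.uIoc_of_le hy.2] at hx
    simp [hx.1]

lemma integral_ite_le {E : Type*} [NormedAddCommGroup E] [NormedSpace ℝ E]
    {f g : ℝ → E} {a b y : ℝ}
    (hy : y ∈ Set.Icc a b) (hf : IntervalIntegrable f volume a y)
    (hg : IntervalIntegrable g volume y b) :
    ∫ x in a..b, (if x ≤ y then f x else g x) = (∫ x in a..y, f x) + ∫ x in y..b, g x := by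
  have e1 : Set.EqOn f (fun x => if x ≤ y then f x else g x) (Set.uIoc a y) := fun x hx => by
    rw [Set.uIoc_of_le hy.1] at hx
    simp [hx.2]
  have e2 : Set.EqOn g (fun x => if x ≤ y then f x else g x) (Set.uIoc y b) := fun x hx => by
    rw [Set.uIoc_of_le hy.2] at hx
    simp [hx.1]
  rw [← intervalIntegral.integral_add_adjacent_intervals (hf.congr e1) (hg.congr e2)]
  congr 1
  · exact intervalIntegral.integral_congr_ae (Eventually.of_forall fun x hx => (e1 hx).symm)
  · exact intervalIntegral.integral_congr_ae (Eventually.of_forall fun x hx => (e2 hx).symm)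

/-! ### Lagrange and energy identities -/

namespace Potential

variable {p : Potential}

/-- Lagrange's identity. -/
lemma IsSol.lagrange {z ζ : ℂ} {u u' v v' : ℝ → ℂ} (hu : p.IsSol z u u') (hv : p.IsSol ζ v v')
    {c d : ℝ} (hcd : c ≤ d) (hc : p.a ≤ c) (hd : d ≤ p.b) :
    (z - ζ) * ∫ x in c..d, u x * v x =
      (u d * v' d - u' d * v d) - (u c * v' c - u' c * v c) := by
  rw [← intervalIntegral.integral_const_mul]
  refine integral_eq_sub (f := fun x => u x * v' x - u' x * v x) hcd hc hd
    ((hu.cont.mul hv.cont').sub (hu.cont'.mul hv.cont)) (fun x hx => ?_) ?_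
  · refine (((hu.deriv x hx).mul (hv.deriv' x hx)).sub
      ((hu.deriv' x hx).mul (hv.deriv x hx))).congr_deriv ?_
    ring
  · refine ContinuousOn.intervalIntegrable ?_
    rw [Set.uIcc_of_le hcd]
    exact (continuousOn_const.mul (hu.cont.mul hv.cont)).mono (Set.Icc_subset_Icc hc hd)

lemma IsSol.wronskian_eq {z : ℂ} {u u' v v' : ℝ → ℂ} (hu : p.IsSol z u u')
    (hv : p.IsSol z v v') {x : ℝ} (hx : x ∈ Set.Icc p.a p.b) :
    u x * v' x - u' x * v x = u p.a * v' p.a - u' p.a * v p.a := by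
  have h := hu.lagrange hv hx.1 le_rfl hx.2
  rw [sub_self, zero_mul] at h
  exact (sub_eq_zero.1 h.symm)

/-- The energy identity. -/
lemma IsSol.energy {z : ℂ} {u u' : ℝ → ℂ} (hu : p.IsSol z u u')
    {c d : ℝ} (hcd : c ≤ d) (hc : p.a ≤ c) (hd : d ≤ p.b) :
    ((∫ x in c..d, ‖u' x‖ ^ 2 : ℝ) : ℂ) + ((∫ x in c..d, p.Q x * ‖u x‖ ^ 2 : ℝ) : ℂ) -
      z * ((∫ x in c..d, ‖u x‖ ^ 2 : ℝ) : ℂ) =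
      u' d * starRingEnd ℂ (u d) - u' c * starRingEnd ℂ (u c) := by
  have hsub := Set.Icc_subset_Icc hc hd
  have i1 : IntervalIntegrable (fun x => ((‖u' x‖ ^ 2 : ℝ) : ℂ)) volume c d := by
    refine ContinuousOn.intervalIntegrable ?_
    rw [Set.uIcc_of_le hcd]
    exact Complex.continuous_ofReal.comp_continuousOn ((hu.cont'.mono hsub).norm.pow 2)
  have hc3 : ContinuousOn (fun x => ((‖u x‖ ^ 2 : ℝ) : ℂ)) (Set.Icc c d) :=
    Complex.continuous_ofReal.comp_continuousOn ((hu.cont.mono hsub).norm.pow 2)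
  have i3 : IntervalIntegrable (fun x => z * ((‖u x‖ ^ 2 : ℝ) : ℂ)) volume c d := by
    refine ContinuousOn.intervalIntegrable ?_
    rw [Set.uIcc_of_le hcd]
    exact continuousOn_const.mul hc3
  have i2 : IntervalIntegrable (fun x => ((p.Q x * ‖u x‖ ^ 2 : ℝ) : ℂ)) volume c d := by
    simp_rw [Complex.ofReal_mul]
    exact intervalIntegrable_mul (Complex.measurable_ofReal.comp p.measurable)
      (fun x => (Complex.norm_real _).le.trans (p.abs_le x)) hcd hc3
  rw [← intervalIntegral.integral_ofReal, ← intervalIntegral.integral_ofReal,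
    ← intervalIntegral.integral_ofReal, ← intervalIntegral.integral_const_mul,
    ← intervalIntegral.integral_add i1 i2, ← intervalIntegral.integral_sub (i1.add i2) i3]
  refine integral_eq_sub (f := fun x => u' x * starRingEnd ℂ (u x)) hcd hc hd
    (hu.cont'.mul hu.conj.cont) (fun x hx => ?_) ((i1.add i2).sub i3)
  refine ((hu.deriv' x hx).mul (hu.conj.deriv x hx)).congr_deriv ?_
  have h1 : ((‖u x‖ ^ 2 : ℝ) : ℂ) = u x * starRingEnd ℂ (u x) := by
    rw [Complex.mul_conj, Complex.normSq_eq_norm_sq]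
  have h2 : ((‖u' x‖ ^ 2 : ℝ) : ℂ) = u' x * starRingEnd ℂ (u' x) := by
    rw [Complex.mul_conj, Complex.normSq_eq_norm_sq]
  rw [Complex.ofReal_mul, h1, h2]
  ring

end Potential

/-- A Sturm-Liouville problem without transmission conditions, with the spectral parameter in the
boundary condition at `b`. -/
structure RegularSL extends Potential where
  (β₁ β₂ α₁ α₂ α₁' α₂' : ℝ)
  β_ne : ¬(β₁ = 0 ∧ β₂ = 0)
  ρ_pos : 0 < α₁' * α₂ - α₁ * α₂'

/-! ### The problem without jumps: solutions, Wronskian, glued functions -/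

namespace RegularSL

variable (R : RegularSL)

/-- The determinant of the boundary condition at `b`. -/
def ρ : ℝ := R.α₁' * R.α₂ - R.α₁ * R.α₂'

lemma rho_pos : 0 < R.ρ := R.ρ_pos

def psi (z : ℂ) (x : ℝ) : ℂ := (R.sol z (R.β₂, -R.β₁) x).1
def psi' (z : ℂ) (x : ℝ) : ℂ := (R.sol z (R.β₂, -R.β₁) x).2

def chi (z : ℂ) (x : ℝ) : ℂ :=
  (R.reflect.sol z (z * R.α₂' + R.α₂, -(z * R.α₁' + R.α₁)) (R.a + R.b - x)).1
def chi' (z : ℂ) (x : ℝ) : ℂ :=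
  -(R.reflect.sol z (z * R.α₂' + R.α₂, -(z * R.α₁' + R.α₁)) (R.a + R.b - x)).2

/-- The Wronskian of `psi` and `chi`. -/
def wr (z : ℂ) : ℂ := R.psi z R.a * R.chi' z R.a - R.psi' z R.a * R.chi z R.a

variable {R}

lemma left_mem : R.a ∈ Set.Icc R.a R.b := Set.left_mem_Icc.2 R.a_le_b
lemma right_mem : R.b ∈ Set.Icc R.a R.b := Set.right_mem_Icc.2 R.a_le_b

lemma isSol_psi (z : ℂ) : R.IsSol z (R.psi z) (R.psi' z) := R.toPotential.isSol_sol z _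

lemma isSol_chi (z : ℂ) : R.IsSol z (R.chi z) (R.chi' z) :=
  (R.toPotential.reflect.isSol_sol z _).reflect

lemma psi_left (z : ℂ) : R.psi z R.a = R.β₂ := by simp [psi, Potential.sol_left]
lemma psi'_left (z : ℂ) : R.psi' z R.a = -R.β₁ := by simp [psi', Potential.sol_left]

lemma chi_right (z : ℂ) : R.chi z R.b = z * R.α₂' + R.α₂ := by
  have : R.a + R.b - R.b = R.reflect.a := by simp [Potential.reflect]
  rw [chi, this, Potential.sol_left]

lemma chi'_right (z : ℂ) : R.chi' z R.b = z * R.α₁' + R.α₁ := by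
  have : R.a + R.b - R.b = R.reflect.a := by simp [Potential.reflect]
  rw [chi', this, Potential.sol_left, neg_neg]

lemma continuous_psi (z : ℂ) : Continuous (R.psi z) := (R.toPotential.continuous_sol z _).fst
lemma continuous_psi' (z : ℂ) : Continuous (R.psi' z) := (R.toPotential.continuous_sol z _).snd

lemma continuous_chi (z : ℂ) : Continuous (R.chi z) :=
  (R.toPotential.reflect.continuous_sol z _).fst.comp (by fun_prop)

lemma continuous_chi' (z : ℂ) : Continuous (R.chi' z) :=
  ((R.toPotential.reflect.continuous_sol z _).snd.comp (by fun_prop)).neg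

lemma wr_eq (z : ℂ) {x : ℝ} (hx : x ∈ Set.Icc R.a R.b) :
    R.psi z x * R.chi' z x - R.psi' z x * R.chi z x = R.wr z :=
  (isSol_psi z).wronskian_eq (isSol_chi z) hx

lemma wr_eq_right (z : ℂ) :
    R.wr z = R.psi z R.b * (z * R.α₁' + R.α₁) - R.psi' z R.b * (z * R.α₂' + R.α₂) := by
  rw [← wr_eq z right_mem, chi_right, chi'_right]

/-- The combination α₁'χ(b) − α₂'χ'(b) equals ρ for every z, and ρ > 0. -/
lemma chi_right_ne (z : ℂ) : ¬(R.chi z R.b = 0 ∧ R.chi' z R.b = 0) := by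
  rw [chi_right, chi'_right]
  rintro ⟨h1, h2⟩
  have h : ((R.α₁' * R.α₂ - R.α₁ * R.α₂' : ℝ) : ℂ) = 0 := by
    push_cast
    linear_combination (R.α₁' : ℂ) * h1 - (R.α₂' : ℂ) * h2
  exact R.ρ_pos.ne' (by exact_mod_cast h)

/-- At an eigenvalue the two solutions are proportional. -/
lemma exists_psi_eq_mul_chi {z : ℂ} (hz : R.wr z = 0) : ∃ k : ℂ, k ≠ 0 ∧
    ∀ x ∈ Set.Icc R.a R.b, R.psi z x = k * R.chi z x ∧ R.psi' z x = k * R.chi' z x := by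
  have hw : (R.β₂ : ℂ) * R.chi' z R.a + R.β₁ * R.chi z R.a = 0 := by
    have := hz
    rw [wr, psi_left, psi'_left] at this
    linear_combination this
  obtain ⟨m, hm, hm'⟩ : ∃ m : ℂ, R.chi z R.a = m * R.psi z R.a ∧
      R.chi' z R.a = m * R.psi' z R.a := by
    rw [psi_left, psi'_left]
    -- The initial vector (β₂, −β₁) of ψ is not zero, and a vanishing Wronskian makes that of χ a
    -- multiple of it; the factor is read off from a nonzero component.
    by_cases h2 : R.β₂ = 0
    · have h1 : (R.β₁ : ℂ) ≠ 0 := fun h => R.β_ne ⟨by exact_mod_cast h, h2⟩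
      refine ⟨-R.chi' z R.a / R.β₁, ?_, by field_simp⟩
      rw [h2] at hw ⊢
      have : R.chi z R.a = 0 := by simpa [h1] using hw
      simp [this]
    · have h2' : (R.β₂ : ℂ) ≠ 0 := by exact_mod_cast h2
      refine ⟨R.chi z R.a / R.β₂, by field_simp, ?_⟩
      field_simp
      linear_combination hw
  have key : ∀ x ∈ Set.Icc R.a R.b, R.chi z x = m * R.psi z x ∧ R.chi' z x = m * R.psi' z x :=
    fun x hx => (isSol_chi z).eqOn ((isSol_psi z).const_mul m) hm hm' hx
  have hm0 : m ≠ 0 := by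
    rintro rfl
    have := key R.b right_mem
    simp only [zero_mul] at this
    exact chi_right_ne z this
  refine ⟨m⁻¹, inv_ne_zero hm0, fun x hx => ?_⟩
  obtain ⟨h1, h2⟩ := key x hx
  rw [h1, h2, inv_mul_cancel_left₀ hm0, inv_mul_cancel_left₀ hm0]
  exact ⟨rfl, rfl⟩

variable (R) in
/-- The function `A ψ` on `[a, y]` and `B χ` on `[y, b]`. -/
def glue (z : ℂ) (y : ℝ) (A B : ℂ) (x : ℝ) : ℂ := if x ≤ y then A * R.psi z x else B * R.chi z x

variable (R) in
/-- The derivative of `glue`. -/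
def glue' (z : ℂ) (y : ℝ) (A B : ℂ) (x : ℝ) : ℂ :=
  if x ≤ y then A * R.psi' z x else B * R.chi' z x

variable (R) in
/-- `glue z y A B` is continuous at `y`, and its derivative jumps by `s` there. -/
structure IsGlued (z : ℂ) (y : ℝ) (A B s : ℂ) : Prop where
  mem : y ∈ Set.Icc R.a R.b
  eq : A * R.psi z y = B * R.chi z y
  jump : B * R.chi' z y - A * R.psi' z y = s

variable (R) in
/-- The squared norm of `glue z y A B` in `L²(a, b) ⊕ ℂ`. -/
def nsq (z : ℂ) (y : ℝ) (A B : ℂ) : ℝ :=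
  (∫ x in R.a..R.b, ‖R.glue z y A B x‖ ^ 2) + R.ρ * ‖B‖ ^ 2

variable (R) in
/-- The Dirichlet integral of `glue z y A B`. -/
def dsq (z : ℂ) (y : ℝ) (A B : ℂ) : ℝ := ∫ x in R.a..R.b, ‖R.glue' z y A B x‖ ^ 2

/-- An eigenfunction is glued at any point without a jump, so all estimates for glued functions
apply to it with s = 0. -/
lemma isGlued_of_wr_eq_zero {z : ℂ} {k : ℂ} {y : ℝ} (hy : y ∈ Set.Icc R.a R.b)
    (hk : ∀ x ∈ Set.Icc R.a R.b, R.psi z x = k * R.chi z x ∧ R.psi' z x = k * R.chi' z x) :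
    R.IsGlued z y 1 k 0 where
  mem := hy
  eq := by rw [one_mul, (hk y hy).1]
  jump := by rw [one_mul, (hk y hy).2, sub_self]

/-- These coefficients give Green's function with second argument y; its derivative jumps by the
Wronskian divided by itself. -/
lemma isGlued_green {z : ℂ} (hz : R.wr z ≠ 0) {y : ℝ} (hy : y ∈ Set.Icc R.a R.b) :
    R.IsGlued z y (R.chi z y / R.wr z) (R.psi z y / R.wr z) 1 where
  mem := hy
  eq := by ring
  jump := by
    rw [div_mul_eq_mul_div, div_mul_eq_mul_div, ← sub_div, div_eq_one_iff_eq hz,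
      ← wr_eq z hy]
    ring

/-! ### Energy estimates for glued functions -/

section IsGlued

variable {z : ℂ} {y : ℝ} {A B s : ℂ}

lemma continuous_glue (h : R.IsGlued z y A B s) : Continuous (R.glue z y A B) :=
  Continuous.if_le (continuous_const.mul (continuous_psi z))
    (continuous_const.mul (continuous_chi z)) continuous_id continuous_const
    (fun x hx => by rw [hx]; exact h.eq)

lemma hasDerivAt_glue {x : ℝ} (hx : x ∈ Set.Ioo R.a R.b \ (R.S ∪ {y})) :
    HasDerivAt (R.glue z y A B) (R.glue' z y A B x) x := by
  have hxI : x ∈ Set.Icc R.a R.b \ R.S :=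
    ⟨⟨hx.1.1.le, hx.1.2.le⟩, fun h => hx.2 (Or.inl h)⟩
  have hn := Icc_mem_nhds hx.1.1 hx.1.2
  have hxy : x ≠ y := fun h => hx.2 (Or.inr h)
  rcases lt_or_gt_of_ne hxy with h | h
  · have h1 := (((isSol_psi z).deriv x hxI).hasDerivAt hn).const_mul A
    rw [glue', if_pos h.le]
    refine h1.congr_of_eventuallyEq ?_
    filter_upwards [gt_mem_nhds h] with t ht
    rw [glue, if_pos ht.le]
  · have h1 := (((isSol_chi z).deriv x hxI).hasDerivAt hn).const_mul B
    rw [glue', if_neg (not_le.2 h)]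
    refine h1.congr_of_eventuallyEq ?_
    filter_upwards [lt_mem_nhds h] with t ht
    rw [glue, if_neg (not_le.2 ht)]

lemma intervalIntegrable_glue' (hy : y ∈ Set.Icc R.a R.b) :
    IntervalIntegrable (R.glue' z y A B) volume R.a R.b :=
  intervalIntegrable_ite hy
    ((continuous_const.mul (continuous_psi' z)).intervalIntegrable _ _)
    ((continuous_const.mul (continuous_chi' z)).intervalIntegrable _ _)

lemma norm_sq_glue' (x : ℝ) : ‖R.glue' z y A B x‖ ^ 2 =
    if x ≤ y then ‖A * R.psi' z x‖ ^ 2 else ‖B * R.chi' z x‖ ^ 2 := by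
  rw [glue']; split_ifs <;> rfl

lemma norm_sq_glue (x : ℝ) : ‖R.glue z y A B x‖ ^ 2 =
    if x ≤ y then ‖A * R.psi z x‖ ^ 2 else ‖B * R.chi z x‖ ^ 2 := by
  rw [glue]; split_ifs <;> rfl

lemma intervalIntegrable_glue'_sq (hy : y ∈ Set.Icc R.a R.b) :
    IntervalIntegrable (fun x => ‖R.glue' z y A B x‖ ^ 2) volume R.a R.b := by
  simp_rw [norm_sq_glue']
  exact intervalIntegrable_ite hy
    (((continuous_const.mul (continuous_psi' z)).norm.pow 2).intervalIntegrable _ _)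
    (((continuous_const.mul (continuous_chi' z)).norm.pow 2).intervalIntegrable _ _)

lemma sobolev_glue (h : R.IsGlued z y A B s) {τ : ℝ} (hτ : 0 < τ) {x : ℝ}
    (hx : x ∈ Set.Icc R.a R.b) :
    ‖R.glue z y A B x‖ ^ 2 ≤
      (1 / (R.b - R.a) + 1 / τ) * R.nsq z y A B + τ * R.dsq z y A B := by
  have h1 := norm_sq_le_of_deriv_off_countable R.a_lt_b
    (R.countable.union (Set.countable_singleton y)) (continuous_glue h).continuousOn
    (fun x hx => hasDerivAt_glue hx) (intervalIntegrable_glue' h.mem)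
    (intervalIntegrable_glue'_sq h.mem) hτ hx
  refine h1.trans ?_
  have hba := sub_pos.2 R.a_lt_b
  have h2 : (∫ x in R.a..R.b, ‖R.glue z y A B x‖ ^ 2) ≤ R.nsq z y A B := by
    have := mul_nonneg R.rho_pos.le (sq_nonneg ‖B‖)
    rw [nsq]; linarith
  have h3 : 0 ≤ 1 / (R.b - R.a) + 1 / τ := by positivity
  have := mul_le_mul_of_nonneg_left h2 h3
  simp only [dsq]
  linarith

lemma nsq_nonneg : 0 ≤ R.nsq z y A B := by
  have h1 := mul_nonneg R.rho_pos.le (sq_nonneg ‖B‖)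
  have h2 : 0 ≤ ∫ x in R.a..R.b, ‖R.glue z y A B x‖ ^ 2 :=
    intervalIntegral.integral_nonneg R.a_le_b fun _ _ => by positivity
  rw [nsq]; linarith

lemma dsq_nonneg : 0 ≤ R.dsq z y A B :=
  intervalIntegral.integral_nonneg R.a_le_b fun _ _ => by positivity

lemma rho_mul_le_nsq : R.ρ * ‖B‖ ^ 2 ≤ R.nsq z y A B := by
  have h2 : 0 ≤ ∫ x in R.a..R.b, ‖R.glue z y A B x‖ ^ 2 :=
    intervalIntegral.integral_nonneg R.a_le_b fun _ _ => by positivity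
  rw [nsq]; linarith

lemma nsq_pos (hB : B ≠ 0) : 0 < R.nsq z y A B :=
  lt_of_lt_of_le (mul_pos R.rho_pos (by positivity)) rho_mul_le_nsq

variable (R) in
/-- The real boundary term at `b` in the energy identity. -/
def bdry (z : ℂ) : ℝ :=
  2 * z.re * (R.α₁ * R.α₂') + ‖z‖ ^ 2 * (R.α₁' * R.α₂') + R.α₁ * R.α₂

/-- Only zρ fails to be real. In the energy identity it joins z∫|u|², which explains the weight ρ of
the second component in `nsq`. -/
lemma chi'_mul_conj_chi_right (z : ℂ) :
    R.chi' z R.b * starRingEnd ℂ (R.chi z R.b) = z * R.ρ + R.bdry z := by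
  rw [chi_right, chi'_right, bdry, ρ]
  have h1 : ((‖z‖ ^ 2 : ℝ) : ℂ) = z * starRingEnd ℂ z := by
    rw [Complex.mul_conj, Complex.normSq_eq_norm_sq]
  have h2 : ((2 * z.re : ℝ) : ℂ) = z + starRingEnd ℂ z := (Complex.add_conj z).symm
  simp only [Complex.ofReal_add, Complex.ofReal_mul, Complex.ofReal_sub, map_add, map_mul,
    Complex.conj_ofReal] at h1 h2 ⊢
  rw [h1, h2]
  ring

/-- If α₂' = 0 the boundary term is constant. Otherwise χ(b) = zα₂' + α₂ controls |z|, so the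
quadratic growth in z is paid for by a boundary value, which the Sobolev inequality can absorb. -/
lemma exists_bdry_le : ∃ C : ℝ, 0 ≤ C ∧ ∀ z : ℂ, R.bdry z ≤ C * (1 + ‖R.chi z R.b‖ ^ 2) := by
  by_cases h : R.α₂' = 0
  · refine ⟨|R.α₁ * R.α₂|, abs_nonneg _, fun z => ?_⟩
    have h1 := le_abs_self (R.α₁ * R.α₂)
    have h2 : 0 ≤ |R.α₁ * R.α₂| * ‖R.chi z R.b‖ ^ 2 := by positivity
    simp only [bdry, h]
    linarith
  · set c := |R.α₁ * R.α₂'| + |R.α₁' * R.α₂'| with hc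
    refine ⟨c * (2 / R.α₂' ^ 2) * (1 + R.α₂ ^ 2) + |R.α₁ * R.α₂'| + |R.α₁ * R.α₂|,
      by positivity, fun z => ?_⟩
    have hz2 : ‖z‖ ^ 2 ≤ 2 / R.α₂' ^ 2 * (‖R.chi z R.b‖ ^ 2 + R.α₂ ^ 2) := by
      have e : z * R.α₂' = R.chi z R.b - R.α₂ := by rw [chi_right]; ring
      have n : ‖z‖ * |R.α₂'| ≤ ‖R.chi z R.b‖ + |R.α₂| := by
        have := norm_sub_le (R.chi z R.b) (R.α₂ : ℂ)
        rw [← e, norm_mul, Complex.norm_real, Complex.norm_real] at this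
        exact this
      have hp : 0 < R.α₂' ^ 2 := by positivity
      rw [div_mul_eq_mul_div, le_div_iff₀ hp, ← sq_abs R.α₂', ← mul_pow]
      have n2 := pow_le_pow_left₀ (by positivity) n 2
      have n3 := sq_nonneg (‖R.chi z R.b‖ - |R.α₂|)
      have n4 := sq_abs R.α₂
      nlinarith
    have b1 : 2 * z.re * (R.α₁ * R.α₂') ≤ (1 + ‖z‖ ^ 2) * |R.α₁ * R.α₂'| := by
      have hr : |2 * z.re| ≤ 1 + ‖z‖ ^ 2 := by
        rw [abs_mul, abs_two]
        have := Complex.abs_re_le_norm z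
        nlinarith [sq_nonneg (‖z‖ - 1)]
      calc 2 * z.re * (R.α₁ * R.α₂') ≤ |2 * z.re * (R.α₁ * R.α₂')| := le_abs_self _
        _ = |2 * z.re| * |R.α₁ * R.α₂'| := abs_mul _ _
        _ ≤ _ := by gcongr
    have b2 : ‖z‖ ^ 2 * (R.α₁' * R.α₂') ≤ ‖z‖ ^ 2 * |R.α₁' * R.α₂'| := by
      gcongr; exact le_abs_self _
    have b3 := le_abs_self (R.α₁ * R.α₂)
    have hX : 0 ≤ ‖R.chi z R.b‖ ^ 2 := by positivity
    have b4 : R.bdry z ≤ c * ‖z‖ ^ 2 + |R.α₁ * R.α₂'| + |R.α₁ * R.α₂| := by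
      rw [bdry, hc]; linarith
    have b5 : c * ‖z‖ ^ 2 ≤ c * (2 / R.α₂' ^ 2) * (1 + R.α₂ ^ 2) * (1 + ‖R.chi z R.b‖ ^ 2) := by
      calc c * ‖z‖ ^ 2 ≤ c * (2 / R.α₂' ^ 2 * (‖R.chi z R.b‖ ^ 2 + R.α₂ ^ 2)) := by gcongr
        _ = c * (2 / R.α₂' ^ 2) * (‖R.chi z R.b‖ ^ 2 + R.α₂ ^ 2) := by ring
        _ ≤ c * (2 / R.α₂' ^ 2) * ((1 + R.α₂ ^ 2) * (1 + ‖R.chi z R.b‖ ^ 2)) := by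
            gcongr
            nlinarith [mul_nonneg (sq_nonneg R.α₂) hX]
        _ = _ := by ring
    have b6 : |R.α₁ * R.α₂'| + |R.α₁ * R.α₂| ≤
        (|R.α₁ * R.α₂'| + |R.α₁ * R.α₂|) * (1 + ‖R.chi z R.b‖ ^ 2) :=
      le_mul_of_one_le_right (by positivity) (by linarith)
    nlinarith

/-- The energy identity for a glued function. -/
lemma energy_glue (h : R.IsGlued z y A B s) :
    ((R.dsq z y A B : ℝ) : ℂ) +
      ((∫ x in R.a..R.b, R.Q x * ‖R.glue z y A B x‖ ^ 2 : ℝ) : ℂ) -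
      z * (R.nsq z y A B : ℝ) =
    -(s * starRingEnd ℂ (A * R.psi z y)) +
      ((R.β₁ / R.β₂ * ‖A * R.psi z R.a‖ ^ 2 + ‖B‖ ^ 2 * R.bdry z : ℝ) : ℂ) := by
  have e1 := ((isSol_psi (R := R) z).const_mul A).energy h.mem.1 le_rfl h.mem.2
  have e2 := ((isSol_chi (R := R) z).const_mul B).energy h.mem.2 h.mem.1 le_rfl
  have iQ : ∀ {f : ℝ → ℂ}, Continuous f → ∀ c d : ℝ, c ≤ d →
      IntervalIntegrable (fun x => R.Q x * ‖f x‖ ^ 2) volume c d := by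
    intro f hf c d hcd
    have h1 : IntervalIntegrable (fun x => ‖f x‖ ^ 2) volume c d :=
      (hf.norm.pow 2).intervalIntegrable _ _
    rw [intervalIntegrable_iff] at h1 ⊢
    exact h1.bdd_mul R.measurable.aestronglyMeasurable (Eventually.of_forall R.abs_le)
  have d1 : R.dsq z y A B = (∫ x in R.a..y, ‖A * R.psi' z x‖ ^ 2) +
      ∫ x in y..R.b, ‖B * R.chi' z x‖ ^ 2 := by
    simp_rw [dsq, norm_sq_glue']
    exact integral_ite_le h.mem
      (((continuous_const.mul (continuous_psi' z)).norm.pow 2).intervalIntegrable _ _)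
      (((continuous_const.mul (continuous_chi' z)).norm.pow 2).intervalIntegrable _ _)
  have d2 : ∫ x in R.a..R.b, ‖R.glue z y A B x‖ ^ 2 = (∫ x in R.a..y, ‖A * R.psi z x‖ ^ 2) +
      ∫ x in y..R.b, ‖B * R.chi z x‖ ^ 2 := by
    simp_rw [norm_sq_glue]
    exact integral_ite_le h.mem
      (((continuous_const.mul (continuous_psi z)).norm.pow 2).intervalIntegrable _ _)
      (((continuous_const.mul (continuous_chi z)).norm.pow 2).intervalIntegrable _ _)
  have d3 : ∫ x in R.a..R.b, R.Q x * ‖R.glue z y A B x‖ ^ 2 =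
      (∫ x in R.a..y, R.Q x * ‖A * R.psi z x‖ ^ 2) +
      ∫ x in y..R.b, R.Q x * ‖B * R.chi z x‖ ^ 2 := by
    simp_rw [norm_sq_glue, mul_ite]
    exact integral_ite_le h.mem
      (iQ (continuous_const.mul (continuous_psi z)) _ _ h.mem.1)
      (iQ (continuous_const.mul (continuous_chi z)) _ _ h.mem.2)
  rw [nsq, d1, d2, d3]
  have j : B * R.chi' z y = s + A * R.psi' z y := by rw [← h.jump]; ring
  -- For β₂ = 0 the quotient β₁ / β₂ has the default value 0, which is the right one: ψ(a) = 0 and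
  -- the boundary term vanishes.
  have ba : A * R.psi' z R.a * starRingEnd ℂ (A * R.psi z R.a) =
      -((R.β₁ / R.β₂ * ‖A * R.psi z R.a‖ ^ 2 : ℝ) : ℂ) := by
    rw [psi_left, psi'_left, norm_mul, mul_pow, Complex.norm_real, Real.norm_eq_abs, sq_abs]
    have h1 : ((‖A‖ ^ 2 : ℝ) : ℂ) = A * starRingEnd ℂ A := by
      rw [Complex.mul_conj, Complex.normSq_eq_norm_sq]
    rw [map_mul, Complex.conj_ofReal]
    have h2 : R.β₁ / R.β₂ * (‖A‖ ^ 2 * R.β₂ ^ 2) = ‖A‖ ^ 2 * (R.β₁ * R.β₂) := by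
      by_cases hb : R.β₂ = 0
      · simp [hb]
      · field_simp
    rw [h2, Complex.ofReal_mul, h1]
    push_cast
    ring
  have bb : B * R.chi' z R.b * starRingEnd ℂ (B * R.chi z R.b) =
      ((‖B‖ ^ 2 : ℝ) : ℂ) * (z * R.ρ + R.bdry z) := by
    have h1 : ((‖B‖ ^ 2 : ℝ) : ℂ) = B * starRingEnd ℂ B := by
      rw [Complex.mul_conj, Complex.normSq_eq_norm_sq]
    rw [← chi'_mul_conj_chi_right, h1, map_mul]
    ring
  rw [ba] at e1
  rw [bb, ← h.eq, j] at e2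
  push_cast at e1 e2 ⊢
  linear_combination e1 + e2

lemma abs_integral_Q_le (h : R.IsGlued z y A B s) :
    |∫ x in R.a..R.b, R.Q x * ‖R.glue z y A B x‖ ^ 2| ≤ R.bound * R.nsq z y A B := by
  have hc := continuous_glue h
  have h1 : ‖∫ x in R.a..R.b, R.Q x * ‖R.glue z y A B x‖ ^ 2‖ ≤
      ∫ x in R.a..R.b, R.bound * ‖R.glue z y A B x‖ ^ 2 := by
    refine intervalIntegral.norm_integral_le_of_norm_le R.a_le_b
      (Eventually.of_forall fun t _ => ?_) (Continuous.intervalIntegrable (by fun_prop) _ _)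
    rw [norm_mul, norm_pow, norm_norm]
    exact mul_le_mul_of_nonneg_right (R.abs_le t) (by positivity)
  rw [intervalIntegral.integral_const_mul] at h1
  refine h1.trans (mul_le_mul_of_nonneg_left ?_ R.bound_nonneg)
  have := mul_nonneg R.rho_pos.le (sq_nonneg ‖B‖)
  rw [nsq]; linarith

/-- In the imaginary part of the energy identity only z · `nsq` and the jump term survive. -/
lemma abs_im_mul_nsq_le (h : R.IsGlued z y A B s) :
    |z.im| * R.nsq z y A B ≤ ‖s‖ * ‖A * R.psi z y‖ := by
  have e := congrArg Complex.im (energy_glue h)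
  rw [Complex.sub_im, Complex.add_im, Complex.add_im, Complex.ofReal_im, Complex.ofReal_im,
    Complex.ofReal_im, Complex.im_mul_ofReal, Complex.neg_im] at e
  have e2 : z.im * R.nsq z y A B = (s * starRingEnd ℂ (A * R.psi z y)).im := by linarith
  rw [← abs_of_nonneg (nsq_nonneg (R := R) (z := z) (y := y) (A := A) (B := B)), ← abs_mul, e2]
  refine (Complex.abs_im_le_norm _).trans (le_of_eq ?_)
  rw [norm_mul, RCLike.norm_conj]

end IsGlued

/-- The a priori bound for the Dirichlet integral. -/
lemma exists_dsq_le : ∃ C : ℝ, 0 ≤ C ∧ ∀ {z : ℂ} {y : ℝ} {A B s : ℂ}, R.IsGlued z y A B s →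
    R.dsq z y A B ≤ 2 * ((C + z.re) * R.nsq z y A B + ‖s‖ * ‖A * R.psi z y‖) := by
  obtain ⟨C₁, hC₁, hb⟩ := exists_bdry_le (R := R)
  set c := |R.β₁ / R.β₂| with hc
  -- With this τ the boundary terms at a (coefficient c) and at b (coefficient C₁) contribute at
  -- most half of the Dirichlet integral, which is moved to the left-hand side.
  set τ : ℝ := 1 / (2 * (c + C₁ + 1)) with hτ
  have hc0 : 0 ≤ c := abs_nonneg _
  have hτ0 : 0 < τ := by positivity
  have hba := sub_pos.2 R.a_lt_b
  have hρ := R.rho_pos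
  set K := 1 / (R.b - R.a) + 1 / τ with hK
  have hK0 : 0 < K := by positivity
  have hbd := R.bound_nonneg
  refine ⟨R.bound + (c + C₁) * K + C₁ / R.ρ, by positivity, fun {z y A B s} h => ?_⟩
  set n := R.nsq z y A B with hn
  set d := R.dsq z y A B with hd
  have hd0 : 0 ≤ d := dsq_nonneg
  have e := congrArg Complex.re (energy_glue h)
  rw [Complex.sub_re, Complex.add_re, Complex.add_re, Complex.ofReal_re, Complex.ofReal_re,
    Complex.ofReal_re, Complex.re_mul_ofReal, Complex.neg_re] at e
  have b0 : |(s * starRingEnd ℂ (A * R.psi z y)).re| ≤ ‖s‖ * ‖A * R.psi z y‖ := by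
    refine (Complex.abs_re_le_norm _).trans (le_of_eq ?_)
    rw [norm_mul, RCLike.norm_conj]
  have b1 := abs_integral_Q_le h
  have sa : ‖A * R.psi z R.a‖ ^ 2 ≤ K * n + τ * d := by
    have := sobolev_glue h hτ0 left_mem
    rwa [glue, if_pos h.mem.1] at this
  have sb : ‖B * R.chi z R.b‖ ^ 2 ≤ K * n + τ * d := by
    have := sobolev_glue h hτ0 right_mem
    rw [glue] at this
    split_ifs at this with hby
    -- If y = b the glued function uses its left branch at b; the matching condition turns the value
    -- into Bχ(b).
    · have : R.b = y := le_antisymm hby h.mem.2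
      subst this
      rwa [h.eq] at this
    · exact this
  have b2 : R.β₁ / R.β₂ * ‖A * R.psi z R.a‖ ^ 2 ≤ c * (K * n + τ * d) :=
    mul_le_mul (le_abs_self _) sa (by positivity) hc0
  have b3 : ‖B‖ ^ 2 * R.bdry z ≤ C₁ / R.ρ * n + C₁ * (K * n + τ * d) := by
    have h1 : ‖B‖ ^ 2 ≤ n / R.ρ := by
      rw [le_div_iff₀ hρ, mul_comm]; exact rho_mul_le_nsq
    calc ‖B‖ ^ 2 * R.bdry z ≤ ‖B‖ ^ 2 * (C₁ * (1 + ‖R.chi z R.b‖ ^ 2)) := by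
          gcongr; exact hb z
      _ = C₁ * ‖B‖ ^ 2 + C₁ * ‖B * R.chi z R.b‖ ^ 2 := by rw [norm_mul]; ring
      _ ≤ C₁ * (n / R.ρ) + C₁ * (K * n + τ * d) := by gcongr
      _ = _ := by ring
  have b4 : (c + C₁) * (τ * d) ≤ d / 2 := by
    have : (c + C₁) * τ ≤ 1 / 2 := by
      rw [hτ, mul_one_div, div_le_div_iff₀ (by positivity) (by norm_num)]
      linarith
    nlinarith
  have b5 := neg_le_of_abs_le b0
  have b6 := neg_le_of_abs_le b1
  nlinarith

end RegularSL

/-- Evaluation along m followed by integration against h is a bounded linear functional on C([a, b],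
ℂ²). The reparametrization m accommodates χ, which is defined by reflection. -/
lemma differentiable_integral_eval_fst_mul {a b : ℝ} {Φ : ℂ → C(Set.Icc a b, ℂ × ℂ)}
    (hΦ : Differentiable ℂ Φ) {m : ℝ → Set.Icc a b} (hm : Continuous m) {h : ℝ → ℂ} {c d : ℝ}
    (hh : IntervalIntegrable h volume c d) :
    Differentiable ℂ fun z => ∫ x in c..d, (Φ z (m x)).1 * h x := by
  have hi : ∀ f : C(Set.Icc a b, ℂ × ℂ),
      IntervalIntegrable (fun x => (f (m x)).1 * h x) volume c d := fun f =>
    hh.continuousOn_mul (f.continuous.comp hm).fst.continuousOn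
  let L : C(Set.Icc a b, ℂ × ℂ) →ₗ[ℂ] ℂ :=
    { toFun := fun f => ∫ x in c..d, (f (m x)).1 * h x
      map_add' := fun f g => by
        rw [← intervalIntegral.integral_add (hi f) (hi g)]
        refine intervalIntegral.integral_congr fun x _ => ?_
        simp [add_mul]
      map_smul' := fun r f => by
        rw [RingHom.id_apply, smul_eq_mul, ← intervalIntegral.integral_const_mul]
        refine intervalIntegral.integral_congr fun x _ => ?_
        simp [mul_assoc] }
  let L' : C(Set.Icc a b, ℂ × ℂ) →L[ℂ] ℂ :=
    L.mkContinuous |∫ x in c..d, ‖h x‖| fun f => by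
      have h1 : ‖∫ x in c..d, (f (m x)).1 * h x‖ ≤ |∫ x in c..d, ‖f‖ * ‖h x‖| := by
        refine intervalIntegral.norm_integral_le_abs_of_norm_le
          (Eventually.of_forall fun x => ?_) (hh.norm.const_mul _)
        rw [norm_mul]
        gcongr
        exact (norm_fst_le _).trans (f.norm_coe_le_norm _)
      rw [intervalIntegral.integral_const_mul, abs_mul, abs_norm, mul_comm] at h1
      exact h1
  exact L'.differentiable.comp hΦ

/-! ### Analytic dependence on z and location of the eigenvalues -/

namespace RegularSL

variable {R : RegularSL}

variable (R) in
def psiMap (z : ℂ) : C(Set.Icc R.a R.b, ℂ × ℂ) := R.solMap z (R.β₂, -R.β₁)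

variable (R) in
def chiMap (z : ℂ) : C(Set.Icc R.a R.b, ℂ × ℂ) :=
  R.reflect.solMap z (z * R.α₂' + R.α₂, -(z * R.α₁' + R.α₁))

lemma differentiable_psiMap : Differentiable ℂ R.psiMap :=
  R.toPotential.differentiable_solMap (differentiable_const _)

lemma differentiable_chiMap : Differentiable ℂ R.chiMap :=
  R.toPotential.reflect.differentiable_solMap (by fun_prop)

variable (R) in
/-- The projection of the line onto `[a, b]`. -/
def proj (x : ℝ) : Set.Icc R.a R.b := Set.projIcc R.a R.b R.a_le_b x

lemma continuous_proj : Continuous R.proj := continuous_projIcc (h := R.a_le_b)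

lemma differentiable_eval {Φ : ℂ → C(Set.Icc R.a R.b, ℂ × ℂ)} (hΦ : Differentiable ℂ Φ)
    (y : Set.Icc R.a R.b) : Differentiable ℂ fun z => Φ z y := by
  let L : C(Set.Icc R.a R.b, ℂ × ℂ) →L[ℂ] ℂ × ℂ := ContinuousMap.evalCLM ℂ y
  exact L.differentiable.comp hΦ

lemma differentiable_psi (x : ℝ) : Differentiable ℂ fun z => R.psi z x :=
  (differentiable_eval differentiable_psiMap _).fst

lemma differentiable_psi' (x : ℝ) : Differentiable ℂ fun z => R.psi' z x :=
  (differentiable_eval differentiable_psiMap _).snd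

lemma differentiable_chi (x : ℝ) : Differentiable ℂ fun z => R.chi z x :=
  (differentiable_eval differentiable_chiMap _).fst

lemma differentiable_chi' (x : ℝ) : Differentiable ℂ fun z => R.chi' z x :=
  (differentiable_eval differentiable_chiMap _).snd.neg

lemma differentiable_wr : Differentiable ℂ R.wr :=
  ((differentiable_psi _).mul (differentiable_chi' _)).sub
    ((differentiable_psi' _).mul (differentiable_chi _))

/-- Without a jump the energy identity gives |Im z| · `nsq` ≤ 0, while `nsq` ≥ ρ|k|² > 0. -/
lemma im_eq_zero_of_wr {z : ℂ} (hz : R.wr z = 0) : z.im = 0 := by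
  obtain ⟨k, hk, h⟩ := exists_psi_eq_mul_chi hz
  have h1 := abs_im_mul_nsq_le (isGlued_of_wr_eq_zero left_mem h)
  rw [norm_zero, zero_mul] at h1
  have h2 := nsq_pos (R := R) (z := z) (y := R.a) (A := 1) hk
  by_contra h0
  have := mul_pos (abs_pos.2 h0) h2
  linarith

lemma wr_ne_zero_of_im {z : ℂ} (hz : z.im ≠ 0) : R.wr z ≠ 0 := fun h => hz (im_eq_zero_of_wr h)

/-- For an eigenfunction the a priori bound reads 0 ≤ `dsq` ≤ 2(C + Re z) · `nsq` with `nsq`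
positive. -/
lemma exists_le_re_of_wr : ∃ C : ℝ, ∀ z : ℂ, R.wr z = 0 → -C ≤ z.re := by
  obtain ⟨C, -, hC⟩ := exists_dsq_le (R := R)
  refine ⟨C, fun z hz => ?_⟩
  obtain ⟨k, hk, h⟩ := exists_psi_eq_mul_chi hz
  have h1 := hC (isGlued_of_wr_eq_zero left_mem h)
  rw [norm_zero, zero_mul, add_zero] at h1
  have h2 := nsq_pos (R := R) (z := z) (y := R.a) (A := 1) hk
  have h3 := dsq_nonneg (R := R) (z := z) (y := R.a) (A := 1) (B := k)
  by_contra h0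
  have : (C + z.re) * R.nsq z R.a 1 k < 0 := mul_neg_of_neg_of_pos (by linarith) h2
  linarith

/-- A bound for the norm of Green's function off the real axis. -/
lemma exists_nsq_green_le : ∃ C : ℝ, 0 ≤ C ∧ ∀ {z : ℂ}, z.im ≠ 0 → ∀ {y : ℝ},
    y ∈ Set.Icc R.a R.b →
    R.nsq z y (R.chi z y / R.wr z) (R.psi z y / R.wr z) ≤ C * √(1 + ‖z‖) / z.im ^ 2 := by
  obtain ⟨C, hC0, hC⟩ := exists_dsq_le (R := R)
  have hba := sub_pos.2 R.a_lt_b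
  refine ⟨1 / (R.b - R.a) + 1 + 2 * (C + 2), by positivity, fun {z} hz {y} hy => ?_⟩
  have h := isGlued_green (wr_ne_zero_of_im hz) hy
  set A := R.chi z y / R.wr z
  set B := R.psi z y / R.wr z
  have h1 := hC h
  have h2 := abs_im_mul_nsq_le h
  set r := √(1 + ‖z‖) with hr
  have hr2 : r ^ 2 = 1 + ‖z‖ := Real.sq_sqrt (by positivity)
  have hr1 : 1 ≤ r := Real.one_le_sqrt.2 (by linarith [norm_nonneg z])
  have hr0 : 0 < r := by linarith
  -- Write t = |Im z| and A₀ for the modulus of Green's function on the diagonal. The energy bounds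
  -- give tn ≤ A₀ and td ≲ r²A₀. The choice τ = 1/r balances the Sobolev terms to tA₀² ≲ rA₀, whence
  -- t²n ≤ tA₀ ≲ r.
  have h3 := sobolev_glue h (τ := 1 / r) (by positivity) hy
  rw [glue, if_pos le_rfl] at h3
  rw [norm_one, one_mul] at h1 h2
  set n := R.nsq z y A B
  set d := R.dsq z y A B
  set A₀ := ‖A * R.psi z y‖
  have hA₀ : 0 ≤ A₀ := norm_nonneg _
  have hn : 0 ≤ n := nsq_nonneg
  set t := |z.im| with ht
  have ht0 : 0 < t := abs_pos.2 hz
  have htz : t ≤ r ^ 2 := by rw [hr2]; linarith [Complex.abs_im_le_norm z]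
  have hre : z.re ≤ r ^ 2 := by
    rw [hr2]; linarith [Complex.re_le_norm z]
  rw [← sq_abs z.im, ← ht, le_div_iff₀ (by positivity)]
  have hd : t * d ≤ 2 * (C + 2) * r ^ 2 * A₀ := by
    have h4 : (C + z.re) * n ≤ (C + 1) * r ^ 2 * n := by
      refine mul_le_mul_of_nonneg_right ?_ hn
      have := le_mul_of_one_le_right hC0 (one_le_pow₀ (n := 2) hr1)
      linarith
    have h5 : t * ((C + 1) * r ^ 2 * n) ≤ (C + 1) * r ^ 2 * A₀ := by
      calc t * ((C + 1) * r ^ 2 * n) = (C + 1) * r ^ 2 * (t * n) := by ring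
        _ ≤ _ := by gcongr
    have h6 : t * A₀ ≤ r ^ 2 * A₀ := by gcongr
    have h7 : t * d ≤ t * (2 * ((C + 1) * r ^ 2 * n + A₀)) := by
      gcongr; linarith
    nlinarith
  have h8 : t * A₀ ^ 2 ≤ (1 / (R.b - R.a) + 1 + 2 * (C + 2)) * r * A₀ := by
    have h9 : t * A₀ ^ 2 ≤ (1 / (R.b - R.a) + r) * (t * n) + 1 / r * (t * d) := by
      have := mul_le_mul_of_nonneg_left h3 ht0.le
      rw [one_div_one_div] at this
      linarith
    have h10 : (1 / (R.b - R.a) + r) * (t * n) ≤ ((1 / (R.b - R.a) + 1) * r) * A₀ := by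
      have : 1 / (R.b - R.a) + r ≤ (1 / (R.b - R.a) + 1) * r := by
        have : 0 ≤ 1 / (R.b - R.a) := by positivity
        nlinarith
      gcongr
    have h11 : 1 / r * (t * d) ≤ 2 * (C + 2) * r * A₀ := by
      calc 1 / r * (t * d) ≤ 1 / r * (2 * (C + 2) * r ^ 2 * A₀) := by gcongr
        _ = _ := by field_simp
    nlinarith
  have h12 : t * A₀ ≤ (1 / (R.b - R.a) + 1 + 2 * (C + 2)) * r := by
    rcases hA₀.eq_or_lt with h0 | h0
    · rw [← h0]; simp; positivity
    · refine le_of_mul_le_mul_right ?_ h0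
      calc t * A₀ * A₀ = t * A₀ ^ 2 := by ring
        _ ≤ _ := h8
  nlinarith

/-! ### Eigenfunctions and simplicity of the eigenvalues -/

section Eigenvalue

variable {l : ℝ} {k : ℂ}

/-- The inner product of a glued function with an eigenfunction. -/
lemma lagrange_glue
    (hk : ∀ x ∈ Set.Icc R.a R.b, R.psi l x = k * R.chi l x ∧ R.psi' l x = k * R.chi' l x)
    {z : ℂ} {y : ℝ} {A B s : ℂ} (h : R.IsGlued z y A B s) :
    (z - l) * ((∫ x in R.a..R.b, R.glue z y A B x * starRingEnd ℂ (R.psi l x)) +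
      R.ρ * B * starRingEnd ℂ k) = s * starRingEnd ℂ (R.psi l y) := by
  have hv := (isSol_psi (R := R) (l : ℂ)).conj
  rw [Complex.conj_ofReal] at hv
  have e1 := ((isSol_psi (R := R) z).const_mul A).lagrange hv h.mem.1 le_rfl h.mem.2
  have e2 := ((isSol_chi (R := R) z).const_mul B).lagrange hv h.mem.2 h.mem.1 le_rfl
  have cps := Complex.continuous_conj.comp (continuous_psi (R := R) (l : ℂ))
  have e3 : ∫ x in R.a..R.b, R.glue z y A B x * starRingEnd ℂ (R.psi l x) =
      (∫ x in R.a..y, A * R.psi z x * starRingEnd ℂ (R.psi l x)) +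
      ∫ x in y..R.b, B * R.chi z x * starRingEnd ℂ (R.psi l x) := by
    simp_rw [glue, ite_mul]
    exact integral_ite_le h.mem
      (((continuous_const.mul (continuous_psi z)).mul cps).intervalIntegrable _ _)
      (((continuous_const.mul (continuous_chi z)).mul cps).intervalIntegrable _ _)
  rw [e3]
  obtain ⟨k1, k2⟩ := hk R.b right_mem
  have j : B * R.chi' z y = s + A * R.psi' z y := by rw [← h.jump]; ring
  rw [j, ← h.eq, k1, k2, chi_right, chi'_right, chi_right, chi'_right] at e2
  rw [psi_left, psi'_left, psi_left, psi'_left] at e1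
  rw [ρ]
  simp only [map_add, map_mul, map_neg, Complex.conj_ofReal] at e1 e2
  push_cast
  linear_combination e1 + e2

lemma glue_eq_psi
    (hk : ∀ x ∈ Set.Icc R.a R.b, R.psi l x = k * R.chi l x ∧ R.psi' l x = k * R.chi' l x)
    (y : ℝ) {x : ℝ} (hx : x ∈ Set.Icc R.a R.b) : R.glue l y 1 k x = R.psi l x := by
  rw [glue, ← (hk x hx).1, one_mul, ite_self]

lemma nsq_eigen
    (hk : ∀ x ∈ Set.Icc R.a R.b, R.psi l x = k * R.chi l x ∧ R.psi' l x = k * R.chi' l x)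
    (y : ℝ) :
    R.nsq l y 1 k = (∫ x in R.a..R.b, ‖R.psi l x‖ ^ 2) + R.ρ * ‖k‖ ^ 2 := by
  rw [nsq]
  congr 1
  refine intervalIntegral.integral_congr fun x hx => ?_
  rw [Set.uIcc_of_le R.a_le_b] at hx
  simp only [glue_eq_psi hk y hx]

/-- The derivative of the Wronskian at an eigenvalue; in particular eigenvalues are simple. -/
lemma deriv_wr_mul
    (hk : ∀ x ∈ Set.Icc R.a R.b, R.psi l x = k * R.chi l x ∧ R.psi' l x = k * R.chi' l x)
    (y : ℝ) :
    deriv R.wr l * starRingEnd ℂ k = R.nsq l y 1 k := by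
  have hv := (isSol_psi (R := R) (l : ℂ)).conj
  rw [Complex.conj_ofReal] at hv
  have cps := Complex.continuous_conj.comp (continuous_psi (R := R) (l : ℂ))
  -- Lagrange's identity for ψ_z and the conjugate of ψ_l is (z − l) g(z) = k̄ wr(z);
  -- differentiating at l gives g(l) = k̄ wr'(l). There α₁'ψ(b) − α₂'ψ'(b) = kρ, so g(l) is the
  -- squared norm.
  set g : ℂ → ℂ := fun z => (∫ x in R.a..R.b, R.psi z x * starRingEnd ℂ (R.psi l x)) +
    starRingEnd ℂ k * (R.α₁' * R.psi z R.b - R.α₂' * R.psi' z R.b) with hg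
  have hgc : Differentiable ℂ g :=
    (differentiable_integral_eval_fst_mul (differentiable_psiMap (R := R)) continuous_proj
      (cps.intervalIntegrable _ _)).add
      (((differentiable_psi _).const_mul _ |>.sub ((differentiable_psi' _).const_mul _)).const_mul _)
  have key : ∀ z, (z - l) * g z = starRingEnd ℂ k * R.wr z := fun z => by
    have e1 := (isSol_psi (R := R) z).lagrange hv R.a_le_b le_rfl le_rfl
    obtain ⟨k1, k2⟩ := hk R.b right_mem
    rw [k1, k2, chi_right, chi'_right, psi_left, psi'_left, psi_left, psi'_left] at e1
    simp only [map_add, map_mul, map_neg, Complex.conj_ofReal] at e1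
    rw [wr_eq_right]
    simp only [hg]
    linear_combination e1
  have hgl : g l = R.nsq l y 1 k := by
    rw [nsq_eigen hk]
    obtain ⟨k1, k2⟩ := hk R.b right_mem
    have e2 : ∫ x in R.a..R.b, R.psi l x * starRingEnd ℂ (R.psi l x) =
        ((∫ x in R.a..R.b, ‖R.psi l x‖ ^ 2 : ℝ) : ℂ) := by
      rw [← intervalIntegral.integral_ofReal]
      refine intervalIntegral.integral_congr fun x _ => ?_
      rw [Complex.mul_conj, Complex.normSq_eq_norm_sq]
    have e3 : ((‖k‖ ^ 2 : ℝ) : ℂ) = k * starRingEnd ℂ k := by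
      rw [Complex.mul_conj, Complex.normSq_eq_norm_sq]
    simp only [hg]
    rw [e2, k1, k2, chi_right, chi'_right, Complex.ofReal_add, Complex.ofReal_mul, e3, ρ]
    push_cast
    ring
  have d1 : HasDerivAt (fun z => (z - l) * g z) (1 * g l + ((l : ℂ) - l) * deriv g l) (l : ℂ) :=
    ((hasDerivAt_id (l : ℂ)).sub_const _).mul (hgc l).hasDerivAt
  have d2 : HasDerivAt (fun z => (z - l) * g z) (starRingEnd ℂ k * deriv R.wr l) (l : ℂ) := by
    simp_rw [key]
    exact (differentiable_wr l).hasDerivAt.const_mul _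
  have := d1.unique d2
  rw [← hgl]
  linear_combination -this

lemma deriv_wr_ne_zero (hl : R.wr l = 0) : deriv R.wr l ≠ 0 := by
  obtain ⟨k, hk0, hk⟩ := exists_psi_eq_mul_chi hl
  intro h
  have := deriv_wr_mul hk R.a
  rw [h, zero_mul] at this
  exact (nsq_pos (R := R) (z := l) (y := R.a) (A := 1) hk0).ne' (by exact_mod_cast this.symm)

end Eigenvalue

end RegularSL

/-- Bessel's inequality for an orthogonal family. -/
lemma sum_norm_inner_sq_div_le {ι H : Type*} [NormedAddCommGroup H] [InnerProductSpace ℂ H]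
    {e : ι → H} (he : ∀ i, e i ≠ 0) (ho : ∀ i j, i ≠ j → inner ℂ (e i) (e j) = 0)
    (s : Finset ι) (f : H) :
    ∑ i ∈ s, ‖inner ℂ (e i) f‖ ^ 2 / ‖e i‖ ^ 2 ≤ ‖f‖ ^ 2 := by
  classical
  have hon : Orthonormal ℂ fun i => ((‖e i‖⁻¹ : ℝ) : ℂ) • e i := by
    refine ⟨fun i => ?_, fun i j hij => ?_⟩
    · rw [norm_smul, Complex.norm_real, norm_inv, norm_norm,
        inv_mul_cancel₀ (norm_ne_zero_iff.2 (he i))]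
    · change inner ℂ (((‖e i‖⁻¹ : ℝ) : ℂ) • e i) (((‖e j‖⁻¹ : ℝ) : ℂ) • e j) = 0
      rw [inner_smul_left, inner_smul_right, ho i j hij, mul_zero, mul_zero]
  refine le_trans (le_of_eq ?_) (hon.sum_inner_products_le f (s := s))
  refine Finset.sum_congr rfl fun i _ => ?_
  rw [inner_smul_left, norm_mul, mul_pow, Complex.conj_ofReal, Complex.norm_real, norm_inv,
    norm_norm, inv_pow, div_eq_inv_mul]

/-! ### Orthogonal eigenvectors in L² ⊕ ℂ and the transform -/

namespace RegularSL

variable {R : RegularSL}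

variable (R) in
/-- Lebesgue measure on `[a, b]`. -/
abbrev vol : Measure ℝ := volume.restrict (Set.Ioc R.a R.b)

variable (R) in
/-- The Hilbert space `L²(a, b) ⊕ ℂ`. -/
abbrev Hilb : Type := WithLp 2 (Lp ℂ 2 R.vol × ℂ)

/-- The vector with components `u` and `√ρ k`. -/
def vec {u : ℝ → ℂ} (hu : MemLp u 2 R.vol) (k : ℂ) : R.Hilb :=
  WithLp.toLp 2 (hu.toLp u, (√R.ρ : ℂ) * k)

lemma memLp_of_continuous {u : ℝ → ℂ} (hu : Continuous u) : MemLp u 2 R.vol := by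
  obtain ⟨C, hC⟩ := (isCompact_Icc (a := R.a) (b := R.b)).exists_bound_of_continuousOn
    hu.continuousOn
  refine MemLp.of_bound hu.aestronglyMeasurable C ?_
  refine (ae_restrict_iff' measurableSet_Ioc).2 (Eventually.of_forall fun x hx => ?_)
  exact hC x ⟨hx.1.le, hx.2⟩

lemma intervalIntegrable_of_memLp {h : ℝ → ℂ} (hh : MemLp h 2 R.vol) :
    IntervalIntegrable h volume R.a R.b := by
  rw [intervalIntegrable_iff_integrableOn_Ioc_of_le R.a_le_b]
  exact hh.integrable (by norm_num)

lemma inner_vec {u v : ℝ → ℂ} (hu : MemLp u 2 R.vol) (hv : MemLp v 2 R.vol) (k l : ℂ) :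
    inner ℂ (vec hu k) (vec hv l) =
      (∫ x in R.a..R.b, v x * starRingEnd ℂ (u x)) + R.ρ * l * starRingEnd ℂ k := by
  rw [WithLp.prod_inner_apply, intervalIntegral.integral_of_le R.a_le_b]
  congr 1
  · rw [L2.inner_def]
    refine integral_congr_ae ?_
    filter_upwards [hu.coeFn_toLp, hv.coeFn_toLp] with x h1 h2
    simp only [vec]
    rw [h1, h2]
    simp
  · have h : ((√R.ρ : ℝ) : ℂ) * √R.ρ = R.ρ := by
      rw [← Complex.ofReal_mul, Real.mul_self_sqrt R.rho_pos.le]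
    simp only [vec, RCLike.inner_apply, map_mul, Complex.conj_ofReal]
    rw [← h]
    ring

lemma norm_vec_sq {u : ℝ → ℂ} (hu : MemLp u 2 R.vol) (k : ℂ) :
    ‖vec hu k‖ ^ 2 = (∫ x in R.a..R.b, ‖u x‖ ^ 2) + R.ρ * ‖k‖ ^ 2 := by
  have h := inner_self_eq_norm_sq_to_K (𝕜 := ℂ) (vec hu k)
  rw [inner_vec] at h
  have e2 : ∫ x in R.a..R.b, u x * starRingEnd ℂ (u x) =
      ((∫ x in R.a..R.b, ‖u x‖ ^ 2 : ℝ) : ℂ) := by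
    rw [← intervalIntegral.integral_ofReal]
    refine intervalIntegral.integral_congr fun x _ => ?_
    rw [Complex.mul_conj, Complex.normSq_eq_norm_sq]
  have e3 : ((‖k‖ ^ 2 : ℝ) : ℂ) = k * starRingEnd ℂ k := by
    rw [Complex.mul_conj, Complex.normSq_eq_norm_sq]
  rw [e2, mul_assoc, ← e3] at h
  have h' : (((∫ x in R.a..R.b, ‖u x‖ ^ 2) + R.ρ * ‖k‖ ^ 2 : ℝ) : ℂ) =
      ((‖vec hu k‖ ^ 2 : ℝ) : ℂ) := by
    rw [Complex.ofReal_add, Complex.ofReal_mul, h, Complex.ofReal_pow]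
    rfl
  exact (Complex.ofReal_injective h').symm

variable (R) in
/-- The eigenvalues. -/
abbrev Spec : Type := {l : ℝ // R.wr l = 0}

/-- The factor of proportionality of the two solutions at an eigenvalue. -/
def kap (l : R.Spec) : ℂ := (exists_psi_eq_mul_chi l.2).choose

lemma kap_ne_zero (l : R.Spec) : kap l ≠ 0 := (exists_psi_eq_mul_chi l.2).choose_spec.1

lemma kap_spec (l : R.Spec) : ∀ x ∈ Set.Icc R.a R.b,
    R.psi (l : ℝ) x = kap l * R.chi (l : ℝ) x ∧ R.psi' (l : ℝ) x = kap l * R.chi' (l : ℝ) x :=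
  (exists_psi_eq_mul_chi l.2).choose_spec.2

/-- The squared norm of an eigenvector. -/
def eigNsq (l : R.Spec) : ℝ := R.nsq (l : ℝ) R.a 1 (kap l)

lemma eigNsq_pos (l : R.Spec) : 0 < eigNsq l := nsq_pos (kap_ne_zero l)

/-- The eigenvectors. -/
def eig (l : R.Spec) : R.Hilb := 
  vec (memLp_of_continuous (continuous_psi (R := R) ((l : ℝ) : ℂ))) (kap l)

lemma norm_eig_sq (l : R.Spec) : ‖eig l‖ ^ 2 = eigNsq l := by
  rw [eig, norm_vec_sq, eigNsq, nsq_eigen (kap_spec l)]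

lemma eig_ne_zero (l : R.Spec) : eig l ≠ 0 := by
  intro h
  have := norm_eig_sq l
  rw [h, norm_zero] at this
  have h2 := eigNsq_pos l
  rw [← this] at h2
  norm_num at h2

/-- With s = 1 this computes the Fourier coefficients of Green's vector, conj ψ_l(y) / (z − l), from
Lagrange's identity alone. -/
lemma sub_mul_inner_eig_glue (l : R.Spec) {z : ℂ} {y : ℝ} {A B s : ℂ} (h : R.IsGlued z y A B s) :
    (z - (l : ℝ)) * inner ℂ (eig l) (vec (memLp_of_continuous (continuous_glue h)) B) =
      s * starRingEnd ℂ (R.psi (l : ℝ) y) := by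
  rw [eig, inner_vec, lagrange_glue (kap_spec l) h]

/-- An eigenvector is a glued function with jump 0, so Lagrange's identity gives (m − l) times the
inner product equal to 0. -/
lemma inner_eig_eig {l m : R.Spec} (hlm : l ≠ m) : inner ℂ (eig l) (eig m) = 0 := by
  have h := isGlued_of_wr_eq_zero (left_mem (R := R)) (kap_spec m)
  have e := lagrange_glue (kap_spec l) h
  rw [zero_mul] at e
  have hne : (((m : ℝ) : ℂ) - (l : ℝ)) ≠ 0 := by
    rw [sub_ne_zero]
    exact fun h => hlm (Subtype.ext (by exact_mod_cast h.symm))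
  rw [eig, eig, inner_vec]
  refine Eq.trans ?_ ((mul_eq_zero.1 e).resolve_left hne)
  congr 1
  refine intervalIntegral.integral_congr fun x hx => ?_
  rw [Set.uIcc_of_le R.a_le_b] at hx
  simp only [glue_eq_psi (kap_spec m) _ hx]

variable (R) in
/-- The transform of `h` with kernel the Wronskian times Green's function. -/
def trans (y : ℝ) (h : ℝ → ℂ) (z : ℂ) : ℂ :=
  ∫ x in R.a..R.b, R.glue z y (R.chi z y) (R.psi z y) x * h x

/-- The quotient of the transform and the derivative of the Wronskian. -/
def coeff (y : ℝ) (h : ℝ → ℂ) (l : R.Spec) : ℂ := R.trans y h (l : ℝ) / deriv R.wr (l : ℝ)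

lemma glue_const_mul (z : ℂ) (y : ℝ) (c A B : ℂ) (x : ℝ) :
    R.glue z y (c * A) (c * B) x = c * R.glue z y A B x := by
  simp only [glue]; split_ifs <;> ring

/-- At an eigenvalue ψ = kχ, so k times the kernel degenerates to the rank-one kernel ψ(x)ψ(y). -/
lemma trans_eigen {y : ℝ} (hy : y ∈ Set.Icc R.a R.b) (h : ℝ → ℂ) (l : R.Spec) :
    kap l * R.trans y h (l : ℝ) = R.psi (l : ℝ) y * ∫ x in R.a..R.b, R.psi (l : ℝ) x * h x := by
  rw [trans, ← intervalIntegral.integral_const_mul, ← intervalIntegral.integral_const_mul]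
  refine intervalIntegral.integral_congr fun x hx => ?_
  rw [Set.uIcc_of_le R.a_le_b] at hx
  rw [← mul_assoc, ← mul_assoc, ← glue_const_mul, ← (kap_spec l y hy).1, glue,
    mul_assoc, mul_left_comm, ← (kap_spec l x hx).1, ite_self]

/-- The unknown factor |k| cancels between `trans_eigen` and `deriv_wr_mul`. What remains is a
product of two Fourier coefficients over the squared norm of the eigenvector. -/
lemma norm_coeff {y : ℝ} (hy : y ∈ Set.Icc R.a R.b) (h : ℝ → ℂ) (l : R.Spec) :
    ‖coeff y h l‖ =
      ‖R.psi (l : ℝ) y‖ * ‖∫ x in R.a..R.b, R.psi (l : ℝ) x * h x‖ / eigNsq l := by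
  have h1 := congrArg norm (deriv_wr_mul (kap_spec l) R.a)
  have h2 := congrArg norm (trans_eigen hy h l)
  rw [norm_mul, norm_mul] at h2
  rw [norm_mul, RCLike.norm_conj, Complex.norm_real, Real.norm_eq_abs, ← eigNsq,
    abs_of_pos (eigNsq_pos l)] at h1
  have hk : 0 < ‖kap l‖ := norm_pos_iff.2 (kap_ne_zero l)
  have hd : 0 < ‖deriv R.wr (l : ℝ)‖ := norm_pos_iff.2 (deriv_wr_ne_zero l.2)
  rw [coeff, norm_div, ← h2, ← h1]
  field_simp

/-! ### Bounds through Bessel's inequality -/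

section Bounds

variable {y : ℝ} {h : ℝ → ℂ}

/-- The norm of the function transformed. -/
def hnorm (hh : MemLp h 2 R.vol) : ℝ := ‖vec (R := R) hh.star 0‖

lemma norm_integral_glue_mul_le (hh : MemLp h 2 R.vol) {z A B s : ℂ} (hg : R.IsGlued z y A B s) :
    ‖∫ x in R.a..R.b, R.glue z y A B x * h x‖ ≤ √(R.nsq z y A B) * hnorm hh := by
  have e : ∫ x in R.a..R.b, R.glue z y A B x * h x =
      inner ℂ (vec (R := R) hh.star 0) (vec (memLp_of_continuous (continuous_glue hg)) B) := by
    rw [inner_vec]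
    simp
  have n : ‖vec (R := R) (memLp_of_continuous (continuous_glue hg)) B‖ = √(R.nsq z y A B) := by
    rw [nsq, ← norm_vec_sq (memLp_of_continuous (continuous_glue hg)), Real.sqrt_sq (norm_nonneg _)]
  rw [e, ← n, mul_comm]
  exact norm_inner_le_norm _ _

/-- Each term is the product of the normalized Fourier coefficients of Green's vector and of (h̄,
0); Cauchy–Schwarz and Bessel's inequality for both vectors finish. -/
lemma sum_norm_coeff_div_le (hh : MemLp h 2 R.vol) {z : ℂ} (hz : z.im ≠ 0)
    (hy : y ∈ Set.Icc R.a R.b) (s : Finset R.Spec) :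
    ∑ l ∈ s, ‖coeff y h l‖ / ‖z - (l : ℝ)‖ ≤
      √(R.nsq z y (R.chi z y / R.wr z) (R.psi z y / R.wr z)) * hnorm hh := by
  have hg := isGlued_green (wr_ne_zero_of_im hz) hy
  set A := R.chi z y / R.wr z
  set B := R.psi z y / R.wr z
  set G := vec (memLp_of_continuous (continuous_glue hg)) B with hG
  set V := vec (R := R) hh.star 0 with hV
  have n : ‖G‖ = √(R.nsq z y A B) := by
    rw [nsq, ← norm_vec_sq (memLp_of_continuous (continuous_glue hg)), Real.sqrt_sq (norm_nonneg _)]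
  have b1 := sum_norm_inner_sq_div_le eig_ne_zero (fun l m => inner_eig_eig) s G
  have b2 := sum_norm_inner_sq_div_le eig_ne_zero (fun l m => inner_eig_eig) s V
  have t : ∀ l : R.Spec, ‖coeff y h l‖ / ‖z - (l : ℝ)‖ =
      (‖inner ℂ (eig l) G‖ / ‖eig l‖) * (‖inner ℂ (eig l) V‖ / ‖eig l‖) := fun l => by
    have h1 := congrArg norm (sub_mul_inner_eig_glue l hg)
    rw [one_mul, norm_mul, RCLike.norm_conj, ← hG] at h1
    have h2 : ‖inner ℂ (eig l) V‖ = ‖∫ x in R.a..R.b, R.psi (l : ℝ) x * h x‖ := by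
      rw [hV, eig, inner_vec, mul_zero, zero_mul, add_zero, ← RCLike.norm_conj,
        intervalIntegral.integral_of_le R.a_le_b, intervalIntegral.integral_of_le R.a_le_b,
        ← integral_conj]
      congr 1
      refine integral_congr_ae (Eventually.of_forall fun x => ?_)
      simp [mul_comm]
    have hzl : ‖z - (l : ℝ)‖ ≠ 0 := by
      rw [norm_ne_zero_iff]
      intro h0
      apply hz
      have := congrArg Complex.im h0
      simpa using this
    have hE : ‖eig l‖ ≠ 0 := norm_ne_zero_iff.2 (eig_ne_zero l)
    rw [norm_coeff hy, ← h1, ← h2, ← norm_eig_sq]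
    field_simp
  simp_rw [t]
  have cs := Finset.sum_mul_sq_le_sq_mul_sq s (fun l => ‖inner ℂ (eig l) G‖ / ‖eig l‖)
    (fun l => ‖inner ℂ (eig l) V‖ / ‖eig l‖)
  simp_rw [div_pow] at cs
  rw [← n, hnorm, ← hV]
  refine (sq_le_sq₀ (Finset.sum_nonneg fun _ _ => by positivity) (by positivity)).1 ?_
  rw [mul_pow]
  refine cs.trans (mul_le_mul b1 b2 (Finset.sum_nonneg fun _ _ => by positivity) (by positivity))

lemma summable_norm_coeff_div (hh : MemLp h 2 R.vol) {z : ℂ} (hz : z.im ≠ 0)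
    (hy : y ∈ Set.Icc R.a R.b) : Summable fun l : R.Spec => ‖coeff y h l‖ / ‖z - (l : ℝ)‖ :=
  summable_of_sum_le (fun _ => by positivity) (sum_norm_coeff_div_le hh hz hy)

lemma trans_eq_wr_mul {z : ℂ} (hz : R.wr z ≠ 0) (y : ℝ) (h : ℝ → ℂ) :
    R.trans y h z = R.wr z * ∫ x in R.a..R.b,
      R.glue z y (R.chi z y / R.wr z) (R.psi z y / R.wr z) x * h x := by
  rw [trans, ← intervalIntegral.integral_const_mul]
  refine intervalIntegral.integral_congr fun x _ => ?_
  rw [← mul_assoc, ← glue_const_mul, mul_div_cancel₀ _ hz, mul_div_cancel₀ _ hz]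

end Bounds

lemma differentiable_trans {y : ℝ} (hy : y ∈ Set.Icc R.a R.b) {h : ℝ → ℂ}
    (hh : IntervalIntegrable h volume R.a R.b) : Differentiable ℂ (R.trans y h) := by
  have h1 : IntervalIntegrable h volume R.a y := hh.mono_set (by
    rw [Set.uIcc_of_le hy.1, Set.uIcc_of_le R.a_le_b]; exact Set.Icc_subset_Icc le_rfl hy.2)
  have h2 : IntervalIntegrable h volume y R.b := hh.mono_set (by
    rw [Set.uIcc_of_le hy.2, Set.uIcc_of_le R.a_le_b]; exact Set.Icc_subset_Icc hy.1 le_rfl)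
  have e : R.trans y h = fun z => R.chi z y * (∫ x in R.a..y, R.psi z x * h x) +
      R.psi z y * ∫ x in y..R.b, R.chi z x * h x := by
    funext z
    rw [trans, ← intervalIntegral.integral_const_mul, ← intervalIntegral.integral_const_mul]
    simp_rw [glue, ite_mul, mul_assoc]
    exact integral_ite_le hy
      ((h1.continuousOn_mul (continuous_psi z).continuousOn).const_mul _)
      ((h2.continuousOn_mul (continuous_chi z).continuousOn).const_mul _)
  rw [e]
  exact ((differentiable_chi y).mul
    (differentiable_integral_eval_fst_mul differentiable_psiMap continuous_proj h1)).add
    ((differentiable_psi y).mul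
      (differentiable_integral_eval_fst_mul differentiable_chiMap
        (continuous_proj.comp (continuous_const.sub continuous_id)) h2))

end RegularSL

/-! ### Entire functions: division, vanishing, difference quotients -/

lemma Differentiable.dslope_complex {f : ℂ → ℂ} (hf : Differentiable ℂ f) (c : ℂ) :
    Differentiable ℂ (dslope f c) :=
  differentiableOn_univ.1 ((Complex.differentiableOn_dslope univ_mem).2 hf.differentiableOn)

/-- Division of entire functions with simple zeros. -/
lemma exists_eq_mul_of_simple_zeros {f w : ℂ → ℂ} (hf : Differentiable ℂ f)
    (hw : Differentiable ℂ w) (h : ∀ z, w z = 0 → f z = 0 ∧ deriv w z ≠ 0) :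
    ∃ H : ℂ → ℂ, Differentiable ℂ H ∧ ∀ z, f z = H z * w z := by
  classical
  refine ⟨fun z => if w z = 0 then deriv f z / deriv w z else f z / w z, fun c => ?_,
    fun z => ?_⟩
  · by_cases hc : w c = 0
    · have h1 : dslope w c c ≠ 0 := by rw [dslope_same]; exact (h c hc).2
      have h2 : DifferentiableAt ℂ (fun z => dslope f c z / dslope w c z) c :=
        (hf.dslope_complex c c).div (hw.dslope_complex c c) h1
      refine h2.congr_of_eventuallyEq ?_
      filter_upwards [(hw.dslope_complex c).continuous.continuousAt.eventually_ne h1] with z hz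
      rcases eq_or_ne z c with rfl | hzc
      · rw [if_pos hc, dslope_same, dslope_same]
      · have e1 := sub_smul_dslope_of_zero hc z
        have e2 := sub_smul_dslope_of_zero (h c hc).1 z
        rw [smul_eq_mul] at e1 e2
        have hzc' := sub_ne_zero.2 hzc
        rw [if_neg (by rw [← e1]; exact mul_ne_zero hzc' hz), ← e1, ← e2,
          mul_div_mul_left _ _ hzc']
    · refine ((hf c).div (hw c) hc).congr_of_eventuallyEq ?_
      filter_upwards [hw.continuous.continuousAt.eventually_ne hc] with z hz
      rw [if_neg hz]; rfl
  · by_cases hz : w z = 0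
    · rw [hz, (h z hz).1, mul_zero]
    · simp only [if_neg hz, div_mul_cancel₀ _ hz]

/-- An entire function that is small off the real axis vanishes. -/
lemma eq_zero_of_norm_mul_abs_im_le {H : ℂ → ℂ} (hH : Differentiable ℂ H) {C : ℝ}
    (h : ∀ z : ℂ, z.im ≠ 0 → ‖H z‖ * |z.im| ≤ C * √(1 + ‖z‖)) (z₀ : ℂ) : H z₀ = 0 := by
  have hC : 0 ≤ C := by
    have h1 := (mul_nonneg (norm_nonneg _) (abs_nonneg _)).trans (h Complex.I (by simp))
    by_contra h0
    have : C * √(1 + ‖Complex.I‖) < 0 := mul_neg_of_neg_of_pos (not_le.1 h0) (by positivity)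
    linarith
  have key : ∀ r : ℝ, 1 ≤ r → 2 * ‖z₀‖ ≤ r → ‖H z₀‖ ≤ 8 * C / √r := by
    intro r hr1 hr
    have hr0 : 0 < r := by linarith
    -- On |z| = r the factor z² − r² has modulus 2r|Im z|, which compensates the missing control of
    -- H near the real axis. Inside, at |z₀| ≤ r/2, it has modulus at least 3r²/4.
    have hd : Differentiable ℂ fun z => (z ^ 2 - (r : ℂ) ^ 2) * H z := by fun_prop
    have hb := Complex.norm_le_of_forall_mem_frontier_norm_le
      (f := fun z => (z ^ 2 - (r : ℂ) ^ 2) * H z)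
      (U := Metric.ball 0 r) Metric.isBounded_ball hd.diffContOnCl (C := 2 * r * (C * √(1 + r)))
      (fun z hz => ?_) (z := z₀) (subset_closure (by
        rw [mem_ball_zero_iff]; linarith [norm_nonneg z₀]))
    · have h1 : 3 / 4 * r ^ 2 ≤ ‖z₀ ^ 2 - (r : ℂ) ^ 2‖ := by
        have := norm_sub_norm_le ((r : ℂ) ^ 2) (z₀ ^ 2)
        rw [norm_sub_rev, norm_pow, norm_pow, Complex.norm_real, Real.norm_eq_abs,
          abs_of_pos hr0] at this
        have h2 : ‖z₀‖ ^ 2 ≤ (r / 2) ^ 2 := pow_le_pow_left₀ (norm_nonneg _) (by linarith) 2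
        nlinarith
      rw [norm_mul] at hb
      have h3 : √(1 + r) ≤ 2 * √r := by
        rw [← Real.sqrt_sq (show (0 : ℝ) ≤ 2 by norm_num), ← Real.sqrt_mul (by norm_num)]
        exact Real.sqrt_le_sqrt (by linarith)
      have h4 : 3 / 4 * r ^ 2 * ‖H z₀‖ ≤ 2 * r * (C * (2 * √r)) :=
        (mul_le_mul_of_nonneg_right h1 (norm_nonneg _)).trans (hb.trans (by gcongr))
      have hs : 0 < √r := Real.sqrt_pos.2 hr0
      have hs2 : √r ^ 2 = r := Real.sq_sqrt hr0.le
      rw [le_div_iff₀ hs]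
      have h5 : (r * √r) * (‖H z₀‖ * √r) ≤ (r * √r) * (8 * C) := by
        calc (r * √r) * (‖H z₀‖ * √r) = r * √r ^ 2 * ‖H z₀‖ := by ring
          _ = r ^ 2 * ‖H z₀‖ := by rw [hs2]; ring
          _ ≤ (r * √r) * (8 * C) := by
            have : 0 ≤ r * √r * C := by positivity
            nlinarith
      exact le_of_mul_le_mul_left h5 (by positivity)
    · rw [frontier_ball _ hr0.ne', mem_sphere_zero_iff_norm] at hz
      have e : z ^ 2 - (r : ℂ) ^ 2 = z * (2 * z.im * Complex.I) := by
        have h1 : (r : ℂ) ^ 2 = z * starRingEnd ℂ z := by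
          rw [Complex.mul_conj, Complex.normSq_eq_norm_sq, hz]; push_cast; rfl
        have h2 := Complex.sub_conj z
        push_cast at h2
        rw [h1, ← h2]
        ring
      simp only [e, norm_mul, hz, Complex.norm_I, Complex.norm_real, Complex.norm_ofNat,
        Real.norm_eq_abs, mul_one]
      by_cases hi : z.im = 0
      · simp only [hi, abs_zero, mul_zero, zero_mul]; positivity
      · have := h z hi
        rw [hz] at this
        nlinarith
  have hlim : Tendsto (fun r : ℝ => 8 * C / √r) atTop (𝓝 0) :=
    tendsto_const_nhds.div_atTop Real.tendsto_sqrt_atTop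
  have h0 : ‖H z₀‖ ≤ 0 := ge_of_tendsto hlim (by
    filter_upwards [eventually_ge_atTop 1, eventually_ge_atTop (2 * ‖z₀‖)] with r h1 h2
    exact key r h1 h2)
  exact norm_le_zero_iff.1 h0

lemma samplingFun_eq_dslope {w : ℂ → ℂ} {c : ℂ} (hc : w c = 0) (hd : deriv w c ≠ 0) (z : ℂ) :
    samplingFun w c z = dslope w c z / deriv w c := by
  rw [samplingFun]
  split_ifs with h
  · rw [h, dslope_same, div_self hd]
  · rw [dslope_of_ne _ h, slope_def_field, hc, sub_zero, div_div]

/-- The bound is uniform over all zeros c. For |z − c| ≥ 1 the quotient is |w(z)| / |z − c| and |i −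
c| ≤ (2 + r)|z − c|; for closer c the derivative of w on a larger disc bounds the quotient. -/
lemma exists_norm_dslope_mul_le {w : ℂ → ℂ} (hw : Differentiable ℂ w) (r : ℝ) :
    ∃ M : ℝ, 0 ≤ M ∧ ∀ z : ℂ, ‖z‖ ≤ r → ∀ c : ℂ, w c = 0 →
      ‖dslope w c z‖ * ‖Complex.I - c‖ ≤ M := by
  obtain ⟨D, hD⟩ := (isCompact_closedBall (0 : ℂ) (r + 1)).exists_bound_of_continuousOn
    (hw.contDiff.continuous_deriv le_top : Continuous (deriv w)).continuousOn
  obtain ⟨E, hE⟩ := (isCompact_closedBall (0 : ℂ) r).exists_bound_of_continuousOn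
    hw.continuous.continuousOn
  refine ⟨(|D| + |E|) * (2 + |r|), by positivity, fun z hz c hc => ?_⟩
  have hr : 0 ≤ r := (norm_nonneg z).trans hz
  rw [abs_of_nonneg hr]
  have hI : ‖Complex.I - c‖ ≤ 1 + r + ‖z - c‖ := by
    calc ‖Complex.I - c‖ = ‖(Complex.I - z) + (z - c)‖ := by ring_nf
      _ ≤ ‖Complex.I - z‖ + ‖z - c‖ := norm_add_le _ _
      _ ≤ 1 + r + ‖z - c‖ := by
        have := norm_sub_le Complex.I z
        rw [Complex.norm_I] at this
        linarith
  rcases le_or_gt 1 ‖z - c‖ with h1 | h1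
  · have hzc : z ≠ c := by rintro rfl; simp at h1; linarith
    rw [dslope_of_ne _ hzc, slope_def_field, hc, sub_zero, norm_div]
    have h2 : ‖w z‖ ≤ |E| := (hE z (by simpa using hz)).trans (le_abs_self _)
    have h3 : ‖Complex.I - c‖ ≤ (2 + r) * ‖z - c‖ := by nlinarith
    calc ‖w z‖ / ‖z - c‖ * ‖Complex.I - c‖ ≤ |E| / ‖z - c‖ * ((2 + r) * ‖z - c‖) := by gcongr
      _ = |E| * (2 + r) := by field_simp
      _ ≤ (|D| + |E|) * (2 + r) := by gcongr; linarith [abs_nonneg D]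
  · have hcb : c ∈ Metric.closedBall (0 : ℂ) (r + 1) := by
      rw [mem_closedBall_zero_iff]
      have := norm_sub_norm_le c z
      rw [norm_sub_rev] at this
      linarith
    have hzb : z ∈ Metric.closedBall (0 : ℂ) (r + 1) := by
      rw [mem_closedBall_zero_iff]; linarith
    have h2 : ‖dslope w c z‖ ≤ |D| := by
      rcases eq_or_ne z c with rfl | hzc
      · rw [dslope_same]; exact (hD z hzb).trans (le_abs_self _)
      · rw [dslope_of_ne _ hzc, slope_def_field, norm_div,
          div_le_iff₀ (norm_pos_iff.2 (sub_ne_zero.2 hzc))]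
        refine (convex_closedBall (0 : ℂ) (r + 1)).norm_image_sub_le_of_norm_deriv_le
          (fun x _ => hw x) (fun x hx => (hD x hx).trans (le_abs_self _)) hcb hzb
    calc ‖dslope w c z‖ * ‖Complex.I - c‖ ≤ |D| * (2 + r) := by
          gcongr; linarith
      _ ≤ (|D| + |E|) * (2 + r) := by gcongr; linarith [abs_nonneg E]

/-! ### The sampling series -/

namespace RegularSL

variable {R : RegularSL} {y : ℝ} {h : ℝ → ℂ}

/-- A term of the sampling series. -/
def samplingTerm (y : ℝ) (h : ℝ → ℂ) (l : R.Spec) (z : ℂ) : ℂ :=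
  R.trans y h (l : ℝ) * samplingFun R.wr (l : ℝ) z

lemma samplingTerm_eq (l : R.Spec) (z : ℂ) :
    samplingTerm y h l z = coeff y h l * dslope R.wr (l : ℝ) z := by
  rw [samplingTerm, samplingFun_eq_dslope l.2 (deriv_wr_ne_zero l.2), coeff]
  ring

lemma samplingTerm_eq_of_im (l : R.Spec) {z : ℂ} (hz : z.im ≠ 0) :
    samplingTerm y h l z = R.wr z * (coeff y h l / (z - (l : ℝ))) := by
  have hzl : z ≠ (l : ℝ) := by rintro rfl; simp at hz
  rw [samplingTerm_eq, dslope_of_ne _ hzl, slope_def_field, l.2, sub_zero]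
  ring

/-- The terms on a disc are dominated by a constant times |coeff| / |i − l|, which is summable
because i is not real. -/
lemma exists_samplingTerm_bound (hh : MemLp h 2 R.vol) (hy : y ∈ Set.Icc R.a R.b) (r : ℝ) :
    ∃ u : R.Spec → ℝ, Summable u ∧ ∀ l z, ‖z‖ ≤ r → ‖samplingTerm y h l z‖ ≤ u l := by
  obtain ⟨M, -, hM⟩ := exists_norm_dslope_mul_le (differentiable_wr (R := R)) r
  refine ⟨fun l => M * (‖coeff y h l‖ / ‖Complex.I - (l : ℝ)‖),
    (summable_norm_coeff_div hh (by simp) hy).mul_left M, fun l z hz => ?_⟩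
  have hne : 0 < ‖Complex.I - ((l : ℝ) : ℂ)‖ := by
    rw [norm_pos_iff]
    intro h0
    have := congrArg Complex.im h0
    simp at this
  beta_reduce
  rw [samplingTerm_eq, norm_mul, ← mul_div_assoc, le_div_iff₀ hne]
  calc ‖coeff y h l‖ * ‖dslope R.wr (l : ℝ) z‖ * ‖Complex.I - ((l : ℝ) : ℂ)‖
      = ‖coeff y h l‖ * (‖dslope R.wr (l : ℝ) z‖ * ‖Complex.I - ((l : ℝ) : ℂ)‖) := by ring
    _ ≤ ‖coeff y h l‖ * M := by gcongr; exact hM z hz _ l.2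
    _ = M * ‖coeff y h l‖ := mul_comm _ _

lemma summable_samplingTerm (hh : MemLp h 2 R.vol) (hy : y ∈ Set.Icc R.a R.b) (z : ℂ) :
    Summable fun l => ‖samplingTerm (R := R) y h l z‖ := by
  obtain ⟨u, hu, hb⟩ := exists_samplingTerm_bound hh hy ‖z‖
  exact hu.of_nonneg_of_le (fun _ => norm_nonneg _) fun l => hb l z le_rfl

lemma differentiable_tsum_samplingTerm (hh : MemLp h 2 R.vol) (hy : y ∈ Set.Icc R.a R.b) :
    Differentiable ℂ fun z => ∑' l, samplingTerm (R := R) y h l z := by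
  intro z
  obtain ⟨u, hu, hb⟩ := exists_samplingTerm_bound hh hy (‖z‖ + 1)
  have := Complex.differentiableOn_tsum_of_summable_norm (U := Metric.ball 0 (‖z‖ + 1)) hu
    (F := fun l => samplingTerm (R := R) y h l) (fun l => ?_) Metric.isOpen_ball
    (fun l w hw => hb l w (mem_ball_zero_iff.1 hw).le)
  · exact this.differentiableAt (Metric.isOpen_ball.mem_nhds (by simp))
  · have e : samplingTerm y h l = fun z => coeff y h l * dslope R.wr (l : ℝ) z :=
      funext (samplingTerm_eq l)
    rw [e]
    exact ((differentiable_wr.dslope_complex _).const_mul _).differentiableOn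

/-- The sampling series represents the transform. -/
lemma hasSum_samplingTerm (hh : MemLp h 2 R.vol) (hy : y ∈ Set.Icc R.a R.b) (z : ℂ) :
    HasSum (fun l => samplingTerm (R := R) y h l z) (R.trans y h z) := by
  classical
  set D : ℂ → ℂ := fun z => R.trans y h z - ∑' l, samplingTerm (R := R) y h l z with hD
  have hDd : Differentiable ℂ D :=
    (differentiable_trans hy (intervalIntegrable_of_memLp hh)).sub
      (differentiable_tsum_samplingTerm hh hy)
  -- At an eigenvalue only its own sampling function is nonzero, with value 1, so the series
  -- reproduces the transform there.
  obtain ⟨H, hH, hHw⟩ := exists_eq_mul_of_simple_zeros hDd (differentiable_wr (R := R)) (fun c hc => by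
    have hcr : c = ((c.re : ℝ) : ℂ) := Complex.ext rfl (by simp [im_eq_zero_of_wr hc])
    rw [hcr] at hc ⊢
    refine ⟨?_, deriv_wr_ne_zero hc⟩
    simp only [hD]
    rw [tsum_eq_single (⟨c.re, hc⟩ : R.Spec)]
    · rw [samplingTerm, samplingFun, if_pos rfl, mul_one, sub_self]
    · intro m hm
      have hne : ((c.re : ℝ) : ℂ) ≠ ((m : ℝ) : ℂ) := fun h0 =>
        hm (Subtype.ext (by exact_mod_cast h0.symm))
      rw [samplingTerm, samplingFun, if_neg hne, hc, zero_div, mul_zero])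
  obtain ⟨C, hC0, hC⟩ := exists_nsq_green_le (R := R)
  -- After division by `wr`, the integral and the series are each at most √N times the norm of h;
  -- hence the factor 2.
  have hz0 := eq_zero_of_norm_mul_abs_im_le hH (C := 2 * hnorm hh * √C) (fun z hz => by
    have hw := wr_ne_zero_of_im (R := R) hz
    set N := R.nsq z y (R.chi z y / R.wr z) (R.psi z y / R.wr z) with hN
    have b1 := norm_integral_glue_mul_le hh (isGlued_green hw hy)
    have b2 : ‖∑' l : R.Spec, coeff y h l / (z - (l : ℝ))‖ ≤ √N * hnorm hh := by
      have hs : Summable fun l : R.Spec => ‖coeff y h l / (z - (l : ℝ))‖ := by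
        simp_rw [norm_div]; exact summable_norm_coeff_div hh hz hy
      refine (norm_tsum_le_tsum_norm hs).trans (hs.tsum_le_of_sum_le fun s => ?_)
      simp_rw [norm_div]
      exact sum_norm_coeff_div_le hh hz hy s
    have e : H z = (∫ x in R.a..R.b,
        R.glue z y (R.chi z y / R.wr z) (R.psi z y / R.wr z) x * h x) -
        ∑' l : R.Spec, coeff y h l / (z - (l : ℝ)) := by
      refine mul_right_cancel₀ hw ?_
      rw [← hHw]
      simp only [hD]
      rw [trans_eq_wr_mul hw]
      simp_rw [samplingTerm_eq_of_im _ hz]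
      rw [tsum_mul_left]
      ring
    have b3 : ‖H z‖ ≤ 2 * hnorm hh * √N := by
      rw [e]; refine (norm_sub_le _ _).trans ?_; linarith
    have hti : 0 < |z.im| := abs_pos.2 hz
    have b4 : √N * |z.im| ≤ √C * √(1 + ‖z‖) := by
      have h1 : √N * |z.im| = √(N * z.im ^ 2) := by
        rw [Real.sqrt_mul nsq_nonneg, Real.sqrt_sq_eq_abs]
      rw [h1, ← Real.sqrt_mul hC0]
      refine Real.sqrt_le_sqrt ?_
      have h2 := hC hz hy
      rw [← hN, le_div_iff₀ (by positivity)] at h2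
      refine h2.trans (mul_le_mul_of_nonneg_left ?_ hC0)
      rw [Real.sqrt_le_left (by positivity)]
      nlinarith [norm_nonneg z]
    have hn0 : 0 ≤ hnorm hh := norm_nonneg _
    calc ‖H z‖ * |z.im| ≤ 2 * hnorm hh * √N * |z.im| := by gcongr
      _ = 2 * hnorm hh * (√N * |z.im|) := by ring
      _ ≤ 2 * hnorm hh * (√C * √(1 + ‖z‖)) := by gcongr
      _ = 2 * hnorm hh * √C * √(1 + ‖z‖) := by ring)
  have h1 := hHw z
  rw [hz0 z, zero_mul] at h1
  have h2 : R.trans y h z = ∑' l, samplingTerm (R := R) y h l z := sub_eq_zero.1 h1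
  rw [h2]
  exact (summable_samplingTerm hh hy z).of_norm.hasSum

/-- There are infinitely many eigenvalues. -/
lemma infinite_spec : Infinite R.Spec := by
  rw [← not_finite_iff_infinite]
  intro hfin
  have := Fintype.ofFinite R.Spec
  -- Off the exceptional set the solutions are differentiable at y, so the jump of the derivative
  -- can be read there.
  obtain ⟨y, hyS, hyI⟩ := (R.countable.dense_compl ℝ).exists_mem_open isOpen_Ioo
    (Set.nonempty_Ioo.2 R.a_lt_b)
  have hy : y ∈ Set.Icc R.a R.b := ⟨hyI.1.le, hyI.2.le⟩
  have hIm : Complex.I.im ≠ 0 := by simp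
  have hw := wr_ne_zero_of_im (R := R) hIm
  have hg := isGlued_green hw hy
  set A := R.chi Complex.I y / R.wr Complex.I
  set B := R.psi Complex.I y / R.wr Complex.I
  -- These are the coefficients of Green's function at z = i when a finite sampling series, divided
  -- by wr(i), is read as an identity for every continuous h.
  set d : R.Spec → ℂ := fun l =>
    R.psi (l : ℝ) y / kap l / deriv R.wr (l : ℝ) / (Complex.I - (l : ℝ)) with hd
  set f : ℝ → ℂ := fun x => ∑ l, d l * R.psi (l : ℝ) x with hf
  have hfc : Continuous f :=
    continuous_finsetSum _ fun l _ => continuous_const.mul (continuous_psi _)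
  have hGc := continuous_glue hg
  set E : ℝ → ℂ := fun x => R.glue Complex.I y A B x - f x with hE
  have hEc : Continuous E := hGc.sub hfc
  have key : ∀ h : ℝ → ℂ, Continuous h → ∫ x in R.a..R.b, E x * h x = 0 := by
    intro h hc
    have h1 := (hasSum_samplingTerm (memLp_of_continuous hc) hy Complex.I).unique (hasSum_fintype _)
    simp_rw [samplingTerm_eq_of_im _ hIm] at h1
    rw [trans_eq_wr_mul hw, ← Finset.mul_sum] at h1
    have h2 := mul_left_cancel₀ hw h1
    have h3 : ∀ l : R.Spec, coeff y h l / (Complex.I - (l : ℝ)) =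
        d l * ∫ x in R.a..R.b, R.psi (l : ℝ) x * h x := fun l => by
      have h4 : R.trans y h (l : ℝ) =
          R.psi (l : ℝ) y * (∫ x in R.a..R.b, R.psi (l : ℝ) x * h x) / kap l := by
        rw [← trans_eigen hy, mul_div_cancel_left₀ _ (kap_ne_zero l)]
      rw [coeff, h4]
      simp only [hd]
      ring
    simp_rw [h3] at h2
    simp only [hE, sub_mul]
    have i1 : IntervalIntegrable (fun x => R.glue Complex.I y A B x * h x) volume R.a R.b :=
      (hGc.mul hc).intervalIntegrable _ _
    have i2 : IntervalIntegrable (fun x => f x * h x) volume R.a R.b :=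
      (hfc.mul hc).intervalIntegrable _ _
    rw [intervalIntegral.integral_sub i1 i2, h2, sub_eq_zero]
    simp only [hf, Finset.sum_mul]
    have i3 : ∀ l ∈ Finset.univ, IntervalIntegrable
        (fun x => d l * R.psi ((l : ℝ) : ℂ) x * h x) volume R.a R.b := fun l _ =>
      ((continuous_const.mul (continuous_psi _)).mul hc).intervalIntegrable _ _
    rw [intervalIntegral.integral_finsetSum i3]
    refine Finset.sum_congr rfl fun l _ => ?_
    rw [← intervalIntegral.integral_const_mul]
    simp_rw [mul_assoc]
  have hE0 : ∀ x ∈ Set.Icc R.a R.b, E x = 0 := by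
    have h1 := key (fun x => starRingEnd ℂ (E x)) (Complex.continuous_conj.comp hEc)
    have h2 : ∫ x in R.a..R.b, ‖E x‖ ^ 2 = 0 := by
      have : ((∫ x in R.a..R.b, ‖E x‖ ^ 2 : ℝ) : ℂ) = 0 := by
        rw [← h1, ← intervalIntegral.integral_ofReal]
        refine intervalIntegral.integral_congr fun x _ => ?_
        rw [Complex.mul_conj, Complex.normSq_eq_norm_sq]
      exact_mod_cast this
    intro x hx
    by_contra hne
    have := intervalIntegral.integral_pos R.a_lt_b (f := fun x => ‖E x‖ ^ 2)
      (hEc.norm.pow 2).continuousOn (fun _ _ => by positivity)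
      ⟨x, hx, by positivity⟩
    linarith
  have hGf : ∀ x ∈ Set.Icc R.a R.b, R.glue Complex.I y A B x = f x := fun x hx =>
    sub_eq_zero.1 (hE0 x hx)
  have hn := Icc_mem_nhds hyI.1 hyI.2
  have hyS' : y ∈ Set.Icc R.a R.b \ R.S := ⟨hy, hyS⟩
  -- The finite sum f is differentiable at y, but it agrees with Green's function, whose one-sided
  -- derivatives at y differ by 1.
  have hfd : HasDerivAt f (∑ l, d l * R.psi' (l : ℝ) y) y := by
    refine HasDerivAt.fun_sum fun l _ => ?_
    exact (((isSol_psi _).deriv y hyS').hasDerivAt hn).const_mul _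
  have hl : HasDerivWithinAt f (A * R.psi' Complex.I y) (Set.Iic y) y := by
    refine ((((isSol_psi _).deriv y hyS').hasDerivAt hn).const_mul A
      ).hasDerivWithinAt.congr_of_eventuallyEq
      ?_ ?_
    · filter_upwards [mem_nhdsWithin_of_mem_nhds hn, self_mem_nhdsWithin] with x hx hxy
      rw [← hGf x hx, glue, if_pos (Set.mem_Iic.1 hxy)]
    · rw [← hGf y hy, glue, if_pos le_rfl]
  have hr : HasDerivWithinAt f (B * R.chi' Complex.I y) (Set.Ici y) y := by
    refine ((((isSol_chi _).deriv y hyS').hasDerivAt hn).const_mul B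
      ).hasDerivWithinAt.congr_of_eventuallyEq
      ?_ ?_
    · filter_upwards [mem_nhdsWithin_of_mem_nhds hn, self_mem_nhdsWithin] with x hx hxy
      rw [← hGf x hx, glue]
      split_ifs with hxy'
      · rw [le_antisymm hxy' hxy, hg.eq]
      · rfl
    · rw [← hGf y hy, glue, if_pos le_rfl, hg.eq]
  have e1 := (uniqueDiffWithinAt_Iic y).eq_deriv _ hfd.hasDerivWithinAt hl
  have e2 := (uniqueDiffWithinAt_Ici y).eq_deriv _ hfd.hasDerivWithinAt hr
  have := hg.jump
  rw [← e1, ← e2, sub_self] at this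
  exact zero_ne_one this

end RegularSL

/-- A zero-free holomorphic function with bounded modulus is nearly constant well inside a disc. -/
lemma exists_eq_mul_exp_of_ne_zero {h : ℂ → ℂ} {R M : ℝ} (hR : 0 < R)
    (hd : DifferentiableOn ℂ h (Metric.ball 0 R)) (h0 : ∀ z ∈ Metric.ball (0 : ℂ) R, h z ≠ 0)
    (hM : 0 < M) (hb : ∀ z ∈ Metric.ball (0 : ℂ) R, ‖h z‖ ≤ ‖h 0‖ * Real.exp M)
    {z : ℂ} (hz : z ∈ Metric.ball (0 : ℂ) R) :
    ∃ g : ℂ, h z = h 0 * Complex.exp g ∧ ‖g‖ ≤ 2 * M * ‖z‖ / (R - ‖z‖) := by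
  have hd' : DifferentiableOn ℂ (fun z => deriv h z / h z) (Metric.ball 0 R) :=
    (hd.deriv Metric.isOpen_ball).div hd h0
  -- The primitive g of h'/h with g(0) = 0 is a logarithm of h/h(0). The hypothesis bounds its real
  -- part by M, and Borel–Carathéodory then bounds |g|.
  obtain ⟨g, hg0, hg⟩ := hd'.isExactOn_ball.with_val_at 0 0
  have h0m : (0 : ℂ) ∈ Metric.ball (0 : ℂ) R := Metric.mem_ball_self hR
  have hconst : ∀ w ∈ Metric.ball (0 : ℂ) R, h w * Complex.exp (-g w) = h 0 := by
    intro w hw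
    have hder : ∀ x ∈ Metric.ball (0 : ℂ) R,
        HasDerivAt (fun x => h x * Complex.exp (-g x)) 0 x := fun x hx => by
      have h1 := (hd.differentiableAt (Metric.isOpen_ball.mem_nhds hx)).hasDerivAt
      refine (h1.mul (hg x hx).neg.cexp).congr_deriv ?_
      have := h0 x hx
      simp only [Pi.neg_apply]
      field_simp
      ring
    have := Metric.isOpen_ball.is_const_of_deriv_eq_zero
      (convex_ball (0 : ℂ) R).isPreconnected
      (fun x hx => (hder x hx).differentiableAt.differentiableWithinAt)
      (fun x hx => (hder x hx).deriv) hw h0m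
    simpa [hg0] using this
  have heq : ∀ w ∈ Metric.ball (0 : ℂ) R, h w = h 0 * Complex.exp (g w) := fun w hw => by
    rw [← hconst w hw, mul_assoc, ← Complex.exp_add, neg_add_cancel, Complex.exp_zero, mul_one]
  refine ⟨g z, heq z hz, Complex.borelCaratheodory_zero hM
    (fun x hx => (hg x hx).differentiableAt.differentiableWithinAt) (fun w hw => ?_) hR hz hg0⟩
  have h1 := hb w hw
  rw [heq w hw, norm_mul, Complex.norm_exp] at h1
  have h2 : 0 < ‖h 0‖ := norm_pos_iff.2 (h0 0 h0m)
  exact Real.exp_le_exp.1 (le_of_mul_le_mul_left h1 h2)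

/-! ### Canonical product and Hadamard factorization -/

section CanonicalProduct

variable {f : ℂ → ℂ} {lam : ℕ → ℝ}

/-- The successive quotients of `f` by the factors of the canonical product. -/
def canonicalQuotient (f : ℂ → ℂ) (lam : ℕ → ℝ) : ℕ → ℂ → ℂ
  | 0 => f
  | n + 1 => fun z => (if lam n = 0 then 1 else -(lam n : ℂ)) *
      dslope (canonicalQuotient f lam n) (lam n) z

lemma differentiable_canonicalQuotient (hf : Differentiable ℂ f) (n : ℕ) :
    Differentiable ℂ (canonicalQuotient f lam n) := by
  induction n with
  | zero => exact hf
  | succ n ih => exact (ih.dslope_complex _).const_mul _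

lemma canonicalFactor_eq (z : ℂ) (n : ℕ) : canonicalFactor lam z n *
    (if lam n = 0 then 1 else -(lam n : ℂ)) = z - lam n := by
  rw [canonicalFactor]
  split_ifs with h
  · simp [h]
  · have : (lam n : ℂ) ≠ 0 := by exact_mod_cast h
    field_simp
    ring

lemma canonicalFactor_eq_zero_iff {z : ℂ} {n : ℕ} : canonicalFactor lam z n = 0 ↔ z = lam n := by
  have h := canonicalFactor_eq (lam := lam) z n
  have h2 : (if lam n = 0 then 1 else -(lam n : ℂ)) ≠ 0 := by
    split_ifs with h0
    · exact one_ne_zero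
    · exact neg_ne_zero.2 (by exact_mod_cast h0)
  constructor
  · intro h0
    rw [h0, zero_mul] at h
    exact (sub_eq_zero.1 h.symm)
  · intro h0
    rw [h0, sub_self] at h
    rw [h0]
    exact (mul_eq_zero.1 h).resolve_right h2

lemma eq_prod_mul_canonicalQuotient (hinj : Function.Injective lam) (hz : ∀ n, f (lam n) = 0)
    (n : ℕ) (z : ℂ) :
    f z = (∏ i ∈ Finset.range n, canonicalFactor lam z i) * canonicalQuotient f lam n z := by
  induction n generalizing z with
  | zero => simp [canonicalQuotient]
  | succ n ih =>
    have h0 : canonicalQuotient f lam n (lam n) = 0 := by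
      have h1 := ih (lam n)
      rw [hz n] at h1
      refine (mul_eq_zero.1 h1.symm).resolve_left (Finset.prod_ne_zero_iff.2 fun i hi => ?_)
      rw [Ne, canonicalFactor_eq_zero_iff]
      intro h2
      exact (Finset.mem_range.1 hi).ne' (hinj (by exact_mod_cast h2))
    have h2 := sub_smul_dslope_of_zero h0 z
    rw [smul_eq_mul] at h2
    rw [ih z, Finset.prod_range_succ, ← h2, canonicalQuotient, ← canonicalFactor_eq]
    ring

/-- A zero of the quotient in this disc is a zero λₘ of f with m < n. The partial product vanishes
there too, so f would have a double zero, against the simplicity. -/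
lemma canonicalQuotient_ne_zero (hf : Differentiable ℂ f) (hinj : StrictMono lam)
    (hz : ∀ z, f z = 0 ↔ ∃ n, z = (lam n : ℂ)) (hd : ∀ n, deriv f (lam n : ℂ) ≠ 0) {n : ℕ} {z : ℂ}
    (hzn : ‖z‖ < lam n) : canonicalQuotient f lam n z ≠ 0 := by
  have heq := eq_prod_mul_canonicalQuotient hinj.injective (fun n => (hz _).2 ⟨n, rfl⟩) n
  intro h0
  have hfz : f z = 0 := by rw [heq z, h0, mul_zero]
  obtain ⟨m, rfl⟩ := (hz z).1 hfz
  rw [Complex.norm_real] at hzn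
  have hmn : m < n := hinj.lt_iff_lt.1 ((le_abs_self _).trans_lt hzn)
  have hp : (∏ i ∈ Finset.range n, canonicalFactor lam (lam m : ℂ) i) = 0 :=
    Finset.prod_eq_zero (Finset.mem_range.2 hmn) (canonicalFactor_eq_zero_iff.2 rfl)
  have hpd : Differentiable ℂ fun z => ∏ i ∈ Finset.range n, canonicalFactor lam z i := by
    refine Differentiable.fun_finsetProd fun i _ => ?_
    unfold canonicalFactor
    split_ifs <;> fun_prop
  have h1 : HasDerivAt f (deriv (fun z => ∏ i ∈ Finset.range n, canonicalFactor lam z i) (lam m) *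
      canonicalQuotient f lam n (lam m) +
      (∏ i ∈ Finset.range n, canonicalFactor lam (lam m : ℂ) i) *
        deriv (canonicalQuotient f lam n) (lam m)) (lam m : ℂ) := by
    have := (hpd (lam m)).hasDerivAt.mul
      (differentiable_canonicalQuotient hf n (lam m) (lam := lam)).hasDerivAt
    exact this.congr_of_eventuallyEq (Eventually.of_forall heq)
  rw [h0, hp, mul_zero, zero_mul, add_zero] at h1
  exact hd m h1.deriv

lemma one_le_norm_canonicalFactor {z : ℂ} {n : ℕ} (h1 : 1 ≤ ‖z‖) (h2 : 2 * |lam n| ≤ ‖z‖) :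
    1 ≤ ‖canonicalFactor lam z n‖ := by
  rw [canonicalFactor]
  split_ifs with h
  · exact h1
  · have hp : 0 < |lam n| := abs_pos.2 h
    have h3 : 2 ≤ ‖z / (lam n : ℂ)‖ := by
      rw [norm_div, Complex.norm_real, Real.norm_eq_abs, le_div_iff₀ hp]; exact h2
    have h4 := norm_sub_norm_le (z / (lam n : ℂ)) 1
    rw [norm_one, norm_sub_rev] at h4
    linarith

/-- On the circle of radius 2λₙ every removed factor has modulus at least 1, so the quotient is
bounded by f; the maximum principle carries this inside. The condition on λ₀ handles negative zeros.
-/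
lemma norm_canonicalQuotient_le (hf : Differentiable ℂ f) (hmono : StrictMono lam)
    (hz : ∀ n, f (lam n) = 0) {C c : ℝ} (hg : ∀ s : ℂ, ‖f (s ^ 2)‖ ≤ C * Real.exp (c * ‖s‖))
    {n : ℕ} (h1 : 1 ≤ lam n) (h0 : |lam 0| ≤ lam n) {z : ℂ} (hzn : ‖z‖ < lam n) :
    ‖canonicalQuotient f lam n z‖ ≤ C * Real.exp (c * √(2 * lam n)) := by
  have heq := eq_prod_mul_canonicalQuotient hmono.injective hz n
  refine Complex.norm_le_of_forall_mem_frontier_norm_le (U := Metric.ball 0 (2 * lam n))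
    Metric.isBounded_ball (differentiable_canonicalQuotient hf n).diffContOnCl (fun w hw => ?_)
    (subset_closure (by rw [mem_ball_zero_iff]; linarith))
  rw [frontier_ball _ (by linarith), mem_sphere_zero_iff_norm] at hw
  obtain ⟨s, rfl⟩ := IsAlgClosed.exists_pow_nat_eq w (n := 2) (by norm_num)
  have hs : ‖s‖ = √(2 * lam n) := by
    rw [← hw, norm_pow, Real.sqrt_sq (norm_nonneg _)]
  have hp : 1 ≤ ‖∏ i ∈ Finset.range n, canonicalFactor lam (s ^ 2) i‖ := by
    rw [norm_prod]
    refine Finset.one_le_prod fun i hi => ?_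
    refine one_le_norm_canonicalFactor (by linarith) ?_
    have hin : lam i ≤ lam n := hmono.monotone (Finset.mem_range.1 hi).le
    have h0i : lam 0 ≤ lam i := hmono.monotone (Nat.zero_le i)
    have : |lam i| ≤ lam n := abs_le.2 ⟨by linarith [neg_abs_le (lam 0)], hin⟩
    rw [hw]; linarith
  have h2 := hg s
  rw [heq, norm_mul, hs] at h2
  exact (le_mul_of_one_le_left (norm_nonneg _) hp).trans h2

/-- The n-th quotient is zero-free for |z| < λₙ, with modulus there at most exp(O(√λₙ)) times its
value at 0. Borel–Carathéodory makes it κ exp(O(√λₙ / λₙ)) at fixed z, so it tends to κ. Its value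
at 0 is constant from N on, because each factor 1 − z/λₙ is 1 at 0. -/
lemma tendsto_prod_canonicalFactor (hf : Differentiable ℂ f) (hmono : StrictMono lam)
    (htop : Tendsto lam atTop atTop) (hz : ∀ z, f z = 0 ↔ ∃ n, z = (lam n : ℂ))
    (hd : ∀ n, deriv f (lam n : ℂ) ≠ 0)
    {C c : ℝ} (hg : ∀ s : ℂ, ‖f (s ^ 2)‖ ≤ C * Real.exp (c * ‖s‖)) :
    ∃ κ : ℂ, κ ≠ 0 ∧ ∀ z, Tendsto (fun n => ∏ i ∈ Finset.range n, canonicalFactor lam z i) atTop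
      (𝓝 (f z / κ)) := by
  have hz' : ∀ n, f (lam n) = 0 := fun n => (hz _).2 ⟨n, rfl⟩
  obtain ⟨N, hN⟩ := (htop.eventually (eventually_ge_atTop (max 1 |lam 0|))).exists
  have hge : ∀ n, N ≤ n → 1 ≤ lam n ∧ |lam 0| ≤ lam n := fun n hn =>
    ⟨((le_max_left _ _).trans hN).trans (hmono.monotone hn),
      ((le_max_right _ _).trans hN).trans (hmono.monotone hn)⟩
  set κ := canonicalQuotient f lam N 0 with hκ
  have hκ0 : κ ≠ 0 := canonicalQuotient_ne_zero hf hmono hz hd (by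
    rw [norm_zero]; linarith [(hge N le_rfl).1])
  have hq0 : ∀ n, N ≤ n → canonicalQuotient f lam n 0 = κ := by
    intro n hn
    induction n, hn using Nat.le_induction with
    | base => rfl
    | succ n hn ih =>
      have hlam : (lam n : ℂ) ≠ 0 := by
        have := (hge n hn).1
        exact_mod_cast (by linarith : lam n ≠ 0)
      have hlam' : lam n ≠ 0 := by exact_mod_cast hlam
      have hq : canonicalQuotient f lam n (lam n) = 0 := by
        have h1 := eq_prod_mul_canonicalQuotient hmono.injective hz' n (lam n)
        rw [hz' n] at h1
        refine (mul_eq_zero.1 h1.symm).resolve_left (Finset.prod_ne_zero_iff.2 fun i hi => ?_)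
        rw [Ne, canonicalFactor_eq_zero_iff]
        intro h2
        exact (Finset.mem_range.1 hi).ne' (hmono.injective (by exact_mod_cast h2))
      have h2 := sub_smul_dslope_of_zero hq 0
      rw [zero_sub, smul_eq_mul, ih] at h2
      rw [← h2, canonicalQuotient, if_neg hlam']
  have hC : 0 < C := by
    have h1 := norm_canonicalQuotient_le hf hmono hz' hg (hge N le_rfl).1 (hge N le_rfl).2
      (z := 0) (by rw [norm_zero]; linarith [(hge N le_rfl).1])
    have h2 : 0 < ‖canonicalQuotient f lam N 0‖ := norm_pos_iff.2 hκ0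
    exact pos_of_mul_pos_left (h2.trans_le h1) (Real.exp_pos _).le
  have hκp : 0 < ‖κ‖ := norm_pos_iff.2 hκ0
  -- D moves the constant C/‖κ‖ into the exponent; the summand 1 keeps the bound for the real part
  -- positive.
  set D := |Real.log (C / ‖κ‖)| + 1 with hD
  have hD0 : 0 < D := by positivity
  refine ⟨κ, hκ0, fun z => ?_⟩
  set B : ℕ → ℝ := fun n => |c| * √(2 * lam n) + D with hB
  have hbd : ∀ n, N ≤ n → ∀ w : ℂ, ‖w‖ < lam n →
      ‖canonicalQuotient f lam n w‖ ≤ ‖canonicalQuotient f lam n 0‖ * Real.exp (B n) := by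
    intro n hn w hw
    refine (norm_canonicalQuotient_le hf hmono hz' hg (hge n hn).1 (hge n hn).2 hw).trans ?_
    rw [hq0 n hn]
    have h3 : C ≤ ‖κ‖ * Real.exp D := by
      have h4 : C / ‖κ‖ ≤ Real.exp D := by
        rw [← Real.exp_log (div_pos hC hκp)]
        exact Real.exp_le_exp.2 ((le_abs_self _).trans (by rw [hD]; linarith))
      rw [div_le_iff₀ hκp] at h4
      linarith
    calc C * Real.exp (c * √(2 * lam n))
        ≤ (‖κ‖ * Real.exp D) * Real.exp (|c| * √(2 * lam n)) := by
          gcongr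
          exact le_abs_self c
      _ = ‖κ‖ * Real.exp (B n) := by
        have h5 : Real.exp (B n) = Real.exp (|c| * √(2 * lam n)) * Real.exp D := Real.exp_add _ _
        rw [h5, mul_assoc, mul_comm (Real.exp D)]
  have hev : ∀ᶠ n in atTop, ∃ g : ℂ, canonicalQuotient f lam n z = κ * Complex.exp g ∧
      ‖g‖ ≤ 2 * B n * ‖z‖ / (lam n - ‖z‖) := by
    filter_upwards [eventually_ge_atTop N, htop.eventually (eventually_gt_atTop ‖z‖)] with n hn hzn
    obtain ⟨g, hg1, hg2⟩ := exists_eq_mul_exp_of_ne_zero (h := canonicalQuotient f lam n)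
      (R := lam n) (M := B n) (by linarith [(hge n hn).1])
      (differentiable_canonicalQuotient hf n).differentiableOn
      (fun w hw => canonicalQuotient_ne_zero hf hmono hz hd (mem_ball_zero_iff.1 hw))
      (by positivity) (fun w hw => hbd n hn w (mem_ball_zero_iff.1 hw)) (mem_ball_zero_iff.2 hzn)
    rw [hq0 n hn] at hg1
    exact ⟨g, hg1, hg2⟩
  have hlim0 : Tendsto (fun n => 2 * B n * ‖z‖ / (lam n - ‖z‖)) atTop (𝓝 0) := by
    have h1 : Tendsto (fun r : ℝ => 2 * (|c| * √(2 * r) + D) * ‖z‖ / (r - ‖z‖)) atTop (𝓝 0) := by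
      have h2 : Tendsto (fun r : ℝ => (2 * (|c| * √2 * (√r)⁻¹ + D * r⁻¹) * ‖z‖) *
          (1 - ‖z‖ * r⁻¹)⁻¹) atTop (𝓝 ((2 * (|c| * √2 * 0 + D * 0) * ‖z‖) * (1 - ‖z‖ * 0)⁻¹)) := by
        have i1 : Tendsto (fun r : ℝ => (√r)⁻¹) atTop (𝓝 0) :=
          tendsto_inv_atTop_zero.comp Real.tendsto_sqrt_atTop
        have i2 : Tendsto (fun r : ℝ => r⁻¹) atTop (𝓝 0) := tendsto_inv_atTop_zero
        refine Tendsto.mul ?_ (Tendsto.inv₀ (tendsto_const_nhds.sub (i2.const_mul _)) (by simp))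
        exact (((i1.const_mul _).add (i2.const_mul _)).const_mul _).mul_const _
      simp only [mul_zero, add_zero, zero_mul] at h2
      refine h2.congr' ?_
      filter_upwards [eventually_gt_atTop (max 1 ‖z‖)] with r hr
      have hr0 : 0 < r := by linarith [le_max_left 1 ‖z‖]
      have hrz : r - ‖z‖ ≠ 0 := by linarith [le_max_right 1 ‖z‖]
      have hs : 0 < √r := Real.sqrt_pos.2 hr0
      have hs2 : r = √r ^ 2 := (Real.sq_sqrt hr0.le).symm
      rw [Real.sqrt_mul (by norm_num)]
      have e1 : (1 - ‖z‖ * r⁻¹)⁻¹ = r / (r - ‖z‖) := by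
        rw [← one_div_div, sub_div, div_self hr0.ne', one_div, div_eq_mul_inv]
      have e2 : (√r)⁻¹ = √r / r := by
        rw [eq_div_iff hr0.ne']
        nth_rw 2 [hs2]
        field_simp
      rw [e1, e2]
      field_simp
    exact h1.comp htop
  have hq : Tendsto (fun n => canonicalQuotient f lam n z) atTop (𝓝 κ) := by
    choose! g hg1 using fun n (h : ∃ g : ℂ, canonicalQuotient f lam n z = κ * Complex.exp g ∧
      ‖g‖ ≤ 2 * B n * ‖z‖ / (lam n - ‖z‖)) => h
    have hg0 : Tendsto g atTop (𝓝 0) :=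
      squeeze_zero_norm' (hev.mono fun n hn => (hg1 n hn).2) hlim0
    have h2 : Tendsto (fun n => κ * Complex.exp (g n)) atTop (𝓝 (κ * Complex.exp 0)) :=
      ((Complex.continuous_exp.tendsto 0).comp hg0).const_mul κ
    rw [Complex.exp_zero, mul_one] at h2
    exact h2.congr' (hev.mono fun n hn => (hg1 n hn).1.symm)
  refine (tendsto_const_nhds.div hq hκ0).congr' ?_
  filter_upwards [hq.eventually_ne hκ0] with n hn
  rw [Pi.div_apply, div_eq_iff hn]
  exact eq_prod_mul_canonicalQuotient hmono.injective hz' n z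

lemma one_add_sum_le_prod_one_add {a : ℕ → ℝ} (ha : ∀ n, 0 ≤ a n) (n : ℕ) :
    1 + ∑ i ∈ Finset.range n, a i ≤ ∏ i ∈ Finset.range n, (1 + a i) := by
  induction n with
  | zero => simp
  | succ n ih =>
    rw [Finset.sum_range_succ, Finset.prod_range_succ]
    have h1 : 1 ≤ ∏ i ∈ Finset.range n, (1 + a i) :=
      Finset.one_le_prod fun i _ => by linarith [ha i]
    nlinarith [ha n]

/-- **Hadamard factorization** of an entire function of order `1 / 2` with simple real zeros that
are bounded below. -/
theorem exists_eq_mul_canonicalProduct (hf : Differentiable ℂ f) (hmono : StrictMono lam)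
    (htop : Tendsto lam atTop atTop) (hz : ∀ z, f z = 0 ↔ ∃ n, z = (lam n : ℂ))
    (hd : ∀ n, deriv f (lam n : ℂ) ≠ 0)
    {C c : ℝ} (hg : ∀ s : ℂ, ‖f (s ^ 2)‖ ≤ C * Real.exp (c * ‖s‖)) :
    (∀ z, Multipliable (canonicalFactor lam z)) ∧
      ∃ κ : ℂ, κ ≠ 0 ∧ ∀ z, f z = κ * canonicalProduct lam z := by
  obtain ⟨κ, hκ, hlim⟩ := tendsto_prod_canonicalFactor hf hmono htop hz hd hg
  obtain ⟨N, hN⟩ := (htop.eventually (eventually_gt_atTop 0)).exists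
  have hpos : ∀ n, 0 < lam (n + N) := fun n => hN.trans_le (hmono.monotone (by omega))
  have hsum : Summable fun n => (lam (n + N))⁻¹ := by
    -- The point −t lies to the left of all zeros, so no factor vanishes there, and from N on the
    -- factors are 1 + t/λₙ. Their convergent partial products are bounded, hence so are the sums of
    -- t/λₙ.
    set t : ℝ := |lam 0| + 1 with ht
    have ht0 : 0 < t := by positivity
    have hne : ∀ n, canonicalFactor lam (-(t : ℂ)) n ≠ 0 := fun n => by
      rw [Ne, canonicalFactor_eq_zero_iff]
      intro h
      have h1 : -t = lam n := by exact_mod_cast h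
      have h2 := hmono.monotone (Nat.zero_le n)
      have h3 := neg_abs_le (lam 0)
      rw [ht] at h1
      linarith
    obtain ⟨K, hK⟩ := (hlim (-(t : ℂ))).norm.bddAbove_range
    set p := ‖∏ i ∈ Finset.range N, canonicalFactor lam (-(t : ℂ)) i‖ with hp
    have hp0 : 0 < p := norm_pos_iff.2 (Finset.prod_ne_zero_iff.2 fun i _ => hne i)
    have hsum' : Summable fun n => t * (lam (n + N))⁻¹ := by
      refine summable_of_sum_range_le (c := K / p) (fun n => ?_) fun n => ?_
      · have := hpos n; positivity
      · have h1 := one_add_sum_le_prod_one_add (a := fun n => t * (lam (n + N))⁻¹)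
          (fun n => by have := hpos n; positivity) n
        have h2 : ‖∏ i ∈ Finset.range (N + n), canonicalFactor lam (-(t : ℂ)) i‖ ≤ K :=
          hK ⟨N + n, rfl⟩
        rw [Finset.prod_range_add, norm_mul, ← hp, norm_prod, mul_comm, ← le_div_iff₀ hp0] at h2
        have h3 : ∏ i ∈ Finset.range n, ‖canonicalFactor lam (-(t : ℂ)) (N + i)‖ =
            ∏ i ∈ Finset.range n, (1 + t * (lam (i + N))⁻¹) := by
          refine Finset.prod_congr rfl fun i _ => ?_
          have hi := hpos i
          rw [canonicalFactor, add_comm N i, if_neg hi.ne']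
          have : (1 : ℂ) - -(t : ℂ) / (lam (i + N) : ℂ) = ((1 + t * (lam (i + N))⁻¹ : ℝ) : ℂ) := by
            push_cast; ring
          rw [this, Complex.norm_real, Real.norm_eq_abs, abs_of_pos (by positivity)]
        rw [h3] at h2
        linarith
    have := hsum'.mul_left t⁻¹
    simpa [inv_mul_cancel_left₀ ht0.ne'] using this
  have hmul : ∀ z, Multipliable (canonicalFactor lam z) := by
    intro z
    have h1 : Summable fun n => ‖canonicalFactor lam z n - 1‖ := by
      rw [← summable_nat_add_iff N]
      refine (hsum.mul_left ‖z‖).congr fun n => ?_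
      have hn := hpos n
      rw [canonicalFactor, if_neg hn.ne', sub_sub_cancel_left, norm_neg, norm_div,
        Complex.norm_real, Real.norm_eq_abs, abs_of_pos hn, div_eq_mul_inv]
    have h2 := multipliable_one_add_of_summable h1
    simpa using h2
  refine ⟨hmul, κ, hκ, fun z => ?_⟩
  have h1 := tendsto_nhds_unique (hmul z).hasProd.tendsto_prod_nat (hlim z)
  rw [canonicalProduct, h1, mul_div_cancel₀ _ hκ]

end CanonicalProduct

/-- An infinite set of reals that is finite below every real can be enumerated increasingly. -/
lemma exists_strictMono_enumeration {S : Set ℝ} (hS : S.Infinite)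
    (hf : ∀ r, (S ∩ Set.Iic r).Finite) :
    ∃ e : ℕ ≃ S, StrictMono fun n => (e n : ℝ) := by
  have hIcc : ∀ x y : S, (Set.Icc x y).Finite := fun x y => by
    refine Set.Finite.of_finite_image (f := Subtype.val) ((hf y).subset ?_)
      Subtype.val_injective.injOn
    rintro _ ⟨z, hz, rfl⟩
    exact ⟨z.2, hz.2⟩
  -- A linear order with finite intervals, a least element and no greatest one is order isomorphic
  -- to ℕ.
  let _ : LocallyFiniteOrder S := LocallyFiniteOrder.ofFiniteIcc hIcc
  obtain ⟨x₀, hx₀⟩ := hS.nonempty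
  obtain ⟨m, hm, hmin⟩ := Set.exists_min_image (S ∩ Set.Iic x₀) id (hf x₀) ⟨x₀, hx₀, Set.self_mem_Iic⟩
  let _ : OrderBot S :=
    { bot := ⟨m, hm.1⟩
      bot_le := fun x => by
        rcases le_total (x : ℝ) x₀ with h | h
        · exact hmin x ⟨x.2, h⟩
        · exact (show m ≤ x₀ from hm.2).trans h }
  have : NoMaxOrder S := ⟨fun x => by
    by_contra h
    push Not at h
    exact hS ((hf x).subset fun y hy => ⟨hy, h ⟨y, hy⟩⟩)⟩
  let _ : SuccOrder S := LinearLocallyFiniteOrder.succOrder S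
  let _ : PredOrder S := LinearLocallyFiniteOrder.predOrder S
  let o : ℕ ≃o S := orderIsoNatOfLinearSuccPredArch.symm
  exact ⟨o.toEquiv, fun i j hij => Subtype.coe_lt_coe.2 (o.strictMono hij)⟩

lemma tendsto_atTop_of_enumeration {S : Set ℝ} (hf : ∀ r, (S ∩ Set.Iic r).Finite) {lam : ℕ → ℝ}
    (hmono : StrictMono lam) (hS : ∀ n, lam n ∈ S) : Tendsto lam atTop atTop := by
  refine tendsto_atTop_atTop_of_monotone hmono.monotone fun b => ?_
  by_contra h
  push Not at h
  refine Set.infinite_range_of_injective hmono.injective ((hf b).subset ?_)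
  rintro _ ⟨n, rfl⟩
  exact ⟨hS n, (h n).le⟩

/-! ### Exponential type and growth of solutions -/

lemma exists_sq_growth_bound {f : ℂ → ℂ} (hf : Differentiable ℂ f) {C σ : ℝ}
    (h : ∀ s : ℂ, 1 ≤ ‖s‖ → ‖f (s ^ 2)‖ ≤ C * ‖s‖ ^ 4 * Real.exp (σ * ‖s‖))
    (hσ : 0 ≤ σ) {η : ℝ} (hη : 0 < η) :
    ∃ C' : ℝ, 0 ≤ C' ∧ ∀ s : ℂ, ‖f (s ^ 2)‖ ≤ C' * Real.exp ((σ + η) * ‖s‖) := by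
  obtain ⟨M, hM⟩ := (isCompact_closedBall (0 : ℂ) 1).exists_bound_of_continuousOn
    (f := fun s => f (s ^ 2)) (hf.continuous.comp (continuous_pow 2)).continuousOn
  refine ⟨|C| * (24 / η ^ 4) + |M|, by positivity, fun s => ?_⟩
  rcases le_total 1 ‖s‖ with hs | hs
  · have h1 := Real.pow_div_factorial_le_exp (x := η * ‖s‖) (by positivity) 4
    have h2 : ‖s‖ ^ 4 ≤ 24 / η ^ 4 * Real.exp (η * ‖s‖) := by
      have h3 : ((4 : ℕ).factorial : ℝ) = 24 := by norm_num [Nat.factorial]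
      rw [h3, div_le_iff₀ (by norm_num), mul_pow] at h1
      rw [div_mul_eq_mul_div, le_div_iff₀ (by positivity)]
      linarith
    calc ‖f (s ^ 2)‖ ≤ C * ‖s‖ ^ 4 * Real.exp (σ * ‖s‖) := h s hs
      _ ≤ |C| * ‖s‖ ^ 4 * Real.exp (σ * ‖s‖) := by gcongr; exact le_abs_self C
      _ ≤ |C| * (24 / η ^ 4 * Real.exp (η * ‖s‖)) * Real.exp (σ * ‖s‖) := by gcongr
      _ = |C| * (24 / η ^ 4) * Real.exp ((σ + η) * ‖s‖) := by
        rw [add_mul, Real.exp_add]; ring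
      _ ≤ _ := by gcongr; linarith [abs_nonneg M]
  · have h1 : ‖f (s ^ 2)‖ ≤ |M| :=
      (hM s (by simpa using hs)).trans (le_abs_self M)
    have h2 : 1 ≤ Real.exp ((σ + η) * ‖s‖) := Real.one_le_exp (by positivity)
    have h3 : 0 ≤ |C| * (24 / η ^ 4) := by positivity
    nlinarith [abs_nonneg M]

lemma entireOfExpType_of_sq_growth {f : ℂ → ℂ} (hf : Differentiable ℂ f) {C σ : ℝ} (hσ : 0 ≤ σ)
    (h : ∀ s : ℂ, 1 ≤ ‖s‖ → ‖f (s ^ 2)‖ ≤ C * ‖s‖ ^ 4 * Real.exp (σ * ‖s‖)) :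
    EntireOfExpType σ f ∧ EntireOfExpType σ fun s => f (s ^ 2) := by
  refine ⟨⟨hf, fun η hη => ?_⟩, hf.comp (differentiable_pow 2), fun η hη => ?_⟩
  · obtain ⟨C', h0, hC'⟩ := exists_sq_growth_bound hf h hσ hη
    refine ⟨C' * Real.exp (σ + η), fun z => ?_⟩
    obtain ⟨s, rfl⟩ := IsAlgClosed.exists_pow_nat_eq z (n := 2) (by norm_num)
    refine (hC' s).trans ?_
    rw [mul_assoc, ← Real.exp_add]
    refine mul_le_mul_of_nonneg_left (Real.exp_le_exp.2 ?_) h0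
    rw [norm_pow]
    -- Growth of order 1/2 in z is far below order 1, so the type σ survives in the variable z as
    -- well.
    have : ‖s‖ ≤ 1 + ‖s‖ ^ 2 := by nlinarith [sq_nonneg (‖s‖ - 1), norm_nonneg s]
    nlinarith
  · obtain ⟨C', -, hC'⟩ := exists_sq_growth_bound hf h hσ hη
    exact ⟨C', hC'⟩

namespace Potential

variable {p : Potential}

lemma IsSol.norm_le {s : ℂ} (hs : 1 ≤ ‖s‖) {u u' : ℝ → ℂ} (h : p.IsSol (s ^ 2) u u') {x : ℝ}
    (hx : x ∈ Set.Icc p.a p.b) {N : ℝ} (hN : ‖s‖ * ‖u p.a‖ + ‖u' p.a‖ ≤ N) :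
    ‖u x‖ ≤ N * Real.exp ((‖s‖ + p.bound) * (x - p.a)) ∧
      ‖u' x‖ ≤ N * Real.exp ((‖s‖ + p.bound) * (x - p.a)) := by
  have hs0 : 0 < ‖s‖ := by linarith
  have h1 := h.growth (norm_pos_iff.1 hs0) hx
  have hxa : 0 ≤ x - p.a := sub_nonneg.2 hx.1
  have h2 : p.bound / ‖s‖ ≤ p.bound := div_le_self p.bound_nonneg hs
  have hN0 : 0 ≤ N := le_trans (by positivity) hN
  have h3 : ‖s‖ * ‖u x‖ + ‖u' x‖ ≤ N * Real.exp ((‖s‖ + p.bound) * (x - p.a)) :=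
    h1.trans (by gcongr)
  have h4 : ‖u x‖ ≤ ‖s‖ * ‖u x‖ := le_mul_of_one_le_left (norm_nonneg _) hs
  constructor <;> linarith [norm_nonneg (u' x), norm_nonneg (u x)]

end Potential

namespace RegularSL

variable {R : RegularSL}

lemma norm_psi_le {s : ℂ} (hs : 1 ≤ ‖s‖) {x : ℝ} (hx : x ∈ Set.Icc R.a R.b) :
    ‖R.psi (s ^ 2) x‖ ≤
      (|R.β₁| + |R.β₂|) * ‖s‖ * Real.exp ((‖s‖ + R.bound) * (x - R.a)) ∧
    ‖R.psi' (s ^ 2) x‖ ≤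
      (|R.β₁| + |R.β₂|) * ‖s‖ * Real.exp ((‖s‖ + R.bound) * (x - R.a)) := by
  refine (isSol_psi (s ^ 2)).norm_le hs hx ?_
  rw [psi_left, psi'_left, norm_neg, Complex.norm_real, Complex.norm_real, Real.norm_eq_abs,
    Real.norm_eq_abs]
  nlinarith [abs_nonneg R.β₁]

/-- The data of χ at b are O(|s|²), and the growth estimate weights the value by another |s|; this
gives the third power. -/
lemma norm_chi_le {s : ℂ} (hs : 1 ≤ ‖s‖) {x : ℝ} (hx : x ∈ Set.Icc R.a R.b) :
    ‖R.chi (s ^ 2) x‖ ≤ (|R.α₁| + |R.α₂| + |R.α₁'| + |R.α₂'|) * ‖s‖ ^ 3 *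
      Real.exp ((‖s‖ + R.bound) * (R.b - x)) ∧
    ‖R.chi' (s ^ 2) x‖ ≤ (|R.α₁| + |R.α₂| + |R.α₁'| + |R.α₂'|) * ‖s‖ ^ 3 *
      Real.exp ((‖s‖ + R.bound) * (R.b - x)) := by
  have hx' : R.a + R.b - x ∈ Set.Icc R.a R.b := ⟨by linarith [hx.2], by linarith [hx.1]⟩
  have hlin : ∀ c d : ℝ, ‖s ^ 2 * (c : ℂ) + d‖ ≤ ‖s‖ ^ 2 * (|c| + |d|) := fun c d => by
    refine (norm_add_le _ _).trans ?_
    rw [norm_mul, norm_pow, Complex.norm_real, Complex.norm_real, Real.norm_eq_abs,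
      Real.norm_eq_abs]
    have : 1 ≤ ‖s‖ ^ 2 := one_le_pow₀ hs
    nlinarith [abs_nonneg d]
  have h := (R.toPotential.reflect.isSol_sol (s ^ 2)
    (s ^ 2 * R.α₂' + R.α₂, -(s ^ 2 * R.α₁' + R.α₁))).norm_le hs hx'
    (N := (|R.α₁| + |R.α₂| + |R.α₁'| + |R.α₂'|) * ‖s‖ ^ 3) (by
      rw [Potential.sol_left]
      simp only [norm_neg]
      have h1 := hlin R.α₂' R.α₂
      have h2 := hlin R.α₁' R.α₁
      have h3 : ‖s‖ * ‖s ^ 2 * (R.α₂' : ℂ) + R.α₂‖ ≤ ‖s‖ * (‖s‖ ^ 2 * (|R.α₂'| + |R.α₂|)) := by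
        gcongr
      have h4 : ‖s‖ ^ 2 ≤ ‖s‖ ^ 3 := pow_le_pow_right₀ hs (by norm_num)
      nlinarith [mul_le_mul_of_nonneg_right h4 (by positivity : 0 ≤ |R.α₁'| + |R.α₁|)])
  have e : R.a + R.b - x - R.a = R.b - x := by ring
  change ‖R.chi (s ^ 2) x‖ ≤ _ * Real.exp ((‖s‖ + R.bound) * (R.a + R.b - x - R.a)) ∧
    ‖(R.reflect.sol (s ^ 2) _ (R.a + R.b - x)).2‖ ≤
      _ * Real.exp ((‖s‖ + R.bound) * (R.a + R.b - x - R.a)) at h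
  rw [e] at h
  exact ⟨h.1, by rw [chi', norm_neg]; exact h.2⟩

variable (R) in
/-- A constant in the growth bounds. -/
def growthConst : ℝ := (|R.β₁| + |R.β₂|) * (|R.α₁| + |R.α₂| + |R.α₁'| + |R.α₂'|) *
  Real.exp (R.bound * (R.b - R.a))

/-- For x ≤ y the distances x − a and b − y add up to at most b − a, so the product of a left and a
right solution has only the type b − a. -/
lemma mul_le_growth {s : ℂ} {x y u v : ℝ} (hxy : x ≤ y) (hu0 : 0 ≤ u)
    (hu : u ≤ (|R.β₁| + |R.β₂|) * ‖s‖ * Real.exp ((‖s‖ + R.bound) * (x - R.a)))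
    (hv : v ≤ (|R.α₁| + |R.α₂| + |R.α₁'| + |R.α₂'|) * ‖s‖ ^ 3 *
      Real.exp ((‖s‖ + R.bound) * (R.b - y))) :
    u * v ≤ R.growthConst * ‖s‖ ^ 4 * Real.exp ((R.b - R.a) * ‖s‖) := by
  have hb := R.bound_nonneg
  calc u * v ≤ u * ((|R.α₁| + |R.α₂| + |R.α₁'| + |R.α₂'|) * ‖s‖ ^ 3 *
          Real.exp ((‖s‖ + R.bound) * (R.b - y))) := by gcongr
    _ ≤ ((|R.β₁| + |R.β₂|) * ‖s‖ * Real.exp ((‖s‖ + R.bound) * (x - R.a))) *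
        ((|R.α₁| + |R.α₂| + |R.α₁'| + |R.α₂'|) * ‖s‖ ^ 3 *
          Real.exp ((‖s‖ + R.bound) * (R.b - y))) := by gcongr
    _ = (|R.β₁| + |R.β₂|) * (|R.α₁| + |R.α₂| + |R.α₁'| + |R.α₂'|) * ‖s‖ ^ 4 *
        Real.exp ((‖s‖ + R.bound) * (R.b - R.a - (y - x))) := by
      have : (‖s‖ + R.bound) * (R.b - R.a - (y - x)) =
        (‖s‖ + R.bound) * (x - R.a) + (‖s‖ + R.bound) * (R.b - y) := by ring
      rw [this, Real.exp_add]; ring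
    _ ≤ (|R.β₁| + |R.β₂|) * (|R.α₁| + |R.α₂| + |R.α₁'| + |R.α₂'|) * ‖s‖ ^ 4 *
        Real.exp ((‖s‖ + R.bound) * (R.b - R.a)) := by
      have : (‖s‖ + R.bound) * (R.b - R.a - (y - x)) ≤ (‖s‖ + R.bound) * (R.b - R.a) :=
        mul_le_mul_of_nonneg_left (by linarith) (by positivity)
      exact mul_le_mul_of_nonneg_left (Real.exp_le_exp.2 this) (by positivity)
    _ = _ := by
      have : (‖s‖ + R.bound) * (R.b - R.a) = R.bound * (R.b - R.a) + (R.b - R.a) * ‖s‖ := by ring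
      rw [this, Real.exp_add, growthConst]; ring

lemma norm_kernel_le {s : ℂ} (hs : 1 ≤ ‖s‖) {x y : ℝ} (hx : x ∈ Set.Icc R.a R.b)
    (hy : y ∈ Set.Icc R.a R.b) :
    ‖R.glue (s ^ 2) y (R.chi (s ^ 2) y) (R.psi (s ^ 2) y) x‖ ≤
      R.growthConst * ‖s‖ ^ 4 * Real.exp ((R.b - R.a) * ‖s‖) := by
  rw [glue]
  split_ifs with h
  · rw [norm_mul, mul_comm]
    exact mul_le_growth h (norm_nonneg _) (norm_psi_le hs hx).1 (norm_chi_le hs hy).1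
  · rw [norm_mul]
    exact mul_le_growth (not_le.1 h).le (norm_nonneg _) (norm_psi_le hs hy).1 (norm_chi_le hs hx).1

lemma norm_trans_le {s : ℂ} (hs : 1 ≤ ‖s‖) {y : ℝ} (hy : y ∈ Set.Icc R.a R.b) {h : ℝ → ℂ}
    (hh : IntervalIntegrable h volume R.a R.b) :
    ‖R.trans y h (s ^ 2)‖ ≤ ((∫ x in R.a..R.b, ‖h x‖) * R.growthConst) * ‖s‖ ^ 4 *
      Real.exp ((R.b - R.a) * ‖s‖) := by
  have h1 : ‖R.trans y h (s ^ 2)‖ ≤ ∫ x in R.a..R.b,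
      (R.growthConst * ‖s‖ ^ 4 * Real.exp ((R.b - R.a) * ‖s‖)) * ‖h x‖ := by
    refine intervalIntegral.norm_integral_le_of_norm_le R.a_le_b
      (Eventually.of_forall fun x hx => ?_) (hh.norm.const_mul _)
    rw [norm_mul]
    gcongr
    exact norm_kernel_le hs ⟨hx.1.le, hx.2⟩ hy
  rw [intervalIntegral.integral_const_mul] at h1
  linarith

lemma norm_wr_le {s : ℂ} (hs : 1 ≤ ‖s‖) :
    ‖R.wr (s ^ 2)‖ ≤ (2 * R.growthConst) * ‖s‖ ^ 4 * Real.exp ((R.b - R.a) * ‖s‖) := by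
  rw [wr]
  refine (norm_sub_le _ _).trans ?_
  rw [norm_mul, norm_mul]
  have h1 := mul_le_growth le_rfl (norm_nonneg _) (norm_psi_le hs (left_mem (R := R))).1
    (norm_chi_le hs left_mem).2
  have h2 := mul_le_growth le_rfl (norm_nonneg _) (norm_psi_le hs (left_mem (R := R))).2
    (norm_chi_le hs left_mem).1
  linarith

lemma entireOfExpType_trans {y : ℝ} (hy : y ∈ Set.Icc R.a R.b) {h : ℝ → ℂ}
    (hh : IntervalIntegrable h volume R.a R.b) :
    EntireOfExpType (R.b - R.a) (R.trans y h) ∧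
      EntireOfExpType (R.b - R.a) fun s => R.trans y h (s ^ 2) :=
  entireOfExpType_of_sq_growth (differentiable_trans hy hh) (sub_nonneg.2 R.a_le_b)
    fun _ hs => norm_trans_le hs hy hh

/-- The zeros are bounded below, so infinitely many below r would accumulate, and the identity
theorem would make `wr` vanish at i. -/
lemma finite_zeros_inter_Iic (r : ℝ) : ({l : ℝ | R.wr l = 0} ∩ Set.Iic r).Finite := by
  obtain ⟨C, hC⟩ := exists_le_re_of_wr (R := R)
  by_contra hinf
  have hsub : {l : ℝ | R.wr l = 0} ∩ Set.Iic r ⊆ Set.Icc (-C) r := fun l hl =>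
    ⟨by simpa using hC l hl.1, hl.2⟩
  obtain ⟨x, -, hx⟩ := Set.Infinite.exists_accPt_of_subset_isCompact hinf isCompact_Icc hsub
  have hfr : ∃ᶠ z in 𝓝[≠] (x : ℂ), R.wr z = 0 := by
    rw [accPt_iff_frequently_nhdsNE] at hx
    have ht : Tendsto (fun l : ℝ => (l : ℂ)) (𝓝[≠] x) (𝓝[≠] (x : ℂ)) :=
      tendsto_nhdsWithin_of_tendsto_nhds_of_eventually_within _
        (Complex.continuous_ofReal.continuousAt.tendsto.mono_left nhdsWithin_le_nhds)
        (eventually_nhdsWithin_of_forall fun l hl => by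
          simpa using hl)
    exact ht.frequently (hx.mono fun l hl => hl.1)
  have h0 := (differentiable_wr (R := R)).differentiableOn.analyticOnNhd isOpen_univ
    |>.eqOn_zero_of_preconnected_of_frequently_eq_zero isPreconnected_univ (Set.mem_univ _) hfr
  exact wr_ne_zero_of_im (R := R) (z := Complex.I) (by simp) (h0 (Set.mem_univ _))

lemma exists_wr_growth : ∃ C c : ℝ, ∀ s : ℂ, ‖R.wr (s ^ 2)‖ ≤ C * Real.exp (c * ‖s‖) := by
  obtain ⟨C, -, hC⟩ := exists_sq_growth_bound (differentiable_wr (R := R))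
    (fun s hs => norm_wr_le hs) (sub_nonneg.2 R.a_le_b) one_pos
  exact ⟨C, _, hC⟩

end RegularSL

namespace Potential

variable {p : Potential}

lemma reflect_reflect : p.reflect.reflect = p := by
  cases p
  simp [reflect, Set.preimage]

/-- A solution is determined by its values at the right end point. -/
lemma IsSol.eqOn_right {z : ℂ} {u u' v v' : ℝ → ℂ} (hu : p.IsSol z u u') (hv : p.IsSol z v v')
    (h : u p.b = v p.b) (h' : u' p.b = v' p.b) {x : ℝ} (hx : x ∈ Set.Icc p.a p.b) :
    u x = v x ∧ u' x = v' x := by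
  have e : p.a + p.b - p.a = p.b := by ring
  have ex : p.a + p.b - (p.a + p.b - x) = x := by ring
  have hmem : p.a + p.b - x ∈ Set.Icc p.a p.b := ⟨by linarith [hx.2], by linarith [hx.1]⟩
  have key := IsSol.eqOn (p := p.reflect) (x := p.a + p.b - x)
    (IsSol.reflect (p := p.reflect) (by rwa [reflect_reflect]))
    (IsSol.reflect (p := p.reflect) (by rwa [reflect_reflect]))
    (show u (p.a + p.b - p.a) = v (p.a + p.b - p.a) by rw [e, h])
    (show -u' (p.a + p.b - p.a) = -v' (p.a + p.b - p.a) by rw [e, h']) hmem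
  change u (p.a + p.b - (p.a + p.b - x)) = v (p.a + p.b - (p.a + p.b - x)) ∧
    -u' (p.a + p.b - (p.a + p.b - x)) = -v' (p.a + p.b - (p.a + p.b - x)) at key
  rw [ex] at key
  exact ⟨key.1, neg_injective key.2⟩

end Potential

lemma exists_abs_le_of_continuousOn_Ioo {f : ℝ → ℝ} {c d : ℝ} (hf : ContinuousOn f (Set.Ioo c d))
    {l r : ℝ} (hl : Tendsto f (𝓝[>] c) (𝓝 l)) (hr : Tendsto f (𝓝[<] d) (𝓝 r)) :
    ∃ M, ∀ x ∈ Set.Ioo c d, |f x| ≤ M := by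
  obtain ⟨M, hM⟩ := isCompact_Icc.exists_bound_of_continuousOn
    (continuousOn_Icc_extendFrom_Ioo hf hl hr)
  refine ⟨M, fun x hx => ?_⟩
  rw [← extendFrom_extends hf x hx]
  exact hM x (Set.Ioo_subset_Icc_self hx)

/-! ### Removing the transmission conditions -/

namespace SLProblem

variable (P : SLProblem)

lemma a_lt_θm : P.a < P.θm := by
  have := P.ε_lt
  rw [θm]; linarith

lemma θm_lt_θp : P.θm < P.θp := by
  have := P.ε_pos
  rw [θm, θp]; linarith

lemma θp_lt_b : P.θp < P.b := by
  have := P.ε_lt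
  rw [θp]; linarith

lemma a_lt_b : P.a < P.b := P.a_lt_θm.trans (P.θm_lt_θp.trans P.θp_lt_b)

lemma I_eq : P.I = Set.Icc P.a P.b \ {P.θm, P.θp} := by
  have h1 := P.a_lt_θm
  have h2 := P.θm_lt_θp
  have h3 := P.θp_lt_b
  ext x
  simp only [I, Set.mem_union, Set.mem_Ico, Set.mem_Ioo, Set.mem_Ioc, Set.mem_sdiff, Set.mem_Icc,
    Set.mem_insert_iff, Set.mem_singleton_iff, not_or]
  constructor
  · rintro ((h | h) | h)
    · exact ⟨⟨h.1, by linarith⟩, h.2.ne, by linarith⟩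
    · exact ⟨⟨by linarith, by linarith⟩, h.1.ne', h.2.ne⟩
    · exact ⟨⟨by linarith, h.2⟩, by linarith, h.1.ne'⟩
  · rintro ⟨⟨ha, hb⟩, hm, hp⟩
    rcases lt_or_gt_of_ne hm with h | h
    · exact Or.inl (Or.inl ⟨ha, h⟩)
    rcases lt_or_gt_of_ne hp with h' | h'
    · exact Or.inl (Or.inr ⟨h, h'⟩)
    · exact Or.inr ⟨h', hb⟩

variable {P}

lemma I_subset_Icc : P.I ⊆ Set.Icc P.a P.b := by
  rw [I_eq]; exact Set.sdiff_subset

lemma I_mem_nhdsWithin {x : ℝ} (hx : x ∈ P.I) : P.I ∈ 𝓝[Set.Icc P.a P.b] x := by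
  have hx' := hx
  rw [I_eq] at hx' ⊢
  exact inter_mem self_mem_nhdsWithin (mem_nhdsWithin_of_mem_nhds
    ((Set.toFinite {P.θm, P.θp}).isClosed.isOpen_compl.mem_nhds hx'.2))

lemma left_mem_I : P.a ∈ P.I := Or.inl (Or.inl ⟨le_rfl, P.a_lt_θm⟩)

lemma right_mem_I : P.b ∈ P.I := Or.inr ⟨P.θp_lt_b, le_rfl⟩

variable (P) in
lemma measurableSet_I : MeasurableSet P.I :=
  (measurableSet_Ico.union measurableSet_Ioo).union measurableSet_Ioc

variable (P) in
lemma continuousOn_q : ContinuousOn P.q P.I := by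
  have h2 := P.θm_lt_θp
  rintro x ((hx | hx) | hx)
  · refine (P.q_cont_left x hx).mono_of_mem_nhdsWithin ?_
    filter_upwards [self_mem_nhdsWithin, mem_nhdsWithin_of_mem_nhds (Iio_mem_nhds hx.2)] with y hy h
    exact ⟨(I_subset_Icc hy).1, h⟩
  · refine (P.q_cont_mid x hx).mono_of_mem_nhdsWithin ?_
    exact mem_nhdsWithin_of_mem_nhds (Ioo_mem_nhds hx.1 hx.2)
  · refine (P.q_cont_right x hx).mono_of_mem_nhdsWithin ?_
    filter_upwards [self_mem_nhdsWithin, mem_nhdsWithin_of_mem_nhds (Ioi_mem_nhds hx.1)] with y hy h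
    exact ⟨h, (I_subset_Icc hy).2⟩

variable (P) in
lemma exists_abs_q_le : ∃ M, ∀ x ∈ P.I, |P.q x| ≤ M := by
  obtain ⟨l₁, h₁⟩ := P.q_lim₁
  obtain ⟨l₂, h₂⟩ := P.q_lim₂
  obtain ⟨l₃, h₃⟩ := P.q_lim₃
  obtain ⟨l₄, h₄⟩ := P.q_lim₄
  have ha : Tendsto P.q (𝓝[>] P.a) (𝓝 (P.q P.a)) :=
    (P.q_cont_left P.a ⟨le_rfl, P.a_lt_θm⟩).mono_left
      (nhdsWithin_le_of_mem (mem_of_superset (Ioo_mem_nhdsGT P.a_lt_θm) Set.Ioo_subset_Ico_self))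
  have hb : Tendsto P.q (𝓝[<] P.b) (𝓝 (P.q P.b)) :=
    (P.q_cont_right P.b ⟨P.θp_lt_b, le_rfl⟩).mono_left
      (nhdsWithin_le_of_mem (mem_of_superset (Ioo_mem_nhdsLT P.θp_lt_b) Set.Ioo_subset_Ioc_self))
  obtain ⟨M₁, hM₁⟩ := exists_abs_le_of_continuousOn_Ioo
    (P.q_cont_left.mono Set.Ioo_subset_Ico_self) ha h₁
  obtain ⟨M₂, hM₂⟩ := exists_abs_le_of_continuousOn_Ioo P.q_cont_mid h₂ h₃
  obtain ⟨M₃, hM₃⟩ := exists_abs_le_of_continuousOn_Ioo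
    (P.q_cont_right.mono Set.Ioo_subset_Ioc_self) h₄ hb
  refine ⟨|M₁| + |M₂| + |M₃| + |P.q P.a| + |P.q P.b|, ?_⟩
  have p₁ := abs_nonneg M₁
  have p₂ := abs_nonneg M₂
  have p₃ := abs_nonneg M₃
  have p₄ := abs_nonneg (P.q P.a)
  have p₅ := abs_nonneg (P.q P.b)
  rintro x ((hx | hx) | hx)
  · rcases hx.1.eq_or_lt with rfl | h
    · linarith
    · linarith [hM₁ x ⟨h, hx.2⟩, le_abs_self M₁]
  · linarith [hM₂ x hx, le_abs_self M₂]
  · rcases hx.2.eq_or_lt with rfl | h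
    · linarith
    · linarith [hM₃ x ⟨hx.1, h⟩, le_abs_self M₃]

variable (P) in
/-- The problem without transmission conditions satisfied by the solutions of `P` multiplied by
`P.weight`. -/
def regular : RegularSL where
  a := P.a
  b := P.b
  bound := |P.exists_abs_q_le.choose|
  Q := P.I.indicator P.q
  S := {P.θm, P.θp}
  a_lt_b := P.a_lt_b
  measurable := by
    classical
    rw [← Set.piecewise_eq_indicator]
    exact P.continuousOn_q.measurable_piecewise continuousOn_const P.measurableSet_I
  abs_le x := by
    by_cases hx : x ∈ P.I
    · rw [Set.indicator_of_mem hx]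
      exact (P.exists_abs_q_le.choose_spec x hx).trans (le_abs_self _)
    · rw [Set.indicator_of_notMem hx, abs_zero]
      exact abs_nonneg _
  countable := (Set.toFinite _).countable
  continuousWithinAt x hx := by
    rw [← I_eq] at hx
    refine ContinuousWithinAt.mono_of_mem_nhdsWithin ?_ (I_mem_nhdsWithin hx)
    exact (P.continuousOn_q x hx).congr (fun y hy => Set.indicator_of_mem hy _)
      (Set.indicator_of_mem hx _)
  β₁ := P.β₁
  β₂ := P.β₂
  α₁ := P.α₁
  α₂ := P.α₂
  α₁' := P.α₁'
  α₂' := P.α₂'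
  β_ne h := P.β_ne (by simp [h.1, h.2])
  ρ_pos := P.ρ_pos

lemma regular_Q {x : ℝ} (hx : x ∈ P.I) : P.regular.Q x = P.q x := Set.indicator_of_mem hx _

lemma mem_regular_iff {x : ℝ} :
    x ∈ Set.Icc P.regular.a P.regular.b \ P.regular.S ↔ x ∈ P.I := by
  rw [I_eq]; rfl

variable (P) in
/-- The factor that makes solutions satisfying the transmission conditions continuous. -/
def weight (x : ℝ) : ℂ := if x < P.θm then 1 else if x < P.θp then P.δ else P.γ

lemma weight_of_lt {x : ℝ} (hx : x < P.θm) : P.weight x = 1 := if_pos hx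

lemma weight_of_mem {x : ℝ} (hx : x ∈ Set.Ioo P.θm P.θp) : P.weight x = P.δ := by
  rw [weight, if_neg (not_lt.2 hx.1.le), if_pos hx.2]

lemma weight_of_gt {x : ℝ} (hx : P.θp < x) : P.weight x = P.γ := by
  rw [weight, if_neg (not_lt.2 (P.θm_lt_θp.trans hx).le), if_neg (not_lt.2 hx.le)]

lemma δ_ne' : (P.δ : ℂ) ≠ 0 := Complex.ofReal_ne_zero.2 P.δ_ne

lemma γ_ne' : (P.γ : ℂ) ≠ 0 := Complex.ofReal_ne_zero.2 P.γ_ne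

variable (P) in
lemma weight_ne (x : ℝ) : P.weight x ≠ 0 := by
  rw [weight]
  split_ifs
  exacts [one_ne_zero, δ_ne', γ_ne']

lemma weight_left : P.weight P.a = 1 := weight_of_lt P.a_lt_θm

lemma weight_right : P.weight P.b = P.γ := weight_of_gt P.θp_lt_b

lemma weight_eventually_eq {x : ℝ} (hx : x ∈ P.I) : ∀ᶠ y in 𝓝 x, P.weight y = P.weight x := by
  rcases hx with (hx | hx) | hx
  · filter_upwards [Iio_mem_nhds hx.2] with y hy
    rw [weight_of_lt hx.2, weight_of_lt hy]
  · filter_upwards [Ioo_mem_nhds hx.1 hx.2] with y hy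
    rw [weight_of_mem hx, weight_of_mem hy]
  · filter_upwards [Ioi_mem_nhds hx.1] with y hy
    rw [weight_of_gt hx.1, weight_of_gt hy]

lemma weight_left_θm : ∀ᶠ y in 𝓝[<] P.θm, P.weight y = 1 :=
  eventually_nhdsWithin_of_forall fun _ hy => weight_of_lt hy

lemma weight_right_θm : ∀ᶠ y in 𝓝[>] P.θm, P.weight y = P.δ := by
  filter_upwards [Ioo_mem_nhdsGT P.θm_lt_θp] with y hy using weight_of_mem hy

lemma weight_left_θp : ∀ᶠ y in 𝓝[<] P.θp, P.weight y = P.δ := by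
  filter_upwards [Ioo_mem_nhdsLT P.θm_lt_θp] with y hy using weight_of_mem hy

lemma weight_right_θp : ∀ᶠ y in 𝓝[>] P.θp, P.weight y = P.γ :=
  eventually_nhdsWithin_of_forall fun _ hy => weight_of_gt hy

lemma θm_Icc_mem_nhds : Set.Icc P.a P.b ∈ 𝓝 P.θm :=
  Icc_mem_nhds P.a_lt_θm (P.θm_lt_θp.trans P.θp_lt_b)

lemma θp_Icc_mem_nhds : Set.Icc P.a P.b ∈ 𝓝 P.θp :=
  Icc_mem_nhds (P.a_lt_θm.trans P.θm_lt_θp) P.θp_lt_b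

lemma measurable_weight : Measurable P.weight :=
  Measurable.ite measurableSet_Iio measurable_const
    (Measurable.ite measurableSet_Iio measurable_const measurable_const)

/-- The weights 1, δ, γ are chosen for this: 1 · (v/1) = δ · (v/δ) at the first point and δ · (v/δ)
= γ · (v/γ) at the second. -/
lemma jumpCondition_div_weight {v : ℝ → ℂ} (hv : ContinuousOn v (Set.Icc P.a P.b)) (k : ℂ) :
    JumpCondition P.θm 1 P.δ (fun x => k * v x / P.weight x) ∧
      JumpCondition P.θp P.δ P.γ (fun x => k * v x / P.weight x) := by
  have hm : ContinuousAt v P.θm := hv.continuousAt θm_Icc_mem_nhds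
  have hp : ContinuousAt v P.θp := hv.continuousAt θp_Icc_mem_nhds
  have key : ∀ {x : ℝ} {s : Set ℝ} {w : ℂ}, ContinuousAt v x → (∀ᶠ y in 𝓝[s] x, P.weight y = w) →
      Tendsto (fun x => k * v x / P.weight x) (𝓝[s] x) (𝓝 (k * v x / w)) := by
    intro x s w hx hw
    refine Tendsto.congr' ?_ ((hx.continuousWithinAt.tendsto.const_mul k).div_const w)
    filter_upwards [hw] with y hy
    rw [hy]
  have h1 := δ_ne' (P := P)
  have h2 := γ_ne' (P := P)
  exact ⟨⟨_, _, key hm weight_left_θm, key hm weight_right_θm, by field_simp⟩,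
    ⟨_, _, key hp weight_left_θp, key hp weight_right_θp, by field_simp⟩⟩

lemma transmission_of_isSol {z : ℂ} {v v' : ℝ → ℂ} (h : P.regular.IsSol z v v') (k : ℂ) :
    P.Transmission (fun x => k * v x / P.weight x) (fun x => k * v' x / P.weight x) :=
  ⟨(jumpCondition_div_weight h.cont k).1, (jumpCondition_div_weight h.cont' k).1,
    (jumpCondition_div_weight h.cont k).2, (jumpCondition_div_weight h.cont' k).2⟩

lemma isSolution_of_isSol {z : ℂ} {v v' : ℝ → ℂ} (h : P.regular.IsSol z v v') (k : ℂ) :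
    P.IsSolution z (fun x => k * v x / P.weight x) (fun x => k * v' x / P.weight x) := by
  intro x hx
  have key : ∀ {w : ℝ → ℂ} {d : ℂ}, HasDerivWithinAt w d (Set.Icc P.a P.b) x →
      HasDerivWithinAt (fun x => k * w x / P.weight x) (k * d / P.weight x) P.I x := by
    intro w d hw
    refine (((hw.mono I_subset_Icc).const_mul k).div_const (P.weight x)).congr_of_eventuallyEq ?_
      rfl
    filter_upwards [mem_nhdsWithin_of_mem_nhds (weight_eventually_eq hx)] with y hy
    rw [hy]
  refine ⟨key (h.deriv x (mem_regular_iff.2 hx)), ?_⟩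
  convert key (h.deriv' x (mem_regular_iff.2 hx)) using 1
  rw [regular_Q hx]
  ring

lemma exists_continuousOn_eq_weight_mul {u : ℝ → ℂ} (hu : ContinuousOn u P.I)
    (hm : JumpCondition P.θm 1 P.δ u) (hp : JumpCondition P.θp P.δ P.γ u) :
    ∃ v : ℝ → ℂ, ContinuousOn v (Set.Icc P.a P.b) ∧ ∀ x ∈ P.I, v x = P.weight x * u x := by
  obtain ⟨l, r, hl, hr, hlr⟩ := hm
  obtain ⟨l', r', hl', hr', hlr'⟩ := hp
  have hne := P.θm_lt_θp.ne'
  -- The weighted function has equal one-sided limits, l = δr at the first point and δl' = γr' at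
  -- the second; these values fill the gaps.
  set v : ℝ → ℂ := fun x => if x = P.θm then l else if x = P.θp then P.δ * l' else
    P.weight x * u x with hv
  have hvm : v P.θm = l := if_pos rfl
  have hvp : v P.θp = P.δ * l' := by simp only [hv, if_neg hne, if_true]
  have hvo : ∀ x, x ≠ P.θm → x ≠ P.θp → v x = P.weight x * u x := fun x h1 h2 => by
    simp only [hv, if_neg h1, if_neg h2]
  have hvI : ∀ x ∈ P.I, v x = P.weight x * u x := fun x hx => by
    rw [I_eq] at hx
    exact hvo x (fun h => hx.2 (Or.inl h)) (fun h => hx.2 (Or.inr h))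
  refine ⟨v, fun x hx => ?_, hvI⟩
  by_cases hxm : x = P.θm
  · subst hxm
    refine ContinuousAt.continuousWithinAt (continuousAt_iff_continuous_left'_right'.2 ⟨?_, ?_⟩)
    · rw [ContinuousWithinAt, hvm, ← one_mul l]
      refine (hl.const_mul 1).congr' ?_
      filter_upwards [weight_left_θm, self_mem_nhdsWithin] with y hy hy'
      rw [hvo y (ne_of_lt hy') ((show y < P.θm from hy').trans P.θm_lt_θp).ne, hy]
    · rw [ContinuousWithinAt, hvm, ← one_mul l, hlr]
      refine (hr.const_mul (P.δ : ℂ)).congr' ?_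
      filter_upwards [weight_right_θm, Ioo_mem_nhdsGT P.θm_lt_θp] with y hy hy'
      rw [hvo y hy'.1.ne' hy'.2.ne, hy]
  by_cases hxp : x = P.θp
  · subst hxp
    refine ContinuousAt.continuousWithinAt (continuousAt_iff_continuous_left'_right'.2 ⟨?_, ?_⟩)
    · rw [ContinuousWithinAt, hvp]
      refine (hl'.const_mul (P.δ : ℂ)).congr' ?_
      filter_upwards [weight_left_θp, Ioo_mem_nhdsLT P.θm_lt_θp] with y hy hy'
      rw [hvo y hy'.1.ne' hy'.2.ne, hy]
    · rw [ContinuousWithinAt, hvp, hlr']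
      refine (hr'.const_mul (P.γ : ℂ)).congr' ?_
      filter_upwards [weight_right_θp, self_mem_nhdsWithin] with y hy hy'
      rw [hvo y (P.θm_lt_θp.trans hy').ne' (ne_of_gt hy'), hy]
  have hxI : x ∈ P.I := by
    rw [I_eq]; exact ⟨hx, by simp [hxm, hxp]⟩
  refine ContinuousWithinAt.mono_of_mem_nhdsWithin ?_ (I_mem_nhdsWithin hxI)
  refine ((hu x hxI).const_mul (P.weight x)).congr_of_eventuallyEq ?_ (hvI x hxI)
  filter_upwards [mem_nhdsWithin_of_mem_nhds (weight_eventually_eq hxI), self_mem_nhdsWithin]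
    with y hy hyI
  rw [hvI y hyI, hy]

lemma exists_isSol_eq_weight_mul {z : ℂ} {u u' : ℝ → ℂ} (h : P.IsSolution z u u')
    (ht : P.Transmission u u') : ∃ v v' : ℝ → ℂ, P.regular.IsSol z v v' ∧
      ∀ x ∈ P.I, v x = P.weight x * u x ∧ v' x = P.weight x * u' x := by
  obtain ⟨t₁, t₂, t₃, t₄⟩ := ht
  obtain ⟨v, hv, hvu⟩ := exists_continuousOn_eq_weight_mul
    (fun x hx => (h x hx).1.continuousWithinAt) t₁ t₃
  obtain ⟨v', hv', hvu'⟩ := exists_continuousOn_eq_weight_mul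
    (fun x hx => (h x hx).2.continuousWithinAt) t₂ t₄
  have key : ∀ {x : ℝ} {w W : ℝ → ℂ} {d : ℂ}, x ∈ P.I → (∀ x ∈ P.I, W x = P.weight x * w x) →
      HasDerivWithinAt w d P.I x →
      HasDerivWithinAt W (P.weight x * d) (Set.Icc P.a P.b) x := by
    intro x w W d hx hW hw
    refine HasDerivWithinAt.mono_of_mem_nhdsWithin (t := P.I) ?_ (I_mem_nhdsWithin hx)
    refine (hw.const_mul (P.weight x)).congr_of_eventuallyEq ?_ (hW x hx)
    filter_upwards [mem_nhdsWithin_of_mem_nhds (weight_eventually_eq hx), self_mem_nhdsWithin]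
      with y hy hyI
    rw [hW y hyI, hy]
  refine ⟨v, v', ⟨hv, hv', fun x hx => ?_, fun x hx => ?_⟩, fun x hx => ⟨hvu x hx, hvu' x hx⟩⟩
  · rw [mem_regular_iff] at hx
    rw [hvu' x hx]
    exact key hx hvu (h x hx).1
  · rw [mem_regular_iff] at hx
    rw [hvu x hx, regular_Q hx]
    rw [mul_left_comm]
    exact key hx hvu' (h x hx).2

/-- The regular solution divided by the weight is a witness, so the choice defining `phiPair` is not
a default value. -/
lemma isPhi_phiPair (z : ℂ) : P.IsPhi z (P.phiPair z) := by
  refine Classical.epsilon_spec (p := P.IsPhi z)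
    ⟨(fun x => 1 * P.regular.psi z x / P.weight x, fun x => 1 * P.regular.psi' z x / P.weight x),
      isSolution_of_isSol (RegularSL.isSol_psi z) 1, transmission_of_isSol (RegularSL.isSol_psi z) 1,
      ?_, ?_⟩
  · have := RegularSL.psi_left (R := P.regular) z
    change P.regular.psi z P.a = P.β₂ at this
    simp [weight_left, this]
  · have := RegularSL.psi'_left (R := P.regular) z
    change P.regular.psi' z P.a = -P.β₁ at this
    simp [weight_left, this]

/-- The weight at b is γ, so the regular solution is multiplied by γ to keep the data there. -/
lemma isChi_chiPair (z : ℂ) : P.IsChi z (P.chiPair z) := by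
  have hγ := γ_ne' (P := P)
  refine Classical.epsilon_spec (p := P.IsChi z)
    ⟨(fun x => P.γ * P.regular.chi z x / P.weight x,
      fun x => P.γ * P.regular.chi' z x / P.weight x),
      isSolution_of_isSol (RegularSL.isSol_chi z) _, transmission_of_isSol (RegularSL.isSol_chi z) _,
      ?_, ?_⟩
  · have := RegularSL.chi_right (R := P.regular) z
    change P.regular.chi z P.b = z * P.α₂' + P.α₂ at this
    simp only [weight_right, this]
    field_simp
  · have := RegularSL.chi'_right (R := P.regular) z
    change P.regular.chi' z P.b = z * P.α₁' + P.α₁ at this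
    simp only [weight_right, this]
    field_simp

lemma phi_eq (z : ℂ) {x : ℝ} (hx : x ∈ P.I) :
    P.phi z x = P.regular.psi z x / P.weight x ∧
      P.phi' z x = P.regular.psi' z x / P.weight x := by
  obtain ⟨h, ht, ha, ha'⟩ := isPhi_phiPair (P := P) z
  obtain ⟨v, v', hv, hvu⟩ := exists_isSol_eq_weight_mul h ht
  obtain ⟨e1, e2⟩ := hvu P.a left_mem_I
  have key := hv.eqOn (RegularSL.isSol_psi z)
    (by rw [RegularSL.psi_left]
        change v P.a = P.β₂
        rw [e1, ha, weight_left, one_mul])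
    (by rw [RegularSL.psi'_left]
        change v' P.a = -P.β₁
        rw [e2, ha', weight_left, one_mul]) (I_subset_Icc hx)
  rw [(hvu x hx).1, (hvu x hx).2] at key
  rw [← key.1, ← key.2, mul_div_cancel_left₀ _ (P.weight_ne x),
    mul_div_cancel_left₀ _ (P.weight_ne x)]
  exact ⟨rfl, rfl⟩

lemma chi_eq (z : ℂ) {x : ℝ} (hx : x ∈ P.I) :
    P.chi z x = P.γ * P.regular.chi z x / P.weight x ∧
      P.chi' z x = P.γ * P.regular.chi' z x / P.weight x := by
  obtain ⟨h, ht, hb, hb'⟩ := isChi_chiPair (P := P) z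
  obtain ⟨v, v', hv, hvu⟩ := exists_isSol_eq_weight_mul h ht
  obtain ⟨e1, e2⟩ := hvu P.b right_mem_I
  have key := hv.eqOn_right ((RegularSL.isSol_chi z).const_mul (P.γ : ℂ))
    (by rw [RegularSL.chi_right]
        change v P.b = P.γ * (z * P.α₂' + P.α₂)
        rw [e1, hb, weight_right])
    (by rw [RegularSL.chi'_right]
        change v' P.b = P.γ * (z * P.α₁' + P.α₁)
        rw [e2, hb', weight_right]) (I_subset_Icc hx)
  rw [(hvu x hx).1, (hvu x hx).2] at key
  rw [← key.1, ← key.2, mul_div_cancel_left₀ _ (P.weight_ne x),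
    mul_div_cancel_left₀ _ (P.weight_ne x)]
  exact ⟨rfl, rfl⟩

lemma omega_eq (z : ℂ) : P.omega z = P.γ * P.regular.wr z := by
  have hw : P.regular.wr z = P.regular.psi z P.a * P.regular.chi' z P.a -
    P.regular.psi' z P.a * P.regular.chi z P.a := rfl
  rw [omega, (phi_eq z left_mem_I).1, (phi_eq z left_mem_I).2, (chi_eq z left_mem_I).1,
    (chi_eq z left_mem_I).2, weight_left, hw]
  ring

variable (P) in
/-- The product of the Wronskian and Green's function of `P.regular`. -/
def kernel (y x : ℝ) (z : ℂ) : ℂ :=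
  P.regular.glue z y (P.regular.chi z y) (P.regular.psi z y) x

lemma differentiable_kernel (y x : ℝ) : Differentiable ℂ (P.kernel y x) := by
  by_cases h : x ≤ y
  · have : P.kernel y x = fun z => P.regular.chi z y * P.regular.psi z x := funext fun z => if_pos h
    rw [this]
    exact (RegularSL.differentiable_chi y).mul (RegularSL.differentiable_psi x)
  · have : P.kernel y x = fun z => P.regular.psi z y * P.regular.chi z x := funext fun z => if_neg h
    rw [this]
    exact (RegularSL.differentiable_psi y).mul (RegularSL.differentiable_chi x)

lemma continuous_kernel (y : ℝ) (z : ℂ) : Continuous fun x => P.kernel y x z :=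
  Continuous.if_le (continuous_const.mul (RegularSL.continuous_psi z))
    (continuous_const.mul (RegularSL.continuous_chi z)) continuous_id continuous_const
    (fun x hx => by rw [hx]; exact mul_comm _ _)

/-- The γ carried by χ cancels the γ in ω. The two definitions choose different branches on the
diagonal, where the branches agree. -/
lemma green_eq {x y : ℝ} (hx : x ∈ P.I) (hy : y ∈ P.I) (z : ℂ) :
    P.green x y z = P.kernel y x z / (P.regular.wr z * (P.weight x * P.weight y)) := by
  have hγ := γ_ne' (P := P)
  have hk : P.kernel y x z = if y ≤ x then P.regular.psi z y * P.regular.chi z x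
      else P.regular.chi z y * P.regular.psi z x := by
    rw [kernel, RegularSL.glue]
    rcases lt_trichotomy x y with h | rfl | h
    · rw [if_pos h.le, if_neg (not_le.2 h)]
    · rw [if_pos le_rfl, if_pos le_rfl, mul_comm]
    · rw [if_neg (not_le.2 h), if_pos h.le]
  rw [green, hk, omega_eq, (phi_eq z hx).1, (phi_eq z hy).1, (chi_eq z hx).1, (chi_eq z hy).1]
  have h1 := P.weight_ne x
  have h2 := P.weight_ne y
  by_cases hw : P.regular.wr z = 0
  · simp [hw]
  split_ifs <;> field_simp

lemma eventually_wr_ne_zero (z : ℂ) : ∀ᶠ s in 𝓝[≠] z, P.regular.wr s ≠ 0 := by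
  have hd := RegularSL.differentiable_wr (R := P.regular)
  by_contra h
  have hfr : ∃ᶠ s in 𝓝[≠] z, P.regular.wr s = 0 := by
    simpa only [Filter.not_eventually, not_not] using h
  have h0 := hd.differentiableOn.analyticOnNhd isOpen_univ
    |>.eqOn_zero_of_preconnected_of_frequently_eq_zero isPreconnected_univ (Set.mem_univ _) hfr
  exact RegularSL.wr_ne_zero_of_im (R := P.regular) (z := Complex.I) (by simp)
    (h0 (Set.mem_univ _))

/-- The zeros of `wr` are isolated, so near z, except perhaps at z, the factor `wr` cancels. The
kernel is entire, so the limit is its value. -/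
lemma regGreen_eq {Ω : ℂ → ℂ} {κ : ℂ} (hΩ : ∀ z, Ω z = κ * P.regular.wr z) {x y : ℝ}
    (hx : x ∈ P.I) (hy : y ∈ P.I) (z : ℂ) :
    P.regGreen Ω y x z = κ / (P.weight x * P.weight y) * P.kernel y x z := by
  have h1 := P.weight_ne x
  have h2 := P.weight_ne y
  have hc : Tendsto (fun s => κ / (P.weight x * P.weight y) * P.kernel y x s) (𝓝[≠] z)
      (𝓝 (κ / (P.weight x * P.weight y) * P.kernel y x z)) :=
    (((differentiable_kernel y x).continuous.tendsto z).mono_left nhdsWithin_le_nhds).const_mul _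
  refine Tendsto.limUnder_eq (hc.congr' ?_)
  filter_upwards [eventually_wr_ne_zero z] with s hs
  rw [hΩ, green_eq hx hy]
  field_simp

variable (P) in
/-- The function on `[a, b]` whose transform for `P.regular` is, up to a constant, that of `g`. -/
def weighted (g : ℝ → ℂ) (x : ℝ) : ℂ := P.weight x * starRingEnd ℂ (g x)

lemma memLp_weighted {g : ℝ → ℂ} (hg : MemLp g 2 (volume.restrict (Set.Ioo P.a P.b))) :
    MemLp (P.weighted g) 2 P.regular.vol := by
  have hv : P.regular.vol = volume.restrict (Set.Ioo P.a P.b) :=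
    (Measure.restrict_congr_set Ioo_ae_eq_Ioc).symm
  rw [hv]
  have hs : MemLp (fun x => starRingEnd ℂ (g x)) 2 (volume.restrict (Set.Ioo P.a P.b)) := hg.star
  refine hs.of_le_mul (c := 1 + |P.δ| + |P.γ|)
    (measurable_weight.aestronglyMeasurable.mul hs.1) (Eventually.of_forall fun x => ?_)
  have hw : ‖P.weight x‖ ≤ 1 + |P.δ| + |P.γ| := by
    have h1 := abs_nonneg P.δ
    have h2 := abs_nonneg P.γ
    rw [weight]
    split_ifs
    · rw [norm_one]; linarith
    · rw [Complex.norm_real, Real.norm_eq_abs]; linarith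
    · rw [Complex.norm_real, Real.norm_eq_abs]; linarith
  rw [weighted, norm_mul]
  exact mul_le_mul_of_nonneg_right hw (norm_nonneg _)

lemma integrableOn_regGreen_mul {Ω : ℂ → ℂ} {κ : ℂ} (hΩ : ∀ z, Ω z = κ * P.regular.wr z) {y : ℝ}
    (hy : y ∈ P.I) {g : ℝ → ℂ} (hg : MemLp g 2 (volume.restrict (Set.Ioo P.a P.b))) (z : ℂ) :
    IntegrableOn (fun x => P.regGreen Ω y x z * starRingEnd ℂ (g x)) (Set.Ioo P.a P.b) := by
  have hs : MemLp (fun x => starRingEnd ℂ (g x)) 2 (volume.restrict (Set.Ioo P.a P.b)) := hg.star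
  have hi : Integrable (fun x => starRingEnd ℂ (g x)) (volume.restrict (Set.Ioo P.a P.b)) :=
    hs.integrable (by norm_num)
  obtain ⟨C, hC⟩ := isCompact_Icc.exists_bound_of_continuousOn
    (continuous_kernel (P := P) y z).continuousOn (s := Set.Icc P.a P.b)
  have hm : Measurable fun x => κ / (P.weight x * P.weight y) * P.kernel y x z :=
    ((measurable_const.div (measurable_weight.mul_const _))).mul (continuous_kernel y z).measurable
  have hb : ∀ x, ‖(P.weight x)⁻¹‖ ≤ 1 + |P.δ|⁻¹ + |P.γ|⁻¹ := fun x => by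
    have h1 : 0 ≤ |P.δ|⁻¹ := by positivity
    have h2 : 0 ≤ |P.γ|⁻¹ := by positivity
    rw [norm_inv, weight]
    split_ifs
    · rw [norm_one, inv_one]; linarith
    · rw [Complex.norm_real, Real.norm_eq_abs]; linarith
    · rw [Complex.norm_real, Real.norm_eq_abs]; linarith
  have key : Integrable (fun x => κ / (P.weight x * P.weight y) * P.kernel y x z *
      starRingEnd ℂ (g x)) (volume.restrict (Set.Ioo P.a P.b)) := by
    refine hi.bdd_mul (c := ‖κ / P.weight y‖ * (1 + |P.δ|⁻¹ + |P.γ|⁻¹) * C) hm.aestronglyMeasurable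
      ((ae_restrict_iff' measurableSet_Ioo).2 (Eventually.of_forall fun x hx => ?_))
    have e : κ / (P.weight x * P.weight y) * P.kernel y x z =
        κ / P.weight y * (P.weight x)⁻¹ * P.kernel y x z := by
      rw [mul_comm (P.weight x), ← div_div, div_eq_mul_inv (κ / P.weight y)]
    rw [e, norm_mul, norm_mul]
    have := hb x
    have := hC x (Set.Ioo_subset_Icc_self hx)
    gcongr
  refine key.congr ?_
  have hfin : ∀ᵐ x : ℝ, x ∉ ({P.θm, P.θp} : Set ℝ) :=
    (Set.toFinite _).countable.ae_notMem volume
  filter_upwards [ae_restrict_of_ae hfin, ae_restrict_mem measurableSet_Ioo] with x hx hxI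
  rw [regGreen_eq hΩ (by rw [I_eq]; exact ⟨Set.Ioo_subset_Icc_self hxI, hx⟩) hy]

/-- The factors 1, δ², γ² are the squares of the weight; Green's function carries one inverse weight
in x, which leaves the single weight in `weighted`. -/
lemma transform_eq {Ω : ℂ → ℂ} {κ : ℂ} (hΩ : ∀ z, Ω z = κ * P.regular.wr z) {y : ℝ}
    (hy : y ∈ P.I) {g : ℝ → ℂ} (hg : MemLp g 2 (volume.restrict (Set.Ioo P.a P.b))) (z : ℂ) :
    P.transform Ω y g z = κ / P.weight y * P.regular.trans y (P.weighted g) z := by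
  have h1 := P.a_lt_θm
  have h2 := P.θm_lt_θp
  have h3 := P.θp_lt_b
  have hwy := P.weight_ne y
  have hδ := δ_ne' (P := P)
  have hγ := γ_ne' (P := P)
  set f : ℝ → ℂ := fun x => P.kernel y x z * P.weighted g x with hf
  have hint : IntervalIntegrable f volume P.a P.b :=
    (RegularSL.intervalIntegrable_of_memLp (memLp_weighted hg)).continuousOn_mul
      (continuous_kernel y z).continuousOn
  have hsub : ∀ {c d : ℝ}, P.a ≤ c → c ≤ d → d ≤ P.b → IntervalIntegrable f volume c d :=
    fun hc hcd hd => hint.mono_set (by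
      rw [Set.uIcc_of_le hcd, Set.uIcc_of_le (hc.trans (hcd.trans hd))]
      exact Set.Icc_subset_Icc hc hd)
  have key : ∀ {c d : ℝ} {w : ℂ}, c ≤ d → w ≠ 0 → (∀ x ∈ Set.Ioo c d, x ∈ P.I ∧ P.weight x = w) →
      w ^ 2 * (∫ x in c..d, P.regGreen Ω y x z * starRingEnd ℂ (g x)) =
        κ / P.weight y * ∫ x in c..d, f x := by
    intro c d w hcd hw hx
    rw [← intervalIntegral.integral_const_mul, ← intervalIntegral.integral_const_mul]
    refine intervalIntegral.integral_congr_Ioo_of_le hcd fun x hxm => ?_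
    obtain ⟨hxI, hxw⟩ := hx x hxm
    simp only [hf, regGreen_eq hΩ hxI hy, weighted, hxw]
    field_simp
  have k1 := key h1.le one_ne_zero fun x hx =>
    ⟨Or.inl (Or.inl ⟨hx.1.le, hx.2⟩), weight_of_lt hx.2⟩
  have k2 := key h2.le hδ fun x hx => ⟨Or.inl (Or.inr hx), weight_of_mem hx⟩
  have k3 := key h3.le hγ fun x hx => ⟨Or.inr ⟨hx.1, hx.2.le⟩, weight_of_gt hx.1⟩
  rw [one_pow, one_mul] at k1
  have htr : P.regular.trans y (P.weighted g) z = ∫ x in P.a..P.b, f x := rfl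
  rw [transform, k1, k2, k3, htr, ← mul_add, ← mul_add,
    intervalIntegral.integral_add_adjacent_intervals (hsub le_rfl h1.le (by linarith))
      (hsub h1.le h2.le h3.le),
    intervalIntegral.integral_add_adjacent_intervals (hsub le_rfl (by linarith) h3.le)
      (hsub (by linarith) h3.le le_rfl)]

end SLProblem

/-! ### The sampling theorem -/

lemma EntireOfExpType.const_mul {σ : ℝ} {f : ℂ → ℂ} (hf : EntireOfExpType σ f) (k : ℂ) :
    EntireOfExpType σ fun z => k * f z := by
  refine ⟨hf.1.const_mul k, fun η hη => ?_⟩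
  obtain ⟨C, hC⟩ := hf.2 η hη
  refine ⟨‖k‖ * C, fun z => ?_⟩
  rw [norm_mul, mul_assoc]
  exact mul_le_mul_of_nonneg_left (hC z) (norm_nonneg k)

lemma samplingFun_const_mul {f : ℂ → ℂ} {κ : ℂ} (hκ : κ ≠ 0) (c z : ℂ) :
    samplingFun (fun z => κ * f z) c z = samplingFun f c z := by
  rw [samplingFun, samplingFun, deriv_const_mul_field]
  split_ifs
  · rfl
  · rw [mul_left_comm, mul_div_mul_left _ _ hκ]

theorem theorem2 (P : SLProblem) (y₀ : ℝ) (hy₀ : y₀ ∈ P.I) (g : ℝ → ℂ)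
    (hg : MeasureTheory.MemLp g 2 (MeasureTheory.volume.restrict (Set.Ioo P.a P.b))) :
    -- the zeros of `ω` form a strictly increasing real sequence, with convergent canonical product
    ∃ lam : ℕ → ℝ, StrictMono lam ∧
      (∀ z : ℂ, P.omega z = 0 ↔ ∃ n, z = (lam n : ℂ)) ∧
      (∀ z : ℂ, Multipliable (canonicalFactor lam z)) ∧
      -- the regularizing factor is `ω` or its canonical product
      ∀ Ω : ℂ → ℂ, Ω = P.omega ∨ Ω = canonicalProduct lam →
        -- the zeros of `Ω` are simple, and multiplication by `Ω` removes the poles of `G(x, y₀, ·)`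
        (∀ n, deriv Ω (lam n : ℂ) ≠ 0) ∧
        (∀ x ∈ P.I, Differentiable ℂ (P.regGreen Ω y₀ x) ∧
          ∀ z : ℂ, P.omega z ≠ 0 → P.regGreen Ω y₀ x z = Ω z * P.green x y₀ z) ∧
        -- the integrals defining `F` exist
        (∀ z : ℂ, MeasureTheory.IntegrableOn
          (fun x => P.regGreen Ω y₀ x z * (starRingEnd ℂ) (g x)) (Set.Ioo P.a P.b)) ∧
        -- `F` is entire of exponential type `b - a`, even as a function of the square root of `z`
        EntireOfExpType (P.b - P.a) (P.transform Ω y₀ g) ∧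
        EntireOfExpType (P.b - P.a) (fun s => P.transform Ω y₀ g (s ^ 2)) ∧
        -- the sampling representation, absolutely convergent and uniformly so on compact sets
        (∀ z : ℂ, Summable fun n =>
          ‖P.transform Ω y₀ g (lam n : ℂ) * samplingFun Ω (lam n : ℂ) z‖) ∧
        (∀ z : ℂ, HasSum
          (fun n => P.transform Ω y₀ g (lam n : ℂ) * samplingFun Ω (lam n : ℂ) z)
          (P.transform Ω y₀ g z)) ∧
        (∀ K : Set ℂ, IsCompact K → TendstoUniformlyOn
          (fun (N : ℕ) (z : ℂ) => ∑ n ∈ Finset.range N,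
            P.transform Ω y₀ g (lam n : ℂ) * samplingFun Ω (lam n : ℂ) z)
          (P.transform Ω y₀ g) Filter.atTop K) := by
  set R := P.regular with hR
  have hinf : {l : ℝ | R.wr l = 0}.Infinite :=
    Set.infinite_coe_iff.1 (RegularSL.infinite_spec (R := R))
  obtain ⟨e, he⟩ := exists_strictMono_enumeration hinf RegularSL.finite_zeros_inter_Iic
  set lam : ℕ → ℝ := fun n => (e n : ℝ) with hlam
  have hl0 : ∀ n, R.wr (lam n) = 0 := fun n => (e n).2
  have hz : ∀ z : ℂ, R.wr z = 0 ↔ ∃ n, z = (lam n : ℂ) := fun z => by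
    refine ⟨fun h => ?_, fun ⟨n, hn⟩ => hn ▸ hl0 n⟩
    have hre : z = (z.re : ℂ) := Complex.ext rfl (by simpa using RegularSL.im_eq_zero_of_wr h)
    have hm : R.wr (z.re : ℂ) = 0 := hre ▸ h
    obtain ⟨n, hn⟩ := e.surjective ⟨z.re, hm⟩
    refine ⟨n, ?_⟩
    rw [hlam]
    simp only [hn]
    exact hre
  obtain ⟨C, c, hg'⟩ := RegularSL.exists_wr_growth (R := R)
  obtain ⟨hmult, κ, hκ, hprod⟩ := exists_eq_mul_canonicalProduct
    (RegularSL.differentiable_wr (R := R)) he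
    (tendsto_atTop_of_enumeration RegularSL.finite_zeros_inter_Iic he fun n => (e n).2) hz
    (fun n => RegularSL.deriv_wr_ne_zero (hl0 n)) hg'
  have hγ := SLProblem.γ_ne' (P := P)
  refine ⟨lam, he, fun z => ?_, hmult, fun Ω hΩ => ?_⟩
  · rw [SLProblem.omega_eq, mul_eq_zero, or_iff_right hγ]
    exact hz z
  -- Both choices of Ω are constant multiples of `wr`: k = γ for ω and k = κ⁻¹ for the canonical
  -- product.
  obtain ⟨k, hk, hΩk⟩ : ∃ k : ℂ, k ≠ 0 ∧ ∀ z, Ω z = k * R.wr z := by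
    rcases hΩ with rfl | rfl
    · exact ⟨P.γ, hγ, SLProblem.omega_eq⟩
    · exact ⟨κ⁻¹, inv_ne_zero hκ, fun z => by rw [hprod z, inv_mul_cancel_left₀ hκ]⟩
  have hΩf : Ω = fun z => k * R.wr z := funext hΩk
  have hy : y₀ ∈ Set.Icc R.a R.b := SLProblem.I_subset_Icc hy₀
  have hh : MemLp (P.weighted g) 2 R.vol := SLProblem.memLp_weighted hg
  have htr : P.transform Ω y₀ g = fun z => k / P.weight y₀ * R.trans y₀ (P.weighted g) z :=
    funext (SLProblem.transform_eq hΩk hy₀ hg)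
  have hterm : ∀ n z, P.transform Ω y₀ g (lam n : ℂ) * samplingFun Ω (lam n : ℂ) z =
      k / P.weight y₀ * RegularSL.samplingTerm y₀ (P.weighted g) (e n : R.Spec) z := fun n z => by
    rw [htr, hΩf, samplingFun_const_mul hk, RegularSL.samplingTerm, mul_assoc]
  have hbound : ∀ r : ℝ, ∃ u : ℕ → ℝ, Summable u ∧ ∀ n z, ‖z‖ ≤ r →
      ‖P.transform Ω y₀ g (lam n : ℂ) * samplingFun Ω (lam n : ℂ) z‖ ≤ u n := fun r => by
    obtain ⟨u, hu, hb⟩ := RegularSL.exists_samplingTerm_bound hh hy r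
    refine ⟨fun n => ‖k / P.weight y₀‖ * u (e n),
      ((Equiv.summable_iff e).2 hu).mul_left _, fun n z hz => ?_⟩
    rw [hterm, norm_mul]
    exact mul_le_mul_of_nonneg_left (hb _ z hz) (norm_nonneg _)
  have hsum : ∀ z : ℂ, HasSum
      (fun n => P.transform Ω y₀ g (lam n : ℂ) * samplingFun Ω (lam n : ℂ) z)
      (P.transform Ω y₀ g z) := fun z => by
    simp only [hterm]
    rw [htr]
    exact ((Equiv.hasSum_iff e).2 (RegularSL.hasSum_samplingTerm hh hy z)).mul_left _
  obtain ⟨ht1, ht2⟩ := RegularSL.entireOfExpType_trans hy (RegularSL.intervalIntegrable_of_memLp hh)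
  refine ⟨fun n => ?_, fun x hx => ⟨?_, fun z hzne => ?_⟩,
    SLProblem.integrableOn_regGreen_mul hΩk hy₀ hg, ?_, ?_, fun z => ?_, hsum, fun K hK => ?_⟩
  · rw [hΩf, deriv_const_mul_field]
    exact mul_ne_zero hk (RegularSL.deriv_wr_ne_zero (hl0 n))
  · rw [funext (SLProblem.regGreen_eq hΩk hx hy₀)]
    exact (SLProblem.differentiable_kernel y₀ x).const_mul _
  · have h1 := P.weight_ne x
    have h2 := P.weight_ne y₀
    have h3 : R.wr z ≠ 0 := fun h => hzne (by rw [SLProblem.omega_eq, ← hR, h, mul_zero])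
    rw [SLProblem.regGreen_eq hΩk hx hy₀, SLProblem.green_eq hx hy₀, hΩk, ← hR]
    field_simp
  · rw [htr]; exact ht1.const_mul _
  · rw [htr]; exact ht2.const_mul _
  · obtain ⟨u, hu, hb⟩ := hbound ‖z‖
    exact hu.of_nonneg_of_le (fun _ => norm_nonneg _) fun n => hb n z le_rfl
  · obtain ⟨r, hr⟩ := hK.isBounded.exists_norm_le
    obtain ⟨u, hu, hb⟩ := hbound r
    have := tendstoUniformlyOn_tsum_nat hu (s := K) fun n z hz => hb n z (hr z hz)
    exact this.congr_right fun z _ => (hsum z).tsum_eq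

end
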